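/- Let $a,b,t$ be real numbers with $a,b>0$, $t>1$ and $1/t<1/a<b<t$, and let $(v_1,\dots,v_8)=(-t,-a,-1/b,-1/t,1/t,1/a,b,t)$, an increasing sequence. For $\rho>0$ put, on the closed upper half-plane with principal square roots (boundary values taken from above), $$\phi_1=-\rho\,\frac{(z+a)^{1/2}(z+1/b)^{-1/2}(z-1/a)^{1/2}(z-b)^{-1/2}}{D(z)}\,dz,\qquad \phi_2=\frac1\rho\,\frac{(z+a)^{-1/2}(z+1/b)^{1/2}(z-1/a)^{-1/2}(z-b)^{1/2}}{D(z)}\,dz,\qquad dh=\frac{i}{D(z)}\,dz,$$ where $D(z)=(z+t)^{1/2}(z+1/t)^{1/2}(z-1/t)^{1/2}(z-t)^{1/2}$, and let $$X_\rho(z)=\operatorname{Re}\int_i^z\Big(\tfrac12(\phi_2-\phi_1),\ \tfrac i2(\phi_2+\phi_1),\ dh\Big),\qquad I_k=\Big|\int_{v_k}^{v_{k+1}}\phi_1\Big|,\quad J_k=\Big|\int_{v_k}^{v_{k+1}}\phi_2\Big|\quad(1\le k\le 7).$$ A *box octagon* with vertices $V_1,\dots,V_8$ is a compact embedded minimal disk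 $S\subset[-A,A]\times[-B,B]\times[-1,1]$ ($A,B>0$), regular up to its boundary except at the vertices, which lie on $\partial S$ in cyclic order, such that: the boundary edges $V_8V_1$ and $V_4V_5$ are the segments $\{(x,0,1):|x|\le A\}$ and $\{(x,0,-1):|x|\le A\}$; along the edges $V_1V_2$ and $V_3V_4$ (resp. $V_5V_6$ and $V_7V_8$) $S$ meets the plane $x=A$ (resp. $x=-A$) orthogonally, and along $V_2V_3$ (resp. $V_6V_7$) it meets the plane $y=-B$ (resp. $y=B$) orthogonally; $S$ meets the union of the edges of the box exactly in $\{V_1,\dots,V_8\}$ and is disjoint from the vertical lines $(x,y)=\pm(A,B)$; and $S=-S$. Let $\mathcal O$ be the set of all surfaces obtained from box octagons $S$ by repeated reflection in the planes $x=\pm A$, $y=\pm B$ and rotation by $\pi$ about the lines $y=0,\ z=\pm1$; $S$ is called the fundamental octagon of the surface so obtained. Then: 1. For all $\rho>0$ and $1\le k\le 7$, the integrals that define $I_k$ and $J_k$ converge absolutely, and $I_k,J_k>0$. 2. For every $\rho>0$, the closure of the image of the open upper half-plane under $X_\rho$, with vertices $V_k=X_\rho(v_k)$, is up to congruence and dilation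 of $\mathbb R^3$ the fundamental octagon of a surface in $\mathcal O$ if and only if the period conditions $$I_1+I_3=J_1+J_3,\qquad I_2=J_2$$ hold. 3. The quotients $Q_I=(I_1+I_3)/I_2$ and $Q_J=(J_1+J_3)/J_2$ depend only on $a,b,t$, not on $\rho$. Let $Q=Q_I-Q_J$. Then $Q_I=Q_J$ if and only if $Q=0$, if and only if the period conditions hold for some $\rho>0$; and if $Q=0$, there is exactly one $\rho>0$ for which the period conditions hold. -/

import Mathlib

open Set Metric

noncomputable section

/-- Euclidean three-space, with coordinates `p 0 = x`, `p 1 = y`, `p 2 = z`. -/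
abbrev E3 : Type := EuclideanSpace ℝ (Fin 3)

/-! ### The class of surfaces

An octagon is a minimal disk in the box `[-A,A] × [-B,B] × [-1,1]`.  Its vertices
`V₁, …, V₈` are indexed by `Fin 8`, so that `V k` is the vertex with number `k + 1`. -/

/-- The axes-parallel box `[-A,A] × [-B,B] × [-1,1]`. -/
def box (A B : ℝ) : Set E3 :=
  {p | |p 0| ≤ A ∧ |p 1| ≤ B ∧ |p 2| ≤ 1}

/-- The union of the twelve edges of the box. -/
def boxEdges (A B : ℝ) : Set E3 :=
  {p ∈ box A B | (|p 0| = A ∧ |p 1| = B) ∨ (|p 0| = A ∧ |p 2| = 1) ∨ (|p 1| = B ∧ |p 2| = 1)}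

/-- The interior of the horizontal segment `{(x, 0, h) : -A ≤ x ≤ A}`. -/
def openSegmentAt (A h : ℝ) : Set E3 :=
  {p | |p 0| < A ∧ p 1 = 0 ∧ p 2 = h}

/-- The point of the unit circle with angle `s`. -/
def circlePt (s : ℝ) : ℂ := Complex.exp (s * Complex.I)

/-- Eight consecutive corners on the unit circle are given by angles
`θ 0 < ⋯ < θ 7 < θ 8 = θ 0 + 2π`; `corner θ k` is the corner with index `k`. -/
def corner (θ : Fin 9 → ℝ) (k : Fin 8) : ℂ := circlePt (θ k.castSucc)

/-- The open circular arc between the corner with index `k` and the next one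
(for `k = 7`, the arc from the last corner back to the first). -/
def arc (θ : Fin 9 → ℝ) (k : Fin 8) : Set ℂ :=
  circlePt '' Ioo (θ k.castSucc) (θ k.succ)

/-- `u` is a conformal parametrization, by the closed unit disk, of a compact embedded minimal
disk with image `S`, continuous up to the boundary, and a `C¹` immersion up to the boundary
except possibly at the eight corners, which are sent to the vertices `V k`. -/
structure IsMinimalDisk (u : ℂ → E3) (θ : Fin 9 → ℝ) (S : Set E3) (V : Fin 8 → E3) : Prop where
  strictMono : StrictMono θ
  closes_up : θ 8 = θ 0 + 2 * Real.pi
  continuousOn : ContinuousOn u (closedBall 0 1)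
  injOn : InjOn u (closedBall 0 1)
  image_eq : u '' closedBall 0 1 = S
  harmonic : InnerProductSpace.HarmonicOnNhd u (ball 0 1)
  contDiffOn : ContDiffOn ℝ 1 u (closedBall 0 1 \ range (corner θ))
  conformal : ∀ z ∈ closedBall (0 : ℂ) 1 \ range (corner θ),
    IsConformalMap (fderivWithin ℝ u (closedBall 0 1) z)
  vertex : ∀ k, u (corner θ k) = V k

/-- Free boundary condition: the arc `γ` of the boundary is mapped into the plane
`{p : p i = c}`, and along it the surface meets that plane orthogonally, i.e. the tangent plane
of the surface contains the normal vector of `{p : p i = c}`. -/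
def FreeBoundary (u : ℂ → E3) (γ : Set ℂ) (i : Fin 3) (c : ℝ) : Prop :=
  ∀ z ∈ γ, u z i = c ∧
    EuclideanSpace.single i (1 : ℝ) ∈ range (fderivWithin ℝ u (closedBall 0 1) z)

/-- `S` is an embedded minimal octagon with vertices `V` in the box `[-A,A] × [-B,B] × [-1,1]`:
the edges `V₈V₁` and `V₄V₅` are the fixed segments `{(x, 0, ±1)}`, the other edges satisfy
the free boundary condition on the vertical faces, `S` meets the edges of the box exactly in the
eight vertices and misses the vertical lines over `±(A, B)`, and `S` is symmetric under
`p ↦ -p`. -/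
structure IsBoxOctagon (A B : ℝ) (S : Set E3) (V : Fin 8 → E3) : Prop where
  A_pos : 0 < A
  B_pos : 0 < B
  subset_box : S ⊆ box A B
  disk : ∃ (u : ℂ → E3) (θ : Fin 9 → ℝ), IsMinimalDisk u θ S V ∧
    FreeBoundary u (arc θ 0) 0 A ∧
    FreeBoundary u (arc θ 1) 1 (-B) ∧
    FreeBoundary u (arc θ 2) 0 A ∧
    u '' arc θ 3 = openSegmentAt A (-1) ∧
    FreeBoundary u (arc θ 4) 0 (-A) ∧
    FreeBoundary u (arc θ 5) 1 B ∧
    FreeBoundary u (arc θ 6) 0 (-A) ∧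
    u '' arc θ 7 = openSegmentAt A 1
  inter_edges : S ∩ boxEdges A B = range V
  disjoint_lines : ∀ p ∈ S, ¬ (p 0 = A ∧ p 1 = B) ∧ ¬ (p 0 = -A ∧ p 1 = -B)
  inversion : ∀ p ∈ S, -p ∈ S

/-- Reflection in the plane `x = c`. -/
def reflX (c : ℝ) (p : E3) : E3 := !₂[2 * c - p 0, p 1, p 2]

/-- Reflection in the plane `y = c`. -/
def reflY (c : ℝ) (p : E3) : E3 := !₂[p 0, 2 * c - p 1, p 2]

/-- Rotation by `π` about the line `y = 0, z = c`. -/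
def rotX (c : ℝ) (p : E3) : E3 := !₂[p 0, -p 1, 2 * c - p 2]

/-- The surface obtained from `S` by repeated reflection in the lateral faces of the box and
rotation about the two horizontal segments: the smallest set that contains `S` and is invariant
under these six involutions. -/
def extendedSurface (A B : ℝ) (S : Set E3) : Set E3 :=
  ⋂₀ {T | S ⊆ T ∧ ∀ p ∈ T, reflX A p ∈ T ∧ reflX (-A) p ∈ T ∧ reflY B p ∈ T ∧ reflY (-B) p ∈ T ∧
    rotX 1 p ∈ T ∧ rotX (-1) p ∈ T}

/-- `S`, with vertices `V`, is a fundamental octagon of the surface `M`. -/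
def IsFundamentalOctagonOf (S : Set E3) (V : Fin 8 → E3) (M : Set E3) : Prop :=
  ∃ A B : ℝ, IsBoxOctagon A B S V ∧ M = extendedSurface A B S

/-- The class `𝒪` of all triply periodic surfaces that are obtained from such octagons. -/
def classO : Set (Set E3) :=
  {M | ∃ (S : Set E3) (V : Fin 8 → E3), IsFundamentalOctagonOf S V M}

/-- Up to congruence and dilation, `S` with vertices `V` is the fundamental octagon of a surface
in the class `𝒪`. -/
def IsFundamentalOctagonUpToSimilarity (S : Set E3) (V : Fin 8 → E3) : Prop :=
  ∃ (c : ℝ) (T : E3 ≃ᵃⁱ[ℝ] E3), 0 < c ∧ ∃ M ∈ classO,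
    IsFundamentalOctagonOf ((fun p => T (c • p)) '' S) (fun k => T (c • V k)) M

/-! ### The Weierstrass data

All square roots are principal, so that they are holomorphic on the upper half-plane and take
their boundary values from above on the real axis.  -/

/-- The preimages `v₁ < ⋯ < v₈` of the vertices on the real axis. -/
def vtx (a b t : ℝ) : Fin 8 → ℝ := ![-t, -a, -1 / b, -1 / t, 1 / t, 1 / a, b, t]

/-- The common denominator of the three forms. -/
def wDenom (t : ℝ) (z : ℂ) : ℂ :=
  (z + t) ^ (1 / 2 : ℂ) * (z + 1 / t) ^ (1 / 2 : ℂ) * (z - 1 / t) ^ (1 / 2 : ℂ) *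
    (z - t) ^ (1 / 2 : ℂ)

/-- The form `φ₁ = G dh`, as a function times `dz`. -/
def phi1 (a b t ρ : ℝ) (z : ℂ) : ℂ :=
  -(ρ : ℂ) * ((z + a) ^ (1 / 2 : ℂ) * (z + 1 / b) ^ (-1 / 2 : ℂ) * (z - 1 / a) ^ (1 / 2 : ℂ) *
    (z - b) ^ (-1 / 2 : ℂ)) / wDenom t z

/-- The form `φ₂ = dh / G`, as a function times `dz`. -/
def phi2 (a b t ρ : ℝ) (z : ℂ) : ℂ :=
  (1 / (ρ : ℂ)) * ((z + a) ^ (-1 / 2 : ℂ) * (z + 1 / b) ^ (1 / 2 : ℂ) *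
    (z - 1 / a) ^ (-1 / 2 : ℂ) * (z - b) ^ (1 / 2 : ℂ)) / wDenom t z

/-- The height differential, as a function times `dz`. -/
def dh (t : ℝ) (z : ℂ) : ℂ := Complex.I / wDenom t z

/-- The integral of `f dz` along the straight segment from `i` to `z`. -/
def integralFromI (f : ℂ → ℂ) (z : ℂ) : ℂ :=
  ∫ s in (0 : ℝ)..1, f (Complex.I + s * (z - Complex.I)) * (z - Complex.I)

/-- The Weierstrass map
`z ↦ Re ∫ ((φ₂ - φ₁) / 2, i (φ₂ + φ₁) / 2, dh)`, with base point `i`. -/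
def weierstrassMap (a b t ρ : ℝ) (z : ℂ) : E3 :=
  !₂[(integralFromI (fun w => (phi2 a b t ρ w - phi1 a b t ρ w) / 2) z).re,
     (integralFromI (fun w => Complex.I / 2 * (phi2 a b t ρ w + phi1 a b t ρ w)) z).re,
     (integralFromI (dh t) z).re]

/-- The image of the upper half-plane under the Weierstrass map, together with its boundary. -/
def weierstrassImage (a b t ρ : ℝ) : Set E3 :=
  closure (weierstrassMap a b t ρ '' {z : ℂ | 0 < z.im})

/-- The images of the points `v₁, …, v₈`. -/
def weierstrassVertex (a b t ρ : ℝ) (k : Fin 8) : E3 :=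
  weierstrassMap a b t ρ (vtx a b t k)

/-! ### The periods

`edgeI a b t ρ k` and `edgeJ a b t ρ k` are the edge lengths with number `k + 1`, so that
`I₁, I₂, I₃` have indices `0, 1, 2`. -/

/-- The edge lengths `I₁, …, I₇` of the first Euclidean octagon. -/
def edgeI (a b t ρ : ℝ) (k : Fin 7) : ℝ :=
  ‖∫ x in (vtx a b t k.castSucc)..(vtx a b t k.succ), phi1 a b t ρ (x : ℂ)‖

/-- The edge lengths `J₁, …, J₇` of the second Euclidean octagon. -/
def edgeJ (a b t ρ : ℝ) (k : Fin 7) : ℝ :=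
  ‖∫ x in (vtx a b t k.castSucc)..(vtx a b t k.succ), phi2 a b t ρ (x : ℂ)‖

/-- The period conditions `I₁ + I₃ = J₁ + J₃` and `I₂ = J₂`. -/
def PeriodConditions (a b t ρ : ℝ) : Prop :=
  edgeI a b t ρ 0 + edgeI a b t ρ 2 = edgeJ a b t ρ 0 + edgeJ a b t ρ 2 ∧
    edgeI a b t ρ 1 = edgeJ a b t ρ 1

/-- `Q_I = (I₁ + I₃) / I₂`. -/
def quotI (a b t ρ : ℝ) : ℝ := (edgeI a b t ρ 0 + edgeI a b t ρ 2) / edgeI a b t ρ 1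

/-- `Q_J = (J₁ + J₃) / J₂`. -/
def quotJ (a b t ρ : ℝ) : ℝ := (edgeJ a b t ρ 0 + edgeJ a b t ρ 2) / edgeJ a b t ρ 1

/-- `Q = Q_I - Q_J`. -/
def quotQ (a b t ρ : ℝ) : ℝ := quotI a b t ρ - quotJ a b t ρ

end

/-! The Cayley transform carries the forms to the unit disk. It turns z ↦ -1/z into ζ ↦ -ζ, so the
eight vertices become four antipodal pairs. Each form becomes a constant times a product of
principal powers of 1 - ζ²/d with |d| = 1, whose bases stay off the branch cut
(`Admissible.form_eq`). These products are even, so their primitives are odd, and this is the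
symmetry S = -S. They grow at most like an inverse square root at the circle (`HalfSingular`), so
the primitives extend continuously to the closed disk, and the closure of the Weierstrass image is
the image of that disk.

On each real interval between consecutive vertices the three forms have constant directions
(`Admissible.edge_forms`). This gives convergence and positivity of the edge lengths, places each
edge in a plane or on a line, and expresses the steps between consecutive vertices by I and J
(`surf_edge`). The step V₁V₂ has no x-component, V₂V₃ no y-component, V₃V₄ no x-component. The
period conditions thus say exactly that V₁ and V₄ lie over the same point of the (x,y)-plane.

Necessity: a similarity need not respect the coordinate axes, so the argument uses angles and
parallelism only. In a box octagon V₄ - V₁ and V₃ - V₂ are vertical, and V₁ - V₈ is perpendicular to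
the vertical. For the Weierstrass vertices V₁ - V₈ is a nonzero multiple of the x-direction, while
V₃ - V₂ has nonzero height and no y-component. Orthogonality removes the x-component of V₄ - V₁, and
parallelism removes its y-component.

Sufficiency: what remains is embeddedness and containment in the box. In terms of w = z - 1/z, which
also lies in the upper half-plane, one sees that Re(z dh/dz) > 0 (`Admissible.dh_mul_re_pos`) and
that the Gauss map φ₁/dh has values in the open first quadrant (`Admissible.gauss_mem_quadrant`).
The height therefore increases along every ray from 0. Each level strictly between the horizontal
edges is a curve meeting every ray once, along which x increases and y decreases strictly
(`exists_level_curve`). Injectivity follows at once. The box bounds reduce to the ends of the level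
curves on the negative real axis, where the sign of each derivative is governed by a monotone real
function (`left_boundary`), and the bounds on the other side follow by the symmetry.

Finally I scales by ρ and J by ρ⁻¹. The quotients do not change, and once they agree the period
conditions amount to ρ² = J₂/I₂ with the right side taken at ρ = 1 (`periodConditions_iff`). -/

noncomputable section

open Filter Topology

/-! ### Primitives on the punctured closed disk -/

/-- The primitive of `F` that is obtained by integrating along the radii of the unit disk. -/
def radialPrimitive (F : ℂ → ℂ) (ζ : ℂ) : ℂ := ∫ s in (0 : ℝ)..1, F (s * ζ) * ζ

/-- `F` is holomorphic on the closed unit disk without the boundary points `P`, and grows at most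
like the inverse square root of the distance to the boundary. -/
structure HalfSingular (P : Set ℂ) (F : ℂ → ℂ) : Prop where
  subset_sphere : P ⊆ sphere 0 1
  differentiableOn : DifferentiableOn ℂ F (closedBall 0 1 \ P)
  bound : ∃ K : ℝ, ∀ ζ ∈ ball (0 : ℂ) 1, ‖F ζ‖ ≤ K * (1 - ‖ζ‖) ^ (-1 / 2 : ℝ)

/-- The disk is strictly convex, so an open segment between two distinct points avoids the whole
circle, and with it P. Convexity is what supplies a primitive on the punctured closed disk. -/
lemma convex_closedBall_diff {P : Set ℂ} (hP : P ⊆ sphere (0 : ℂ) 1) :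
    Convex ℝ (closedBall (0 : ℂ) 1 \ P) := by
  rw [convex_iff_openSegment_subset]
  intro x hx y hy
  rcases eq_or_ne x y with rfl | hxy
  · simpa using hx
  have h := (strictConvex_closedBall ℝ (0 : ℂ) 1).openSegment_subset hx.1 hy.1 hxy
  rw [interior_closedBall _ one_ne_zero] at h
  intro z hz
  refine ⟨ball_subset_closedBall (h hz), fun hzP => ?_⟩
  have h1 := h hz
  have h2 := hP hzP
  rw [mem_ball] at h1
  rw [mem_sphere] at h2
  linarith

lemma ball_subset_diff {P : Set ℂ} (hP : P ⊆ sphere (0 : ℂ) 1) :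
    ball (0 : ℂ) 1 ⊆ closedBall 0 1 \ P := by
  intro z hz
  refine ⟨ball_subset_closedBall hz, fun hzP => ?_⟩
  have h2 := hP hzP
  rw [mem_ball] at hz
  rw [mem_sphere] at h2
  linarith

lemma norm_smul_lt_one {s : ℝ} {ζ : ℂ} (hs0 : 0 ≤ s) (hs1 : s < 1) (hζ : ‖ζ‖ ≤ 1) :
    ‖(s : ℂ) * ζ‖ ≤ s ∧ (s : ℂ) * ζ ∈ ball (0 : ℂ) 1 := by
  have h : ‖(s : ℂ) * ζ‖ ≤ s := by
    rw [norm_mul, Complex.norm_real, Real.norm_of_nonneg hs0]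
    exact mul_le_of_le_one_right hs0 hζ
  exact ⟨h, by rw [mem_ball_zero_iff]; linarith⟩

/-- The dominating function for all integrals along radii and along segments from i. -/
lemma intervalIntegrable_one_sub_rpow :
    IntervalIntegrable (fun s : ℝ => (1 - s) ^ (-1 / 2 : ℝ)) MeasureTheory.volume 0 1 := by
  have h : IntervalIntegrable (fun s : ℝ => s ^ (-1 / 2 : ℝ)) MeasureTheory.volume 0 1 :=
    intervalIntegral.intervalIntegrable_rpow' (by norm_num)
  simpa using (h.comp_sub_left 1).symm

lemma rpow_neg_half_anti {x y : ℝ} (hx : 0 < x) (hxy : x ≤ y) :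
    y ^ (-1 / 2 : ℝ) ≤ x ^ (-1 / 2 : ℝ) :=
  Real.rpow_le_rpow_of_nonpos hx hxy (by norm_num)

namespace HalfSingular

variable {P : Set ℂ} {F G : ℂ → ℂ}

lemma bound_nonneg (h : HalfSingular P F) :
    ∃ K : ℝ, 0 ≤ K ∧ ∀ ζ ∈ ball (0 : ℂ) 1, ‖F ζ‖ ≤ K * (1 - ‖ζ‖) ^ (-1 / 2 : ℝ) := by
  obtain ⟨K, hK⟩ := h.bound
  refine ⟨K, ?_, hK⟩
  -- At the centre the bound reads ‖F 0‖ ≤ K, which forces K ≥ 0.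
  have := hK 0 (by simp)
  simp at this
  exact (norm_nonneg _).trans this

lemma const_mul (h : HalfSingular P F) (c : ℂ) : HalfSingular P (fun ζ => c * F ζ) := by
  refine ⟨h.subset_sphere, h.differentiableOn.const_mul c, ?_⟩
  obtain ⟨K, hK⟩ := h.bound
  refine ⟨‖c‖ * K, fun ζ hζ => ?_⟩
  rw [norm_mul, mul_assoc]
  exact mul_le_mul_of_nonneg_left (hK ζ hζ) (norm_nonneg _)

lemma add (h : HalfSingular P F) (h' : HalfSingular P G) :
    HalfSingular P (fun ζ => F ζ + G ζ) := by
  refine ⟨h.subset_sphere, h.differentiableOn.add h'.differentiableOn, ?_⟩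
  obtain ⟨K, hK⟩ := h.bound
  obtain ⟨L, hL⟩ := h'.bound
  refine ⟨K + L, fun ζ hζ => ?_⟩
  rw [add_mul]
  exact (norm_add_le _ _).trans (add_le_add (hK ζ hζ) (hL ζ hζ))

lemma continuousOn_radius (h : HalfSingular P F) {ζ : ℂ} (hζ : ‖ζ‖ ≤ 1) :
    ContinuousOn (fun s : ℝ => F (s * ζ) * ζ) (Ioo 0 1) := by
  have h1 : ContinuousOn (fun s : ℝ => (s : ℂ) * ζ) (Ioo 0 1) := by fun_prop
  refine (h.differentiableOn.continuousOn.comp h1 fun s hs => ?_).mul continuousOn_const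
  exact ball_subset_diff h.subset_sphere (norm_smul_lt_one hs.1.le hs.2 hζ).2

lemma radius_bound {K : ℝ} (hK0 : 0 ≤ K)
    (hK : ∀ ζ ∈ ball (0 : ℂ) 1, ‖F ζ‖ ≤ K * (1 - ‖ζ‖) ^ (-1 / 2 : ℝ)) {ζ : ℂ} (hζ : ‖ζ‖ ≤ 1)
    {s : ℝ} (hs0 : 0 ≤ s) (hs1 : s < 1) :
    ‖F (s * ζ) * ζ‖ ≤ K * (1 - s) ^ (-1 / 2 : ℝ) := by
  obtain ⟨h1, h2⟩ := norm_smul_lt_one hs0 hs1 hζ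
  rw [norm_mul]
  refine (mul_le_of_le_one_right (norm_nonneg _) hζ).trans ((hK _ h2).trans ?_)
  exact mul_le_mul_of_nonneg_left (rpow_neg_half_anti (by linarith) (by linarith)) hK0

lemma ae_ne_one : ∀ᵐ s : ℝ, s ≠ 1 := by
  simp [MeasureTheory.ae_iff]

lemma aestronglyMeasurable_radius (h : HalfSingular P F) {ζ : ℂ} (hζ : ‖ζ‖ ≤ 1) :
    MeasureTheory.AEStronglyMeasurable (fun s : ℝ => F (s * ζ) * ζ)
      (MeasureTheory.volume.restrict (uIoc 0 1)) := by
  rw [uIoc_of_le zero_le_one, ← MeasureTheory.Measure.restrict_congr_set MeasureTheory.Ioo_ae_eq_Ioc]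
  exact (h.continuousOn_radius hζ).aestronglyMeasurable measurableSet_Ioo

lemma intervalIntegrable_radius (h : HalfSingular P F) {ζ : ℂ} (hζ : ‖ζ‖ ≤ 1) :
    IntervalIntegrable (fun s : ℝ => F (s * ζ) * ζ) MeasureTheory.volume 0 1 := by
  obtain ⟨K, hK0, hK⟩ := h.bound_nonneg
  refine (intervalIntegrable_one_sub_rpow.const_mul K).mono_fun (h.aestronglyMeasurable_radius hζ) ?_
  rw [uIoc_of_le zero_le_one, Filter.EventuallyLE, MeasureTheory.ae_restrict_iff' measurableSet_Ioc]
  filter_upwards [ae_ne_one] with s hs hs'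
  exact (radius_bound hK0 hK hζ hs'.1.le (lt_of_le_of_ne hs'.2 hs)).trans (le_abs_self _)

/-- Dominated convergence: at parameter s the integrand is at most K(1 - s)^(-1/2), whichever
endpoint the radius has, corners included. -/
lemma continuousOn_radialPrimitive (h : HalfSingular P F) :
    ContinuousOn (radialPrimitive F) (closedBall 0 1) := by
  intro ζ₀ hζ₀
  obtain ⟨K, hK0, hK⟩ := h.bound_nonneg
  refine intervalIntegral.continuousWithinAt_of_dominated_interval
    (bound := fun s => K * (1 - s) ^ (-1 / 2 : ℝ)) ?_ ?_
    (intervalIntegrable_one_sub_rpow.const_mul K) ?_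
  · filter_upwards [self_mem_nhdsWithin] with ζ hζ
    exact h.aestronglyMeasurable_radius (by simpa using hζ)
  · filter_upwards [self_mem_nhdsWithin] with ζ hζ
    filter_upwards [ae_ne_one] with s hs hs'
    rw [uIoc_of_le zero_le_one] at hs'
    exact radius_bound hK0 hK (by simpa using hζ) hs'.1.le (lt_of_le_of_ne hs'.2 hs)
  · filter_upwards [ae_ne_one] with s hs hs'
    rw [uIoc_of_le zero_le_one] at hs'
    have h1 : ContinuousWithinAt (fun ζ : ℂ => (s : ℂ) * ζ) (closedBall 0 1) ζ₀ := by fun_prop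
    have hm : MapsTo (fun ζ : ℂ => (s : ℂ) * ζ) (closedBall 0 1) (closedBall 0 1 \ P) :=
      fun ζ hζ => ball_subset_diff h.subset_sphere
        (norm_smul_lt_one hs'.1.le (lt_of_le_of_ne hs'.2 hs) (by simpa using hζ)).2
    exact ((h.differentiableOn.continuousOn _ (hm hζ₀)).comp h1 hm).mul continuousWithinAt_id

/-- On the convex punctured disk F has some primitive g. The fundamental theorem of calculus along
radii identifies the radial primitive with g - g 0, so the derivative exists up to the boundary away
from P. -/
lemma hasDerivWithinAt_radialPrimitive (h : HalfSingular P F) {ζ : ℂ}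
    (hζ : ζ ∈ closedBall (0 : ℂ) 1 \ P) :
    HasDerivWithinAt (radialPrimitive F) (F ζ) (closedBall 0 1 \ P) ζ := by
  have hconv := convex_closedBall_diff h.subset_sphere
  obtain ⟨g, hg⟩ := hconv.exists_forall_hasDerivWithinAt h.differentiableOn
  have h0 : (0 : ℂ) ∈ closedBall (0 : ℂ) 1 \ P := ball_subset_diff h.subset_sphere (by simp)
  have key : ∀ ξ ∈ closedBall (0 : ℂ) 1 \ P, radialPrimitive F ξ = g ξ - g 0 := by
    intro ξ hξ
    have hξ1 : ‖ξ‖ ≤ 1 := by simpa using hξ.1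
    have hmem : ∀ s ∈ Icc (0 : ℝ) 1, (s : ℂ) * ξ ∈ closedBall (0 : ℂ) 1 \ P := by
      intro s hs
      have := hconv h0 hξ (sub_nonneg.2 hs.2) hs.1 (by ring)
      simpa using this
    have h2 := intervalIntegral.integral_eq_sub_of_hasDerivAt_of_le (f := fun s : ℝ => g (s * ξ))
      (f' := fun s : ℝ => F (s * ξ) * ξ) zero_le_one ?_ ?_ (h.intervalIntegrable_radius hξ1)
    · simpa [radialPrimitive] using h2
    · have h3 : ContinuousOn (fun s : ℝ => (s : ℂ) * ξ) (Icc 0 1) := by fun_prop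
      have h7 : ContinuousOn g (closedBall (0 : ℂ) 1 \ P) := fun x hx => (hg x hx).continuousWithinAt
      exact h7.comp h3 hmem
    · intro s hs
      have h4 : HasDerivAt (fun s : ℝ => (s : ℂ) * ξ) ξ s := by
        simpa using (Complex.ofRealCLM.hasDerivAt (x := s)).mul_const ξ
      have h5 := (norm_smul_lt_one hs.1.le hs.2 hξ1).2
      have h6 : HasDerivAt g (F (s * ξ)) (s * ξ) :=
        (hg _ (hmem s ⟨hs.1.le, hs.2.le⟩)).hasDerivAt
          (mem_of_superset (isOpen_ball.mem_nhds h5) (ball_subset_diff h.subset_sphere))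
      exact h6.comp s h4
  exact ((hg ζ hζ).sub_const (g 0)).congr key (key ζ hζ)

lemma hasDerivAt_radialPrimitive (h : HalfSingular P F) {ζ : ℂ} (hζ : ζ ∈ ball (0 : ℂ) 1) :
    HasDerivAt (radialPrimitive F) (F ζ) ζ :=
  (h.hasDerivWithinAt_radialPrimitive (ball_subset_diff h.subset_sphere hζ)).hasDerivAt
    (mem_of_superset (isOpen_ball.mem_nhds hζ) (ball_subset_diff h.subset_sphere))

lemma radialPrimitive_const_mul (c ζ : ℂ) :
    radialPrimitive (fun ζ => c * F ζ) ζ = c * radialPrimitive F ζ := by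
  simp only [radialPrimitive, mul_assoc]
  exact intervalIntegral.integral_const_mul _ _

lemma radialPrimitive_add (h : HalfSingular P F) (h' : HalfSingular P G) {ζ : ℂ} (hζ : ‖ζ‖ ≤ 1) :
    radialPrimitive (fun ζ => F ζ + G ζ) ζ = radialPrimitive F ζ + radialPrimitive G ζ := by
  simp only [radialPrimitive, add_mul]
  exact intervalIntegral.integral_add (h.intervalIntegrable_radius hζ)
    (h'.intervalIntegrable_radius hζ)

end HalfSingular

/-- This is the source of the central symmetry of the surface. -/
lemma radialPrimitive_neg_of_even {F : ℂ → ℂ} (hF : ∀ ζ, F (-ζ) = F ζ) (ζ : ℂ) :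
    radialPrimitive F (-ζ) = -radialPrimitive F ζ := by
  simp only [radialPrimitive, mul_neg, hF]
  exact intervalIntegral.integral_neg

/-! ### The Cayley transform -/

/-- The Cayley transform from the upper half-plane to the unit disk. -/
def cayley (z : ℂ) : ℂ := (z - Complex.I) / (z + Complex.I)

lemma add_I_ne_zero {z : ℂ} (hz : 0 ≤ z.im) : z + Complex.I ≠ 0 := by
  intro h
  have := congrArg Complex.im h
  simp at this
  linarith

lemma cayley_I : cayley Complex.I = 0 := by simp [cayley]

/-- It decides at once which points go to the disk or to the circle, and it bounds the distance to
the circle along a path in the half-plane. -/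
lemma one_sub_normSq_cayley {z : ℂ} (hz : 0 ≤ z.im) :
    1 - ‖cayley z‖ ^ 2 = 4 * z.im / ‖z + Complex.I‖ ^ 2 := by
  have h := add_I_ne_zero hz
  have h' : ‖z + Complex.I‖ ^ 2 ≠ 0 := by positivity
  rw [cayley, norm_div, div_pow, eq_div_iff h', sub_mul, div_mul_cancel₀ _ h']
  rw [Complex.sq_norm, Complex.sq_norm, Complex.normSq_apply, Complex.normSq_apply]
  simp
  ring

lemma cayley_mem_closedBall {z : ℂ} (hz : 0 ≤ z.im) : cayley z ∈ closedBall (0 : ℂ) 1 := by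
  have h := one_sub_normSq_cayley hz
  have h2 : 0 ≤ 4 * z.im / ‖z + Complex.I‖ ^ 2 := by positivity
  rw [mem_closedBall_zero_iff]
  nlinarith [norm_nonneg (cayley z)]

lemma cayley_mem_ball {z : ℂ} (hz : 0 < z.im) : cayley z ∈ ball (0 : ℂ) 1 := by
  have h := one_sub_normSq_cayley hz.le
  have h1 := add_I_ne_zero hz.le
  have h2 : 0 < 4 * z.im / ‖z + Complex.I‖ ^ 2 := by positivity
  rw [mem_ball_zero_iff]
  nlinarith [norm_nonneg (cayley z)]

lemma hasDerivAt_cayley {z : ℂ} (hz : 0 ≤ z.im) :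
    HasDerivAt cayley (2 * Complex.I / (z + Complex.I) ^ 2) z := by
  have h := add_I_ne_zero hz
  have h1 := ((hasDerivAt_id z).sub_const Complex.I).div ((hasDerivAt_id z).add_const Complex.I) h
  refine h1.congr_deriv ?_
  simp only [id]
  ring

lemma cayley_sub_cayley {z w : ℂ} (hz : 0 ≤ z.im) (hw : 0 ≤ w.im) :
    cayley z - cayley w = 2 * Complex.I * (z - w) / ((z + Complex.I) * (w + Complex.I)) := by
  have h1 := add_I_ne_zero hz
  have h2 := add_I_ne_zero hw
  rw [cayley, cayley]
  field_simp
  ring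

lemma cayley_injOn : InjOn cayley {z | 0 ≤ z.im} := by
  intro z hz w hw h
  have h3 := cayley_sub_cayley hz hw
  rw [h, sub_self, eq_comm, div_eq_zero_iff] at h3
  rcases h3 with h3 | h3
  · simpa [sub_eq_zero] using h3
  · rcases mul_eq_zero.1 h3 with h4 | h4
    exacts [absurd h4 (add_I_ne_zero hz), absurd h4 (add_I_ne_zero hw)]

/-- The preimage is i(1 + ζ)/(1 - ζ); the excluded point ζ = 1 corresponds to z = ∞. -/
lemma exists_cayley_eq {ζ : ℂ} (hζ : ζ ∈ closedBall (0 : ℂ) 1) (h1 : ζ ≠ 1) :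
    ∃ z : ℂ, 0 ≤ z.im ∧ cayley z = ζ ∧ (ζ ∈ ball (0 : ℂ) 1 → 0 < z.im) ∧
      (ζ ∈ sphere (0 : ℂ) 1 → z.im = 0) := by
  have h : 1 - ζ ≠ 0 := sub_ne_zero.2 (Ne.symm h1)
  have hn : 0 < Complex.normSq (1 - ζ) := Complex.normSq_pos.2 h
  have him : (Complex.I * (1 + ζ) / (1 - ζ)).im = (1 - ‖ζ‖ ^ 2) / Complex.normSq (1 - ζ) := by
    rw [Complex.div_im, Complex.sq_norm, Complex.normSq_apply ζ]
    simp
    field_simp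
    ring
  refine ⟨Complex.I * (1 + ζ) / (1 - ζ), ?_, ?_, ?_, ?_⟩
  · rw [him]
    have : ‖ζ‖ ≤ 1 := by simpa using hζ
    have : 0 ≤ 1 - ‖ζ‖ ^ 2 := by nlinarith [norm_nonneg ζ]
    positivity
  · have h2 : Complex.I * (1 + ζ) / (1 - ζ) + Complex.I ≠ 0 := by
      have : Complex.I * (1 + ζ) / (1 - ζ) + Complex.I = 2 * Complex.I / (1 - ζ) := by
        field_simp; ring
      rw [this]
      simp [h]
    rw [cayley, div_eq_iff h2]
    field_simp
    ring
  · intro hb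
    rw [him]
    have : ‖ζ‖ < 1 := by simpa using hb
    have : 0 < 1 - ‖ζ‖ ^ 2 := by nlinarith [norm_nonneg ζ]
    positivity
  · intro hs
    have : ‖ζ‖ = 1 := by simpa using hs
    rw [him, this]
    simp

/-- The integral over the segment from `i` of a form on the upper half-plane, in terms of the
corresponding form on the disk. -/
lemma HalfSingular.integralFromI_eq {P : Set ℂ} {F : ℂ → ℂ} (h : HalfSingular P F) {f : ℂ → ℂ}
    (hf : ∀ z : ℂ, 0 < z.im → f z = F (cayley z) * (2 * Complex.I / (z + Complex.I) ^ 2)) {z : ℂ}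
    (hz : 0 ≤ z.im) : integralFromI f z = radialPrimitive F (cayley z) := by
  set γ : ℝ → ℂ := fun s => Complex.I + s * (z - Complex.I) with hγ
  have hγim : ∀ s : ℝ, (γ s).im = (1 - s) + s * z.im := by
    intro s
    simp [hγ]
    ring
  have hγd : ∀ s : ℝ, HasDerivAt γ (z - Complex.I) s := by
    intro s
    have := ((Complex.ofRealCLM.hasDerivAt (x := s)).mul_const (z - Complex.I)).const_add Complex.I
    exact this.congr_deriv (by simp)
  have hγc : Continuous γ := continuous_iff_continuousAt.2 fun s => (hγd s).continuousAt
  have hpos : ∀ s ∈ Ioo (0 : ℝ) 1, 0 < (γ s).im := by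
    intro s hs
    rw [hγim]
    have := mul_nonneg hs.1.le hz
    linarith [hs.2]
  have hnn : ∀ s ∈ Icc (0 : ℝ) 1, 0 ≤ (γ s).im := by
    intro s hs
    rw [hγim]
    have := mul_nonneg hs.1 hz
    linarith [hs.2]
  have hcay : ContinuousOn (fun s => cayley (γ s)) (Icc 0 1) := fun s hs =>
    ((hasDerivAt_cayley (hnn s hs)).continuousAt.comp hγc.continuousAt).continuousWithinAt
  have hcont : ContinuousOn (fun s => f (γ s) * (z - Complex.I)) (Ioo (0 : ℝ) 1) := by
    have h1 : ContinuousOn (fun s => F (cayley (γ s)) * (2 * Complex.I / (γ s + Complex.I) ^ 2) *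
        (z - Complex.I)) (Ioo (0 : ℝ) 1) := by
      refine ((h.differentiableOn.continuousOn.comp (hcay.mono Ioo_subset_Icc_self) fun s hs =>
        ball_subset_diff h.subset_sphere (cayley_mem_ball (hpos s hs))).mul ?_).mul
        continuousOn_const
      refine continuousOn_const.div (by fun_prop) fun s hs => ?_
      exact pow_ne_zero 2 (add_I_ne_zero (hpos s hs).le)
    exact h1.congr fun s hs => by simp only [hf _ (hpos s hs)]
  obtain ⟨K, hK0, hK⟩ := h.bound_nonneg
  have hint : IntervalIntegrable (fun s => f (γ s) * (z - Complex.I)) MeasureTheory.volume 0 1 := by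
    -- M bounds |γ s + i| along the whole segment, which keeps the distance to the circle comparable
    -- with 1 - s.
    set M : ℝ := ‖z‖ + 3 with hM
    have hM0 : 0 < M := by positivity
    refine (intervalIntegrable_one_sub_rpow.const_mul
      (K * ((2 / M ^ 2) ^ (-1 / 2 : ℝ)) * 2 * ‖z - Complex.I‖)).mono_fun ?_ ?_
    · rw [uIoc_of_le zero_le_one,
        ← MeasureTheory.Measure.restrict_congr_set MeasureTheory.Ioo_ae_eq_Ioc]
      exact hcont.aestronglyMeasurable measurableSet_Ioo
    · rw [uIoc_of_le zero_le_one, Filter.EventuallyLE,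
        MeasureTheory.ae_restrict_iff' measurableSet_Ioc]
      filter_upwards [HalfSingular.ae_ne_one] with s hs hs'
      have hsI : s ∈ Ioo (0 : ℝ) 1 := ⟨hs'.1, lt_of_le_of_ne hs'.2 hs⟩
      have him := hpos s hsI
      have hs1 : 0 < 1 - s := by linarith [hsI.2]
      have hne := add_I_ne_zero him.le
      have hnle : 1 ≤ ‖γ s + Complex.I‖ := by
        have := Complex.abs_im_le_norm (γ s + Complex.I)
        rw [Complex.add_im, Complex.I_im, abs_of_pos (by linarith)] at this
        linarith
      have hMle : ‖γ s + Complex.I‖ ≤ M := by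
        have e : γ s + Complex.I = ((2 - s : ℝ) : ℂ) * Complex.I + s * z := by
          simp [hγ]; ring
        rw [e]
        refine (norm_add_le _ _).trans ?_
        rw [norm_mul, norm_mul, Complex.norm_real, Complex.norm_real, Complex.norm_I,
          Real.norm_of_nonneg (by linarith), Real.norm_of_nonneg hsI.1.le]
        have := mul_le_of_le_one_left (norm_nonneg z) hsI.2.le
        linarith [hsI.1]
      -- Since Im γ(s) ≥ 1 - s, the Cayley image stays at distance at least a multiple of 1 - s from
      -- the circle. The passage from 1 - |ζ|² to 1 - |ζ| costs a factor 2.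
      have hb : 2 / M ^ 2 * (1 - s) ≤ 1 - ‖cayley (γ s)‖ := by
        have e1 := one_sub_normSq_cayley him.le
        have e2 : 4 / M ^ 2 * (1 - s) ≤ 4 * (γ s).im / ‖γ s + Complex.I‖ ^ 2 := by
          rw [div_mul_eq_mul_div]
          have : 1 - s ≤ (γ s).im := by
            rw [hγim]
            linarith [mul_nonneg hsI.1.le hz]
          gcongr
        have e3 : 2 / M ^ 2 = (4 / M ^ 2) / 2 := by ring
        have e4 : ‖cayley (γ s)‖ < 1 := by simpa using cayley_mem_ball him
        rw [e3]
        nlinarith [norm_nonneg (cayley (γ s))]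
      have hF : ‖F (cayley (γ s))‖ ≤ K * (((2 / M ^ 2) ^ (-1 / 2 : ℝ)) * (1 - s) ^ (-1 / 2 : ℝ)) := by
        refine (hK _ (cayley_mem_ball him)).trans (mul_le_mul_of_nonneg_left ?_ hK0)
        rw [← Real.mul_rpow (by positivity) hs1.le]
        exact rpow_neg_half_anti (by positivity) hb
      refine le_trans ?_ (le_abs_self _)
      rw [hf _ him, norm_mul, norm_mul, norm_div, norm_pow]
      have h2 : ‖2 * Complex.I‖ / ‖γ s + Complex.I‖ ^ 2 ≤ 2 := by
        rw [norm_mul, Complex.norm_I, Complex.norm_ofNat, mul_one]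
        exact div_le_self (by norm_num) (one_le_pow₀ hnle)
      calc ‖F (cayley (γ s))‖ * (‖2 * Complex.I‖ / ‖γ s + Complex.I‖ ^ 2) * ‖z - Complex.I‖
          ≤ K * (((2 / M ^ 2) ^ (-1 / 2 : ℝ)) * (1 - s) ^ (-1 / 2 : ℝ)) * 2 * ‖z - Complex.I‖ := by
            gcongr
        _ = _ := by ring
  have h2 := intervalIntegral.integral_eq_sub_of_hasDerivAt_of_le
    (f := fun s => radialPrimitive F (cayley (γ s))) (f' := fun s => f (γ s) * (z - Complex.I))
    zero_le_one ?_ ?_ hint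
  · have e0 : γ 0 = Complex.I := by simp [hγ]
    have e1 : γ 1 = z := by simp [hγ]
    have e2 : radialPrimitive F 0 = 0 := by simp [radialPrimitive]
    simpa [integralFromI, e0, e1, cayley_I, e2] using h2
  · exact h.continuousOn_radialPrimitive.comp hcay fun s hs => cayley_mem_closedBall (hnn s hs)
  · intro s hs
    have h3 := (h.hasDerivAt_radialPrimitive (cayley_mem_ball (hpos s hs))).comp_of_eq
      (γ s) (hasDerivAt_cayley (hpos s hs).le) rfl
    have h4 := h3.scomp_of_eq s (hγd s) rfl
    refine h4.congr_deriv ?_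
    rw [hf _ (hpos s hs), smul_eq_mul]
    ring

end

noncomputable section

open Filter Topology

/-! ### Products of powers on the disk -/

/-- The even function `∏ (1 - ζ² / d k) ^ e k` on the unit disk. -/
def evenProduct (d : Fin 4 → ℂ) (e : Fin 4 → ℝ) (ζ : ℂ) : ℂ :=
  ∏ k, (1 - ζ ^ 2 / d k) ^ (e k : ℂ)

lemma evenProduct_neg (d : Fin 4 → ℂ) (e : Fin 4 → ℝ) (ζ : ℂ) :
    evenProduct d e (-ζ) = evenProduct d e ζ := by
  simp [evenProduct]

/-- The points of the unit circle at which a factor of `evenProduct d e` vanishes. -/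
def squareRoots (d : Fin 4 → ℂ) : Set ℂ := {ζ | ∃ k, ζ ^ 2 = d k}

/-- In the closed unit disk the real part of w reaches 1 only at w = 1, so otherwise 1 - w has
positive real part. Principal powers therefore raise no branch question on the disk. -/
lemma one_sub_mem_slitPlane {w : ℂ} (hw : ‖w‖ ≤ 1) (h1 : w ≠ 1) : 1 - w ∈ Complex.slitPlane := by
  left
  rw [Complex.sub_re, Complex.one_re, sub_pos]
  refine lt_of_le_of_ne ((Complex.re_le_norm w).trans hw) fun h => h1 ?_
  have h2 : w.re ^ 2 + w.im ^ 2 ≤ 1 := by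
    have := Complex.sq_norm w
    rw [Complex.normSq_apply] at this
    nlinarith [norm_nonneg w]
  have h3 : w.im = 0 := by
    rw [h] at h2
    nlinarith [sq_nonneg w.im]
  exact Complex.ext (by simpa using h) (by simpa using h3)

section

variable {d : Fin 4 → ℂ} (hd : ∀ k, ‖d k‖ = 1)

include hd

lemma one_sub_sq_div_mem_slitPlane {ζ : ℂ} (hζ : ζ ∈ closedBall (0 : ℂ) 1 \ squareRoots d)
    (k : Fin 4) : 1 - ζ ^ 2 / d k ∈ Complex.slitPlane := by
  have hk : d k ≠ 0 := fun h => by simpa [h] using hd k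
  have h1 : ‖ζ‖ ≤ 1 := by simpa using hζ.1
  refine one_sub_mem_slitPlane ?_ fun h => hζ.2 ⟨k, ?_⟩
  · rw [norm_div, hd, div_one, norm_pow]
    exact pow_le_one₀ (norm_nonneg _) h1
  · rwa [div_eq_one_iff_eq hk] at h

lemma evenProduct_ne_zero (e : Fin 4 → ℝ) {ζ : ℂ}
    (hζ : ζ ∈ closedBall (0 : ℂ) 1 \ squareRoots d) : evenProduct d e ζ ≠ 0 := by
  refine Finset.prod_ne_zero_iff.2 fun k _ => ?_
  have h := Complex.slitPlane_ne_zero (one_sub_sq_div_mem_slitPlane hd hζ k)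
  simp [Complex.cpow_eq_zero_iff, h]

lemma squareRoots_subset_sphere : squareRoots d ⊆ sphere 0 1 := by
  rintro ζ ⟨k, hk⟩
  have : ‖ζ‖ ^ 2 = 1 := by rw [← norm_pow, hk, hd]
  rw [mem_sphere_zero_iff_norm]
  exact (pow_eq_one_iff_of_nonneg (norm_nonneg _) two_ne_zero).1 this

lemma differentiableOn_evenProduct (e : Fin 4 → ℝ) :
    DifferentiableOn ℂ (evenProduct d e) (closedBall 0 1 \ squareRoots d) := by
  intro ζ hζ
  refine DifferentiableWithinAt.fun_finsetProd fun k _ => ?_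
  have h : DifferentiableAt ℂ (fun ζ : ℂ => 1 - ζ ^ 2 / d k) ζ := by fun_prop
  exact (h.cpow_const (one_sub_sq_div_mem_slitPlane hd hζ k)).differentiableWithinAt

/-- Two factors cannot be small together, because the points d k are distinct on the circle. So at
most one factor contributes a singularity, and its exponent is at least -1/2. -/
lemma halfSingular_evenProduct (hinj : Function.Injective d) {e : Fin 4 → ℝ}
    (he : ∀ k, |e k| ≤ 1 / 2) : HalfSingular (squareRoots d) (evenProduct d e) := by
  refine ⟨squareRoots_subset_sphere hd, differentiableOn_evenProduct hd e, ?_⟩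
  obtain ⟨δ, hδ0, hδ⟩ : ∃ δ : ℝ, 0 < δ ∧ ∀ k l, k ≠ l → 2 * δ ≤ ‖d k - d l‖ := by
    obtain ⟨p, hp, hmin⟩ := Finset.exists_min_image
      ((Finset.univ : Finset (Fin 4 × Fin 4)).filter fun p => p.1 ≠ p.2)
      (fun p => ‖d p.1 - d p.2‖) ⟨(0, 1), by simp⟩
    refine ⟨‖d p.1 - d p.2‖ / 2, ?_, fun k l hkl => ?_⟩
    · have : d p.1 - d p.2 ≠ 0 := sub_ne_zero.2 fun h => (Finset.mem_filter.1 hp).2 (hinj h)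
      positivity
    · have := hmin (k, l) (by simpa using hkl)
      simpa [mul_div_cancel₀] using this
  refine ⟨2 ^ 4 * (δ ^ (-1 / 2 : ℝ)) ^ 3, fun ζ hζ => ?_⟩
  have hζ1 : ‖ζ‖ < 1 := by simpa using hζ
  have hζD := ball_subset_diff (squareRoots_subset_sphere hd) hζ
  set x : Fin 4 → ℝ := fun k => ‖1 - ζ ^ 2 / d k‖ with hx
  have hd0 : ∀ k, d k ≠ 0 := fun k h => by simpa [h] using hd k
  have hx0 : ∀ k, 0 < x k := fun k =>
    norm_pos_iff.2 (Complex.slitPlane_ne_zero (one_sub_sq_div_mem_slitPlane hd hζD k))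
  have hq : ∀ k, ‖ζ ^ 2 / d k‖ ≤ ‖ζ‖ := by
    intro k
    rw [norm_div, hd, div_one, norm_pow]
    nlinarith [norm_nonneg ζ]
  have hx2 : ∀ k, x k ≤ 2 := by
    intro k
    refine (norm_sub_le _ _).trans ?_
    rw [norm_one]
    linarith [hq k]
  have hxl : ∀ k, 1 - ‖ζ‖ ≤ x k := by
    intro k
    have := norm_sub_norm_le (1 : ℂ) (ζ ^ 2 / d k)
    rw [norm_one] at this
    linarith [hq k]
  have hxd : ∀ k, x k = ‖d k - ζ ^ 2‖ := by
    intro k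
    have : 1 - ζ ^ 2 / d k = (d k - ζ ^ 2) / d k := by
      field_simp [hd0 k]
    rw [hx]
    simp only [this, norm_div, hd, div_one]
  have hsum : ∀ k l, ‖d k - d l‖ ≤ x k + x l := by
    intro k l
    rw [hxd, hxd]
    have : d k - d l = (d k - ζ ^ 2) - (d l - ζ ^ 2) := by ring
    rw [this]
    exact norm_sub_le _ _
  -- Write the exponent as (e k + 1/2) - 1/2. The first part lies in [0, 1] and the base is at most
  -- 2, so it costs at most a factor 2.
  have hfac : ∀ k, ‖(1 - ζ ^ 2 / d k) ^ (e k : ℂ)‖ ≤ 2 * x k ^ (-1 / 2 : ℝ) := by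
    intro k
    have h1 := abs_le.1 (he k)
    have e1 : ‖(1 - ζ ^ 2 / d k) ^ (e k : ℂ)‖ = x k ^ (e k + 1 / 2) * x k ^ (-1 / 2 : ℝ) := by
      rw [Complex.norm_cpow_real, ← Real.rpow_add (hx0 k)]
      congr 1
      ring
    rw [e1]
    refine mul_le_mul_of_nonneg_right ?_ (Real.rpow_nonneg (hx0 k).le _)
    calc x k ^ (e k + 1 / 2) ≤ 2 ^ (e k + 1 / 2) :=
          Real.rpow_le_rpow (hx0 k).le (hx2 k) (by linarith)
      _ ≤ 2 ^ (1 : ℝ) := Real.rpow_le_rpow_of_exponent_le (by norm_num) (by linarith)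
      _ = 2 := by simp
  -- Only the smallest factor may approach 0. Any other is at least δ, since the two together are at
  -- least the distance 2δ of their centres.
  obtain ⟨k₀, -, hk₀⟩ := Finset.exists_min_image (Finset.univ : Finset (Fin 4)) x ⟨0, by simp⟩
  have hδx : ∀ l, l ≠ k₀ → δ ≤ x l := by
    intro l hl
    have h1 := hδ l k₀ hl
    have h2 := hsum l k₀
    have h3 := hk₀ l (by simp)
    linarith
  calc ‖evenProduct d e ζ‖ = ∏ k, ‖(1 - ζ ^ 2 / d k) ^ (e k : ℂ)‖ := by
        rw [evenProduct, norm_prod]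
    _ ≤ ∏ k, 2 * x k ^ (-1 / 2 : ℝ) :=
        Finset.prod_le_prod (fun _ _ => norm_nonneg _) fun k _ => hfac k
    _ = 2 ^ 4 * ((∏ k ∈ Finset.univ.erase k₀, x k ^ (-1 / 2 : ℝ)) * x k₀ ^ (-1 / 2 : ℝ)) := by
        rw [Finset.prod_mul_distrib, Finset.prod_erase_mul _ _ (Finset.mem_univ k₀)]
        simp
    _ ≤ 2 ^ 4 * ((∏ k ∈ Finset.univ.erase k₀, δ ^ (-1 / 2 : ℝ)) * (1 - ‖ζ‖) ^ (-1 / 2 : ℝ)) := by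
        have hr : ∀ k, 0 ≤ x k ^ (-1 / 2 : ℝ) := fun k => Real.rpow_nonneg (hx0 k).le _
        refine mul_le_mul_of_nonneg_left (mul_le_mul ?_ ?_ (hr _) ?_) (by norm_num)
        · refine Finset.prod_le_prod (fun k _ => hr k) fun k hk => ?_
          exact rpow_neg_half_anti hδ0 (hδx k (Finset.ne_of_mem_erase hk))
        · exact rpow_neg_half_anti (by linarith) (hxl _)
        · exact Finset.prod_nonneg fun _ _ => Real.rpow_nonneg hδ0.le _
    _ = 2 ^ 4 * (δ ^ (-1 / 2 : ℝ)) ^ 3 * (1 - ‖ζ‖) ^ (-1 / 2 : ℝ) := by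
        simp [Finset.card_erase_of_mem]
        ring

end

end

noncomputable section

open Filter Topology

/-! ### Pulling forms back to the disk -/

/-- The hypotheses on the parameters. -/
structure Admissible (a b t : ℝ) : Prop where
  a_pos : 0 < a
  b_pos : 0 < b
  one_lt_t : 1 < t
  a_lt_t : a < t
  inv_a_lt_b : 1 / a < b
  b_lt_t : b < t

/-- The negative vertices. -/
def node (a b t : ℝ) : Fin 4 → ℝ := ![-t, -a, -1 / b, -1 / t]

/-- The squares of the images of the vertices on the unit circle. -/
def cornerSq (a b t : ℝ) (k : Fin 4) : ℂ := cayley (node a b t k) ^ 2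

/-- The closed upper half-plane without the vertices. -/
def puncturedHalfPlane (a b t : ℝ) : Set ℂ := {z | 0 ≤ z.im ∧ ∀ k, z ≠ vtx a b t k}

lemma Admissible.vtx_strictMono {a b t : ℝ} (h : Admissible a b t) : StrictMono (vtx a b t) := by
  obtain ⟨ha, hb, ht, hat, hab, hbt⟩ := h
  have h1 : 1 / b < a := by rw [div_lt_iff₀ hb]; rw [div_lt_iff₀ ha] at hab; linarith
  have h2 : 1 / t < 1 / b := one_div_lt_one_div_of_lt hb hbt
  have h3 : 1 / t < 1 / a := one_div_lt_one_div_of_lt ha hat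
  have h4 : 0 < 1 / t := by positivity
  rw [Fin.strictMono_iff_lt_succ]
  intro k
  fin_cases k <;> simp [vtx, neg_div] <;> simp only [one_div] at * <;> linarith

/-- Negativity distinguishes a node v from its partner -1/v. It gives distinct corner squares, and
the exact shift by π between opposite corner angles. -/
lemma Admissible.node_neg {a b t : ℝ} (h : Admissible a b t) (k : Fin 4) : node a b t k < 0 := by
  have h1 := h.a_pos
  have h2 := h.b_pos
  have h3 := h.one_lt_t
  have h4 : 0 < b⁻¹ := by positivity
  have h5 : 0 < t⁻¹ := by positivity
  fin_cases k <;> simp [node, neg_div] <;> linarith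

lemma vtx_castAdd (a b t : ℝ) (k : Fin 4) : vtx a b t (Fin.castAdd 4 k) = node a b t k := by
  fin_cases k <;> rfl

/-- The last four vertices are the images of the first four under z ↦ -1/z, which pairs the linear
factors of the forms. -/
lemma vtx_natAdd (a b t : ℝ) (k : Fin 4) : vtx a b t (Fin.natAdd 4 k) = -1 / node a b t k := by
  fin_cases k
  · change 1 / t = -1 / -t
    rw [neg_div_neg_eq]
  · change 1 / a = -1 / -a
    rw [neg_div_neg_eq]
  · change b = -1 / (-1 / b)
    simp
  · change t = -1 / (-1 / t)
    simp

lemma forall_vtx_ne_iff {a b t : ℝ} {z : ℂ} : (∀ k, z ≠ vtx a b t k) ↔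
    ∀ k, z ≠ node a b t k ∧ z ≠ ((-1 / node a b t k : ℝ) : ℂ) := by
  constructor
  · intro h k
    rw [← vtx_natAdd, ← vtx_castAdd]
    exact ⟨h _, h _⟩
  · intro h k
    refine Fin.addCases (m := 4) (n := 4) (motive := fun k => z ≠ vtx a b t k) (fun i => ?_)
      (fun i => ?_) k
    · rw [vtx_castAdd]; exact (h i).1
    · rw [vtx_natAdd]; exact (h i).2

lemma norm_cayley_ofReal (x : ℝ) : ‖cayley x‖ = 1 := by
  have h := one_sub_normSq_cayley (z := (x : ℂ)) (by simp)
  simp only [Complex.ofReal_im, mul_zero, zero_div] at h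
  exact (pow_eq_one_iff_of_nonneg (norm_nonneg _) two_ne_zero).1 (by linarith)

lemma norm_cornerSq (a b t : ℝ) (k : Fin 4) : ‖cornerSq a b t k‖ = 1 := by
  rw [cornerSq, norm_pow, norm_cayley_ofReal, one_pow]

lemma cornerSq_ne_zero (a b t : ℝ) (k : Fin 4) : cornerSq a b t k ≠ 0 := fun h => by
  simpa [h] using norm_cornerSq a b t k

lemma real_sub_I_ne_zero (x : ℝ) : (x : ℂ) - Complex.I ≠ 0 := by
  intro h
  simpa using congrArg Complex.im h

/-- `z ↦ -1 / z` corresponds to `ζ ↦ -ζ`. -/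
lemma cayley_neg_inv {z : ℂ} (hz : 0 ≤ z.im) (h0 : z ≠ 0) : cayley (-1 / z) = -cayley z := by
  have h1 := add_I_ne_zero hz
  have h2 : -1 + Complex.I * z ≠ 0 := by
    have : -1 + Complex.I * z = Complex.I * (z + Complex.I) := by
      ring_nf; rw [Complex.I_sq]; ring
    rw [this]
    exact mul_ne_zero Complex.I_ne_zero h1
  have h3 : -1 / z + Complex.I ≠ 0 := by
    rw [show -1 / z + Complex.I = (-1 + Complex.I * z) / z by field_simp]
    exact div_ne_zero h2 h0
  rw [cayley, cayley, div_eq_iff h3]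
  field_simp
  ring_nf
  rw [Complex.I_sq]
  ring

/-- The factors of the forms in terms of the factors on the disk. -/
lemma factor_eq {z : ℂ} (hz : 0 ≤ z.im) {v : ℝ} (hv : v ≠ 0) :
    (z - v) * (z + 1 / v) =
      (-((v : ℂ) - Complex.I) ^ 2 / (4 * Complex.I * v)) * (z + Complex.I) ^ 2 *
        (1 - cayley z ^ 2 / cayley v ^ 2) := by
  have h1 := add_I_ne_zero hz
  have h2 : (v : ℂ) + Complex.I ≠ 0 := add_I_ne_zero (by simp)
  have h3 := real_sub_I_ne_zero v
  have h4 : (v : ℂ) ≠ 0 := by exact_mod_cast hv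
  rw [cayley, cayley]
  field_simp
  ring_nf
  simp only [Complex.I_pow_three]
  ring

variable {a b t : ℝ}

lemma Admissible.node_ne_zero (h : Admissible a b t) (k : Fin 4) : node a b t k ≠ 0 :=
  (h.node_neg k).ne

lemma Admissible.node_injective (h : Admissible a b t) : Function.Injective (node a b t) := by
  intro k l hkl
  rw [← vtx_castAdd, ← vtx_castAdd] at hkl
  exact Fin.castAdd_injective 4 4 (h.vtx_strictMono.injective hkl)

lemma Admissible.factor_ne_zero {z : ℂ}
    (hz : z ∈ puncturedHalfPlane a b t) (k : Fin 4) :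
    (z - node a b t k) * (z + 1 / node a b t k) ≠ 0 := by
  have h1 := forall_vtx_ne_iff.1 hz.2 k
  refine mul_ne_zero (sub_ne_zero.2 h1.1) fun h2 => h1.2 ?_
  rw [eq_neg_of_add_eq_zero_left h2]
  push_cast
  ring

lemma Admissible.cayley_mem (h : Admissible a b t) {z : ℂ} (hz : z ∈ puncturedHalfPlane a b t) :
    cayley z ∈ closedBall (0 : ℂ) 1 \ squareRoots (cornerSq a b t) := by
  refine ⟨cayley_mem_closedBall hz.1, ?_⟩
  rintro ⟨k, hk⟩
  have h1 := Admissible.factor_ne_zero hz k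
  have h2 : cayley (node a b t k) ^ 2 ≠ 0 := cornerSq_ne_zero a b t k
  rw [factor_eq hz.1 (h.node_ne_zero k), hk, cornerSq, div_self h2] at h1
  simp at h1

/-- Equal squares mean that the two nodes agree or that one is -1/ the other; the second case is
impossible since all nodes are negative. -/
lemma Admissible.cornerSq_injective (h : Admissible a b t) :
    Function.Injective (cornerSq a b t) := by
  intro k l hkl
  have h2 : cayley (node a b t l) ^ 2 ≠ 0 := cornerSq_ne_zero a b t l
  have h3 := factor_eq (z := (node a b t k : ℂ)) (by simp) (h.node_ne_zero l)
  rw [show cayley (node a b t k) ^ 2 = cayley (node a b t l) ^ 2 from hkl, div_self h2, sub_self,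
    mul_zero, mul_eq_zero] at h3
  rcases h3 with h3 | h3
  · exact h.node_injective (by exact_mod_cast sub_eq_zero.1 h3)
  · have h4 : node a b t k + 1 / node a b t l = 0 := by exact_mod_cast h3
    have h5 := h.node_neg k
    have h6 : 1 / node a b t l < 0 := one_div_neg.2 (h.node_neg l)
    linarith

/-- The set lies between the open half-plane and its closure. -/
lemma isPreconnected_puncturedHalfPlane : IsPreconnected (puncturedHalfPlane a b t) := by
  refine (convex_halfSpace_im_gt 0).isPreconnected.subset_closure (fun z hz => ⟨le_of_lt hz, ?_⟩) ?_
  · rintro k rfl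
    simp at hz
  · rw [Complex.closure_setOfPred_lt_im]
    exact fun z hz => hz.1

lemma I_mem_puncturedHalfPlane : Complex.I ∈ puncturedHalfPlane a b t := by
  refine ⟨by simp, fun k h => ?_⟩
  simpa using congrArg Complex.im h

/-- A form on the upper half-plane with half-integer exponents, pulled back to the disk. -/
lemma Admissible.form_eq (h : Admissible a b t) {f : ℂ → ℂ} {c : ℂ} {m : Fin 4 → ℤ}
    (hm : ∑ k, m k = -2) (hf : ContinuousOn f (puncturedHalfPlane a b t)) (hc : c ≠ 0)
    (hsq : ∀ z ∈ puncturedHalfPlane a b t,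
      f z ^ 2 = c * ∏ k, ((z - node a b t k) * (z + 1 / node a b t k)) ^ m k)
    {z : ℂ} (hz : z ∈ puncturedHalfPlane a b t) :
    f z = 2 * Complex.I * f Complex.I *
      evenProduct (cornerSq a b t) (fun k => (m k : ℝ) / 2) (cayley z) *
      (2 * Complex.I / (z + Complex.I) ^ 2) := by
  have hd := norm_cornerSq a b t
  set g : ℂ → ℂ := fun z => 2 * Complex.I * f Complex.I *
      evenProduct (cornerSq a b t) (fun k => (m k : ℝ) / 2) (cayley z) *
      (2 * Complex.I / (z + Complex.I) ^ 2) with hg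
  set C : ℂ := ∏ k, (-((node a b t k : ℂ) - Complex.I) ^ 2 / (4 * Complex.I * node a b t k)) ^ m k
  have hep : ∀ ζ, evenProduct (cornerSq a b t) (fun k => (m k : ℝ) / 2) ζ ^ 2 =
      ∏ k, (1 - ζ ^ 2 / cornerSq a b t k) ^ m k := by
    intro ζ
    rw [evenProduct, ← Finset.prod_pow]
    refine Finset.prod_congr rfl fun k _ => ?_
    rw [← Complex.cpow_nat_mul]
    push_cast
    rw [mul_div_cancel₀ _ two_ne_zero, Complex.cpow_intCast]
  have hfsq : ∀ z ∈ puncturedHalfPlane a b t, f z ^ 2 = c * C * ((z + Complex.I) ^ 4)⁻¹ *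
      ∏ k, (1 - cayley z ^ 2 / cornerSq a b t k) ^ m k := by
    intro z hz
    have h1 := add_I_ne_zero hz.1
    rw [hsq z hz]
    simp only [factor_eq hz.1 (h.node_ne_zero _), mul_zpow, Finset.prod_mul_distrib]
    -- The exponent sum -2 yields precisely the square of the Jacobian factor (z + i)⁻², so the form
    -- on the disk has no extra singularity at the point corresponding to ∞.
    have h2 : ∏ k, ((z + Complex.I) ^ 2) ^ m k = ((z + Complex.I) ^ 4)⁻¹ := by
      have h3 : ∏ k, ((z + Complex.I) ^ 2) ^ m k = ((z + Complex.I) ^ 2) ^ ∑ k, m k := by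
        simp only [Fin.prod_univ_four, Fin.sum_univ_four, zpow_add₀ (pow_ne_zero 2 h1)]
      rw [h3, hm, zpow_neg, zpow_ofNat, ← pow_mul]
    rw [h2]
    simp only [C, cornerSq]
    ring
  have hI : f Complex.I ^ 2 = c * C / 16 := by
    rw [hfsq _ I_mem_puncturedHalfPlane, cayley_I]
    simp
    have : (Complex.I + Complex.I) ^ 4 = 16 := by
      rw [← two_mul, mul_pow, Complex.I_pow_four]; norm_num
    rw [this, div_eq_mul_inv]
  have hfI : f Complex.I ≠ 0 := by
    intro h0
    have := hsq _ (I_mem_puncturedHalfPlane (a := a) (b := b) (t := t))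
    rw [h0] at this
    have h1 : ∏ k, ((Complex.I - node a b t k) * (Complex.I + 1 / node a b t k)) ^ m k ≠ 0 :=
      Finset.prod_ne_zero_iff.2 fun k _ =>
        zpow_ne_zero _ (Admissible.factor_ne_zero I_mem_puncturedHalfPlane k)
    rw [zero_pow two_ne_zero] at this
    exact mul_ne_zero hc h1 this.symm
  have hcay : ContinuousOn cayley (puncturedHalfPlane a b t) := fun z hz =>
    (hasDerivAt_cayley hz.1).continuousAt.continuousWithinAt
  -- Both sides are continuous, have equal squares, and the right side has no zeros, so on a
  -- connected set they agree up to one global sign. The value at z = i, where the Cayley image is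
  -- 0, fixes this sign without any choice of branches.
  refine isPreconnected_puncturedHalfPlane.eq_of_sq_eq hf (g := g) ?_ ?_ ?_
    I_mem_puncturedHalfPlane ?_ hz
  · refine (continuousOn_const.mul ((differentiableOn_evenProduct hd _).continuousOn.comp hcay
      fun z hz => h.cayley_mem hz)).mul (continuousOn_const.div (by fun_prop) fun z hz => ?_)
    exact pow_ne_zero 2 (add_I_ne_zero hz.1)
  · intro z hz
    simp only [Pi.pow_apply, hg, mul_pow, div_pow, hI, hep, hfsq z hz]
    rw [Complex.I_sq]
    ring
  · intro z hz
    refine mul_ne_zero (mul_ne_zero (by simp [hfI]) (evenProduct_ne_zero hd _ (h.cayley_mem hz))) ?_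
    simp [add_I_ne_zero hz.1]
  · simp [hg, cayley_I, evenProduct]
    ring_nf
    simp

end

noncomputable section

open Filter Topology

/-! ### The three forms -/

lemma cpow_half_sq (z : ℂ) : (z ^ (1 / 2 : ℂ)) ^ 2 = z := by
  rw [← Complex.cpow_nat_mul]
  norm_num

lemma cpow_neg_half (z : ℂ) : z ^ (-1 / 2 : ℂ) = (z ^ (1 / 2 : ℂ))⁻¹ := by
  rw [neg_div, Complex.cpow_neg]

lemma cpow_half_ne_zero {z : ℂ} (hz : z ≠ 0) : z ^ (1 / 2 : ℂ) ≠ 0 := by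
  simp [Complex.cpow_eq_zero_iff, hz]

/-- On the negative axis the principal logarithm is continuous when approached from above; this is
the precise sense of boundary values taken from above. -/
lemma continuousWithinAt_cpow_half {z : ℂ} (h0 : z ≠ 0) :
    ContinuousWithinAt (fun z : ℂ => z ^ (1 / 2 : ℂ)) {z | 0 ≤ z.im} z := by
  have hlog : ContinuousWithinAt Complex.log {z | 0 ≤ z.im} z := by
    by_cases hz : z ∈ Complex.slitPlane
    · exact (continuousAt_clog hz).continuousWithinAt
    · rw [Complex.mem_slitPlane_iff, not_or, not_lt, not_not] at hz
      refine Complex.continuousWithinAt_log_of_re_neg_of_im_zero (lt_of_le_of_ne hz.1 ?_) hz.2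
      exact fun h => h0 (Complex.ext h hz.2)
  have h1 : ContinuousWithinAt (fun z => Complex.exp (Complex.log z * (1 / 2))) {z | 0 ≤ z.im} z :=
    (hlog.mul continuousWithinAt_const).cexp
  refine h1.congr_of_eventuallyEq ?_ (Complex.cpow_def_of_ne_zero h0 _)
  filter_upwards [mem_nhdsWithin_of_mem_nhds (isOpen_ne.mem_nhds h0)] with w hw
  exact Complex.cpow_def_of_ne_zero hw _

variable {a b t ρ : ℝ}

lemma continuousOn_cpow_half_sub {s : Set ℂ} (hs : ∀ z ∈ s, 0 ≤ z.im) (v : ℝ)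
    (hv : ∀ z ∈ s, z ≠ v) : ContinuousOn (fun z : ℂ => (z - v) ^ (1 / 2 : ℂ)) s := by
  intro z hz
  have h1 : ContinuousWithinAt (fun z : ℂ => z - v) s z := by fun_prop
  have hm : MapsTo (fun z : ℂ => z - v) s {z | 0 ≤ z.im} := fun w hw => by simpa using hs w hw
  exact ContinuousWithinAt.comp (g := fun z : ℂ => z ^ (1 / 2 : ℂ)) (f := fun z : ℂ => z - v)
    (continuousWithinAt_cpow_half (sub_ne_zero.2 (hv z hz))) h1 hm

/-- On the punctured half-plane, `z` differs from all vertices. -/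
lemma puncturedHalfPlane_ne {z : ℂ} (hz : z ∈ puncturedHalfPlane a b t) :
    (z + t ≠ 0 ∧ z + 1 / t ≠ 0 ∧ z - 1 / t ≠ 0 ∧ z - t ≠ 0) ∧
      (z + a ≠ 0 ∧ z + 1 / b ≠ 0 ∧ z - 1 / a ≠ 0 ∧ z - b ≠ 0) := by
  have h := hz.2
  refine ⟨⟨fun e => h 0 ?_, fun e => h 3 ?_, fun e => h 4 ?_, fun e => h 7 ?_⟩,
    fun e => h 1 ?_, fun e => h 2 ?_, fun e => h 5 ?_, fun e => h 6 ?_⟩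
  all_goals
    first
    | rw [eq_neg_of_add_eq_zero_left e]
    | rw [sub_eq_zero.1 e]
    simp [vtx, neg_div]

lemma continuousOn_factors :
    (ContinuousOn (fun z : ℂ => (z + t) ^ (1 / 2 : ℂ)) (puncturedHalfPlane a b t) ∧
      ContinuousOn (fun z : ℂ => (z + 1 / t) ^ (1 / 2 : ℂ)) (puncturedHalfPlane a b t) ∧
      ContinuousOn (fun z : ℂ => (z - 1 / t) ^ (1 / 2 : ℂ)) (puncturedHalfPlane a b t) ∧
      ContinuousOn (fun z : ℂ => (z - t) ^ (1 / 2 : ℂ)) (puncturedHalfPlane a b t)) ∧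
    (ContinuousOn (fun z : ℂ => (z + a) ^ (1 / 2 : ℂ)) (puncturedHalfPlane a b t) ∧
      ContinuousOn (fun z : ℂ => (z + 1 / b) ^ (1 / 2 : ℂ)) (puncturedHalfPlane a b t) ∧
      ContinuousOn (fun z : ℂ => (z - 1 / a) ^ (1 / 2 : ℂ)) (puncturedHalfPlane a b t) ∧
      ContinuousOn (fun z : ℂ => (z - b) ^ (1 / 2 : ℂ)) (puncturedHalfPlane a b t)) := by
  have hs : ∀ z ∈ puncturedHalfPlane a b t, 0 ≤ z.im := fun z hz => hz.1
  have key : ∀ (v : ℝ) (w : ℂ), (v : ℂ) = -w →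
      (∀ z ∈ puncturedHalfPlane a b t, z + w ≠ 0) →
      ContinuousOn (fun z : ℂ => (z + w) ^ (1 / 2 : ℂ)) (puncturedHalfPlane a b t) := by
    intro v w hvw h
    have := continuousOn_cpow_half_sub hs v fun z hz hz' => h z hz (by rw [hz', hvw]; ring)
    simpa [hvw] using this
  have key' : ∀ (v : ℝ) (w : ℂ), (v : ℂ) = w →
      (∀ z ∈ puncturedHalfPlane a b t, z - w ≠ 0) →
      ContinuousOn (fun z : ℂ => (z - w) ^ (1 / 2 : ℂ)) (puncturedHalfPlane a b t) := by
    rintro v _ rfl h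
    exact continuousOn_cpow_half_sub hs v fun z hz hz' => h z hz (by rw [hz']; ring)
  exact ⟨⟨key (-t) _ (by push_cast; ring) fun _ hz => (puncturedHalfPlane_ne hz).1.1,
    key (-1 / t) _ (by push_cast; ring) fun _ hz => (puncturedHalfPlane_ne hz).1.2.1,
    key' (1 / t) _ (by push_cast; ring) fun _ hz => (puncturedHalfPlane_ne hz).1.2.2.1,
    key' t _ rfl fun _ hz => (puncturedHalfPlane_ne hz).1.2.2.2⟩,
    key (-a) _ (by push_cast; ring) fun _ hz => (puncturedHalfPlane_ne hz).2.1,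
    key (-1 / b) _ (by push_cast; ring) fun _ hz => (puncturedHalfPlane_ne hz).2.2.1,
    key' (1 / a) _ (by push_cast; ring) fun _ hz => (puncturedHalfPlane_ne hz).2.2.2.1,
    key' b _ rfl fun _ hz => (puncturedHalfPlane_ne hz).2.2.2.2⟩

lemma wDenom_ne_zero {z : ℂ} (hz : z ∈ puncturedHalfPlane a b t) : wDenom t z ≠ 0 := by
  obtain ⟨⟨h1, h2, h3, h4⟩, -⟩ := puncturedHalfPlane_ne hz
  simp only [wDenom, ne_eq, mul_eq_zero, not_or]
  exact ⟨⟨⟨cpow_half_ne_zero h1, cpow_half_ne_zero h2⟩, cpow_half_ne_zero h3⟩, cpow_half_ne_zero h4⟩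

lemma continuousOn_wDenom : ContinuousOn (wDenom t) (puncturedHalfPlane a b t) := by
  obtain ⟨⟨h1, h2, h3, h4⟩, -⟩ := continuousOn_factors (a := a) (b := b) (t := t)
  exact ((h1.mul h2).mul h3).mul h4

lemma continuousOn_phi1 : ContinuousOn (phi1 a b t ρ) (puncturedHalfPlane a b t) := by
  obtain ⟨-, h1, h2, h3, h4⟩ := continuousOn_factors (a := a) (b := b) (t := t)
  unfold phi1
  simp only [cpow_neg_half]
  refine (continuousOn_const.mul (((h1.mul (h2.inv₀ fun z hz => ?_)).mul h3).mul
    (h4.inv₀ fun z hz => ?_))).div continuousOn_wDenom fun _ hz => wDenom_ne_zero hz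
  exacts [cpow_half_ne_zero (puncturedHalfPlane_ne hz).2.2.1,
    cpow_half_ne_zero (puncturedHalfPlane_ne hz).2.2.2.2]

lemma continuousOn_phi2 : ContinuousOn (phi2 a b t ρ) (puncturedHalfPlane a b t) := by
  obtain ⟨-, h1, h2, h3, h4⟩ := continuousOn_factors (a := a) (b := b) (t := t)
  unfold phi2
  simp only [cpow_neg_half]
  refine (continuousOn_const.mul ((((h1.inv₀ fun z hz => ?_).mul h2).mul
    (h3.inv₀ fun z hz => ?_)).mul h4)).div continuousOn_wDenom fun _ hz => wDenom_ne_zero hz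
  exacts [cpow_half_ne_zero (puncturedHalfPlane_ne hz).2.1,
    cpow_half_ne_zero (puncturedHalfPlane_ne hz).2.2.2.1]

lemma continuousOn_dh : ContinuousOn (dh t) (puncturedHalfPlane a b t) :=
  continuousOn_const.div continuousOn_wDenom fun _ hz => wDenom_ne_zero hz

/-- The square of the Gauss map is `-ρ²` times this quotient. -/
def gaussSq (a b : ℝ) (z : ℂ) : ℂ := ((z + a) * (z - 1 / a)) / ((z + 1 / b) * (z - b))

lemma phi1_eq_mul_phi2 (hρ : 0 < ρ) {z : ℂ} (hz : z ∈ puncturedHalfPlane a b t) :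
    phi1 a b t ρ z = -(ρ : ℂ) ^ 2 * gaussSq a b z * phi2 a b t ρ z := by
  obtain ⟨-, h1, h2, h3, h4⟩ := puncturedHalfPlane_ne hz
  have hD := wDenom_ne_zero hz
  have hρ' : (ρ : ℂ) ≠ 0 := by exact_mod_cast hρ.ne'
  have e : gaussSq a b z = (((z + a) ^ (1 / 2 : ℂ)) ^ 2 * ((z - 1 / a) ^ (1 / 2 : ℂ)) ^ 2) /
      (((z + 1 / b) ^ (1 / 2 : ℂ)) ^ 2 * ((z - b) ^ (1 / 2 : ℂ)) ^ 2) := by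
    simp only [cpow_half_sq, gaussSq]
  rw [e, phi1, phi2]
  simp only [cpow_neg_half]
  have k1 := cpow_half_ne_zero h1
  have k2 := cpow_half_ne_zero h2
  have k3 := cpow_half_ne_zero h3
  have k4 := cpow_half_ne_zero h4
  generalize (z + a) ^ (1 / 2 : ℂ) = A at *
  generalize (z + 1 / b) ^ (1 / 2 : ℂ) = B at *
  generalize (z - 1 / a) ^ (1 / 2 : ℂ) = C at *
  generalize (z - b) ^ (1 / 2 : ℂ) = E at *
  field_simp

/-- This is the nullity of the Weierstrass data, hence the source of conformality. -/
lemma phi1_mul_phi2 (hρ : 0 < ρ) {z : ℂ} (hz : z ∈ puncturedHalfPlane a b t) :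
    phi1 a b t ρ z * phi2 a b t ρ z = dh t z ^ 2 := by
  obtain ⟨-, h1, h2, h3, h4⟩ := puncturedHalfPlane_ne hz
  have hD := wDenom_ne_zero hz
  have hρ' : (ρ : ℂ) ≠ 0 := by exact_mod_cast hρ.ne'
  rw [phi1, phi2, dh]
  simp only [cpow_neg_half]
  have k1 := cpow_half_ne_zero h1
  have k2 := cpow_half_ne_zero h2
  have k3 := cpow_half_ne_zero h3
  have k4 := cpow_half_ne_zero h4
  generalize (z + a) ^ (1 / 2 : ℂ) = A at *
  generalize (z + 1 / b) ^ (1 / 2 : ℂ) = B at *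
  generalize (z - 1 / a) ^ (1 / 2 : ℂ) = C at *
  generalize (z - b) ^ (1 / 2 : ℂ) = E at *
  field_simp
  simp

lemma wDenom_sq (z : ℂ) :
    wDenom t z ^ 2 = (z + t) * (z - 1 / t) * ((z + 1 / t) * (z - t)) := by
  simp only [wDenom, mul_pow, cpow_half_sq]
  ring

lemma dh_ne_zero {z : ℂ} (hz : z ∈ puncturedHalfPlane a b t) : dh t z ≠ 0 :=
  div_ne_zero Complex.I_ne_zero (wDenom_ne_zero hz)

/-- It puts the vertices into the pairs v, -1/v, so that the squares of all three forms become
products over the four nodes with integer exponents. -/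
lemma node_factors (a b t : ℝ) (z : ℂ) (m : Fin 4 → ℤ) :
    ∏ k, ((z - node a b t k) * (z + 1 / node a b t k)) ^ m k =
      ((z + t) * (z - 1 / t)) ^ m 0 * ((z + a) * (z - 1 / a)) ^ m 1 *
        ((z + 1 / b) * (z - b)) ^ m 2 * ((z + 1 / t) * (z - t)) ^ m 3 := by
  simp only [Fin.prod_univ_four, node]
  congr 1
  · congr 1
    · congr 1
      · congr 1
        simp [div_neg, sub_eq_add_neg]
      · congr 1
        simp [div_neg, sub_eq_add_neg]
    · congr 1
      simp [neg_div, div_neg, sub_eq_add_neg]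
  · congr 1
    simp [neg_div, div_neg, sub_eq_add_neg]

lemma dh_sq {z : ℂ} : dh t z ^ 2 = -1 * ∏ k,
    ((z - node a b t k) * (z + 1 / node a b t k)) ^ (![-1, 0, 0, -1] : Fin 4 → ℤ) k := by
  rw [node_factors, dh, div_pow, wDenom_sq, Complex.I_sq]
  simp only [Matrix.cons_val, zpow_neg_one, zpow_zero, div_eq_mul_inv, mul_inv]
  ring

lemma phi1_sq {z : ℂ} : phi1 a b t ρ z ^ 2 = (ρ : ℂ) ^ 2 * ∏ k,
    ((z - node a b t k) * (z + 1 / node a b t k)) ^ (![-1, 1, -1, -1] : Fin 4 → ℤ) k := by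
  rw [node_factors, phi1, div_pow, wDenom_sq]
  simp only [mul_pow, cpow_neg_half, inv_pow, cpow_half_sq, neg_sq]
  simp only [Matrix.cons_val, zpow_neg_one, zpow_one, div_eq_mul_inv, mul_inv]
  ring

lemma phi2_sq {z : ℂ} : phi2 a b t ρ z ^ 2 = (1 / (ρ : ℂ)) ^ 2 * ∏ k,
    ((z - node a b t k) * (z + 1 / node a b t k)) ^ (![-1, -1, 1, -1] : Fin 4 → ℤ) k := by
  rw [node_factors, phi2, div_pow, wDenom_sq]
  simp only [mul_pow, cpow_neg_half, inv_pow, cpow_half_sq]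
  simp only [Matrix.cons_val, zpow_neg_one, zpow_one, div_eq_mul_inv, mul_inv]
  ring

/-- The form `φ₁` on the unit disk. -/
def disk1 (a b t ρ : ℝ) (ζ : ℂ) : ℂ := 2 * Complex.I * phi1 a b t ρ Complex.I *
  evenProduct (cornerSq a b t) (fun k => ((![-1, 1, -1, -1] : Fin 4 → ℤ) k : ℝ) / 2) ζ

/-- The form `φ₂` on the unit disk. -/
def disk2 (a b t ρ : ℝ) (ζ : ℂ) : ℂ := 2 * Complex.I * phi2 a b t ρ Complex.I *
  evenProduct (cornerSq a b t) (fun k => ((![-1, -1, 1, -1] : Fin 4 → ℤ) k : ℝ) / 2) ζ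

/-- The form `dh` on the unit disk. -/
def disk3 (a b t : ℝ) (ζ : ℂ) : ℂ := 2 * Complex.I * dh t Complex.I *
  evenProduct (cornerSq a b t) (fun k => ((![-1, 0, 0, -1] : Fin 4 → ℤ) k : ℝ) / 2) ζ

/-- The vertices on the unit circle. -/
abbrev corners (a b t : ℝ) : Set ℂ := squareRoots (cornerSq a b t)

lemma disk1_neg (ζ : ℂ) : disk1 a b t ρ (-ζ) = disk1 a b t ρ ζ := by
  simp [disk1, evenProduct_neg]

lemma disk2_neg (ζ : ℂ) : disk2 a b t ρ (-ζ) = disk2 a b t ρ ζ := by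
  simp [disk2, evenProduct_neg]

lemma disk3_neg (ζ : ℂ) : disk3 a b t (-ζ) = disk3 a b t ζ := by
  simp [disk3, evenProduct_neg]

variable (h : Admissible a b t)
include h

lemma phi1_eq_disk1 (hρ : 0 < ρ) {z : ℂ} (hz : z ∈ puncturedHalfPlane a b t) :
    phi1 a b t ρ z = disk1 a b t ρ (cayley z) * (2 * Complex.I / (z + Complex.I) ^ 2) :=
  h.form_eq (by simp [Fin.sum_univ_four]) continuousOn_phi1
    (pow_ne_zero 2 (by exact_mod_cast hρ.ne')) (fun _ _ => phi1_sq) hz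

lemma phi2_eq_disk2 (hρ : 0 < ρ) {z : ℂ} (hz : z ∈ puncturedHalfPlane a b t) :
    phi2 a b t ρ z = disk2 a b t ρ (cayley z) * (2 * Complex.I / (z + Complex.I) ^ 2) :=
  h.form_eq (by simp [Fin.sum_univ_four]) continuousOn_phi2
    (pow_ne_zero 2 (one_div_ne_zero (by exact_mod_cast hρ.ne'))) (fun _ _ => phi2_sq) hz

lemma dh_eq_disk3 {z : ℂ} (hz : z ∈ puncturedHalfPlane a b t) :
    dh t z = disk3 a b t (cayley z) * (2 * Complex.I / (z + Complex.I) ^ 2) :=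
  h.form_eq (by simp [Fin.sum_univ_four]) continuousOn_dh (by norm_num) (fun _ _ => dh_sq) hz

lemma halfSingular_disk1 (ρ : ℝ) : HalfSingular (corners a b t) (disk1 a b t ρ) := by
  refine (halfSingular_evenProduct (norm_cornerSq a b t) h.cornerSq_injective fun k => ?_).const_mul _
  fin_cases k <;> norm_num [abs_le]

lemma halfSingular_disk2 (ρ : ℝ) : HalfSingular (corners a b t) (disk2 a b t ρ) := by
  refine (halfSingular_evenProduct (norm_cornerSq a b t) h.cornerSq_injective fun k => ?_).const_mul _
  fin_cases k <;> norm_num [abs_le]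

lemma halfSingular_disk3 : HalfSingular (corners a b t) (disk3 a b t) := by
  refine (halfSingular_evenProduct (norm_cornerSq a b t) h.cornerSq_injective fun k => ?_).const_mul _
  fin_cases k <;> norm_num [abs_le]

end

noncomputable section

open Filter Topology

/-! ### The edges -/

/-- From above, the root of a real number is positive or i times positive. Counting the factors i
then gives the direction of each form on each interval. -/
lemma exists_cpow_half_ofReal {y : ℝ} (hy : y ≠ 0) :
    ∃ p : ℝ, 0 < p ∧ (y : ℂ) ^ (1 / 2 : ℂ) = if 0 < y then (p : ℂ) else Complex.I * p := by
  rcases hy.lt_or_gt with h | h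
  · refine ⟨(-y) ^ (1 / 2 : ℝ), Real.rpow_pos_of_pos (by linarith) _, ?_⟩
    rw [if_neg (by linarith), Complex.ofReal_cpow_of_nonpos h.le,
      Complex.ofReal_cpow (by linarith : (0 : ℝ) ≤ -y)]
    have : Complex.exp (Real.pi * Complex.I * (1 / 2)) = Complex.I := by
      rw [show (Real.pi : ℂ) * Complex.I * (1 / 2) = Real.pi / 2 * Complex.I by ring,
        Complex.exp_pi_div_two_mul_I]
    rw [this, mul_comm]
    push_cast
    rfl
  · refine ⟨y ^ (1 / 2 : ℝ), Real.rpow_pos_of_pos h _, ?_⟩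
    rw [if_pos h, Complex.ofReal_cpow h.le]
    push_cast
    rfl

/-- The directions of the edges of the first Euclidean octagon. -/
def edgeDir1 : Fin 7 → ℂ := ![-Complex.I, -1, -Complex.I, 1, Complex.I, 1, Complex.I]

/-- The directions of the edges of the second Euclidean octagon. -/
def edgeDir2 : Fin 7 → ℂ := ![Complex.I, -1, Complex.I, -1, -Complex.I, 1, -Complex.I]

/-- The direction of `dh` along the edges. -/
def edgeDir3 : Fin 7 → ℂ := ![-1, -1, -1, -Complex.I, 1, 1, 1]

lemma norm_edgeDir (k : Fin 7) : ‖edgeDir1 k‖ = 1 ∧ ‖edgeDir2 k‖ = 1 ∧ ‖edgeDir3 k‖ = 1 := by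
  fin_cases k <;> simp [edgeDir1, edgeDir2, edgeDir3]

variable {a b t ρ : ℝ}

lemma Admissible.mem_punctured (h : Admissible a b t) {k : Fin 7} {x : ℝ}
    (hx : x ∈ Ioo (vtx a b t k.castSucc) (vtx a b t k.succ)) :
    (x : ℂ) ∈ puncturedHalfPlane a b t := by
  refine ⟨by simp, fun j hj => ?_⟩
  have hj' : x = vtx a b t j := by exact_mod_cast hj
  rw [hj'] at hx
  have h1 := h.vtx_strictMono.lt_iff_lt.1 hx.1
  have h2 := h.vtx_strictMono.lt_iff_lt.1 hx.2
  rw [Fin.lt_def] at h1 h2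
  simp at h1 h2
  omega

lemma Admissible.order (h : Admissible a b t) : -t < -a ∧ -a < -(1 / b) ∧ -(1 / b) < -(1 / t) ∧
    -(1 / t) < 0 ∧ 0 < 1 / t ∧ 1 / t < 1 / a ∧ 1 / a < b ∧ b < t := by
  obtain ⟨ha, hb, ht, hat, hab, hbt⟩ := h
  have h1 : 1 / b < a := by rw [div_lt_iff₀ hb]; rw [div_lt_iff₀ ha] at hab; linarith
  have h2 : 1 / t < 1 / b := one_div_lt_one_div_of_lt hb hbt
  have h3 : 1 / t < 1 / a := one_div_lt_one_div_of_lt ha hat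
  have h4 : 0 < 1 / t := by positivity
  refine ⟨?_, ?_, ?_, ?_, ?_, ?_, ?_, ?_⟩ <;> linarith

/-- The three forms have constant directions along each edge. -/
lemma Admissible.edge_forms (h : Admissible a b t) (hρ : 0 < ρ) {k : Fin 7} {x : ℝ}
    (hx : x ∈ Ioo (vtx a b t k.castSucc) (vtx a b t k.succ)) :
    ∃ p q r : ℝ, 0 < p ∧ 0 < q ∧ 0 < r ∧ phi1 a b t ρ x = edgeDir1 k * p ∧
      phi2 a b t ρ x = edgeDir2 k * q ∧ dh t x = edgeDir3 k * r := by
  obtain ⟨⟨h1, h2, h3, h4⟩, h5, h6, h7, h8⟩ := puncturedHalfPlane_ne (h.mem_punctured hx)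
  norm_cast at h1 h2 h3 h4 h5 h6 h7 h8
  obtain ⟨p1, hp1, e1⟩ := exists_cpow_half_ofReal h1
  obtain ⟨p2, hp2, e2⟩ := exists_cpow_half_ofReal h2
  obtain ⟨p3, hp3, e3⟩ := exists_cpow_half_ofReal h3
  obtain ⟨p4, hp4, e4⟩ := exists_cpow_half_ofReal h4
  obtain ⟨p5, hp5, e5⟩ := exists_cpow_half_ofReal h5
  obtain ⟨p6, hp6, e6⟩ := exists_cpow_half_ofReal h6
  obtain ⟨p7, hp7, e7⟩ := exists_cpow_half_ofReal h7
  obtain ⟨p8, hp8, e8⟩ := exists_cpow_half_ofReal h8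
  refine ⟨ρ * (p5 * p6⁻¹ * p7 * p8⁻¹) / (p1 * p2 * p3 * p4),
    ρ⁻¹ * (p5⁻¹ * p6 * p7⁻¹ * p8) / (p1 * p2 * p3 * p4), 1 / (p1 * p2 * p3 * p4),
    by positivity, by positivity, by positivity, ?_⟩
  push_cast at e1 e2 e3 e4 e5 e6 e7 e8
  have hI : Complex.I ^ 2 = -1 := Complex.I_sq
  have hI0 := Complex.I_ne_zero
  rw [phi1, phi2, dh]
  simp only [wDenom, cpow_neg_half, e1, e2, e3, e4, e5, e6, e7, e8]
  have o := h.order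
  have hρ' : (ρ : ℂ) ≠ 0 := by exact_mod_cast hρ.ne'
  have c1 : (p1 : ℂ) ≠ 0 := by exact_mod_cast hp1.ne'
  have c2 : (p2 : ℂ) ≠ 0 := by exact_mod_cast hp2.ne'
  have c3 : (p3 : ℂ) ≠ 0 := by exact_mod_cast hp3.ne'
  have c4 : (p4 : ℂ) ≠ 0 := by exact_mod_cast hp4.ne'
  have c5 : (p5 : ℂ) ≠ 0 := by exact_mod_cast hp5.ne'
  have c6 : (p6 : ℂ) ≠ 0 := by exact_mod_cast hp6.ne'
  have c7 : (p7 : ℂ) ≠ 0 := by exact_mod_cast hp7.ne'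
  have c8 : (p8 : ℂ) ≠ 0 := by exact_mod_cast hp8.ne'
  clear e1 e2 e3 e4 e5 e6 e7 e8
  fin_cases k
  · have hx1 : -t < x := hx.1
    have hx2 : x < -a := hx.2
    rw [if_pos (show 0 < x + t by linarith), if_neg (show ¬ 0 < x + 1 / t by linarith),
      if_neg (show ¬ 0 < x - 1 / t by linarith), if_neg (show ¬ 0 < x - t by linarith),
      if_neg (show ¬ 0 < x + a by linarith), if_neg (show ¬ 0 < x + 1 / b by linarith),
      if_neg (show ¬ 0 < x - 1 / a by linarith), if_neg (show ¬ 0 < x - b by linarith)]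
    refine ⟨?_, ?_, ?_⟩ <;> simp [edgeDir1, edgeDir2, edgeDir3] <;> field_simp <;> ring_nf <;>
      simp [hI]
  · have hx1 : -a < x := hx.1
    have hx2 : x < -1 / b := hx.2
    rw [neg_div] at hx2
    rw [if_pos (show 0 < x + t by linarith), if_neg (show ¬ 0 < x + 1 / t by linarith),
      if_neg (show ¬ 0 < x - 1 / t by linarith), if_neg (show ¬ 0 < x - t by linarith),
      if_pos (show 0 < x + a by linarith), if_neg (show ¬ 0 < x + 1 / b by linarith),
      if_neg (show ¬ 0 < x - 1 / a by linarith), if_neg (show ¬ 0 < x - b by linarith)]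
    refine ⟨?_, ?_, ?_⟩ <;> simp [edgeDir1, edgeDir2, edgeDir3] <;> field_simp <;> ring_nf <;>
      simp [hI]
  · have hx1 : -1 / b < x := hx.1
    have hx2 : x < -1 / t := hx.2
    rw [neg_div] at hx1 hx2
    rw [if_pos (show 0 < x + t by linarith), if_neg (show ¬ 0 < x + 1 / t by linarith),
      if_neg (show ¬ 0 < x - 1 / t by linarith), if_neg (show ¬ 0 < x - t by linarith),
      if_pos (show 0 < x + a by linarith), if_pos (show 0 < x + 1 / b by linarith),
      if_neg (show ¬ 0 < x - 1 / a by linarith), if_neg (show ¬ 0 < x - b by linarith)]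
    refine ⟨?_, ?_, ?_⟩ <;> simp [edgeDir1, edgeDir2, edgeDir3] <;> field_simp <;> ring_nf <;>
      simp [hI]
  · have hx1 : -1 / t < x := hx.1
    have hx2 : x < 1 / t := hx.2
    rw [neg_div] at hx1
    rw [if_pos (show 0 < x + t by linarith), if_pos (show 0 < x + 1 / t by linarith),
      if_neg (show ¬ 0 < x - 1 / t by linarith), if_neg (show ¬ 0 < x - t by linarith),
      if_pos (show 0 < x + a by linarith), if_pos (show 0 < x + 1 / b by linarith),
      if_neg (show ¬ 0 < x - 1 / a by linarith), if_neg (show ¬ 0 < x - b by linarith)]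
    refine ⟨?_, ?_, ?_⟩ <;> simp [edgeDir1, edgeDir2, edgeDir3] <;> field_simp <;> ring_nf <;>
      simp [hI]
  · have hx1 : 1 / t < x := hx.1
    have hx2 : x < 1 / a := hx.2
    rw [if_pos (show 0 < x + t by linarith), if_pos (show 0 < x + 1 / t by linarith),
      if_pos (show 0 < x - 1 / t by linarith), if_neg (show ¬ 0 < x - t by linarith),
      if_pos (show 0 < x + a by linarith), if_pos (show 0 < x + 1 / b by linarith),
      if_neg (show ¬ 0 < x - 1 / a by linarith), if_neg (show ¬ 0 < x - b by linarith)]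
    refine ⟨?_, ?_, ?_⟩ <;> simp [edgeDir1, edgeDir2, edgeDir3] <;> field_simp
  · have hx1 : 1 / a < x := hx.1
    have hx2 : x < b := hx.2
    rw [if_pos (show 0 < x + t by linarith), if_pos (show 0 < x + 1 / t by linarith),
      if_pos (show 0 < x - 1 / t by linarith), if_neg (show ¬ 0 < x - t by linarith),
      if_pos (show 0 < x + a by linarith), if_pos (show 0 < x + 1 / b by linarith),
      if_pos (show 0 < x - 1 / a by linarith), if_neg (show ¬ 0 < x - b by linarith)]
    refine ⟨?_, ?_, ?_⟩ <;> simp [edgeDir1, edgeDir2, edgeDir3] <;> field_simp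
  · have hx1 : b < x := hx.1
    have hx2 : x < t := hx.2
    rw [if_pos (show 0 < x + t by linarith), if_pos (show 0 < x + 1 / t by linarith),
      if_pos (show 0 < x - 1 / t by linarith), if_neg (show ¬ 0 < x - t by linarith),
      if_pos (show 0 < x + a by linarith), if_pos (show 0 < x + 1 / b by linarith),
      if_pos (show 0 < x - 1 / a by linarith), if_pos (show 0 < x - b by linarith)]
    refine ⟨?_, ?_, ?_⟩ <;> simp [edgeDir1, edgeDir2, edgeDir3] <;> field_simp <;> ring_nf <;>
      simp [hI]

lemma continuous_cayley_ofReal : Continuous fun x : ℝ => cayley x := by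
  refine continuous_iff_continuousAt.2 fun x => ?_
  exact (hasDerivAt_cayley (z := (x : ℂ)) (by simp)).continuousAt.comp
    Complex.continuous_ofReal.continuousAt

lemma continuous_radialPrimitive_real {P : Set ℂ} {F : ℂ → ℂ} (hF : HalfSingular P F) :
    Continuous fun x : ℝ => radialPrimitive F (cayley x) :=
  hF.continuousOn_radialPrimitive.comp_continuous continuous_cayley_ofReal fun x =>
    cayley_mem_closedBall (z := (x : ℂ)) (by simp)

/-- Real points map to the circle, where the primitive is differentiable only within the closed
disk. This suffices because the composed curve stays in the punctured closed disk. -/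
lemma Admissible.hasDerivAt_real (h : Admissible a b t) {F f : ℂ → ℂ}
    (hF : HalfSingular (corners a b t) F)
    (hf : ∀ z ∈ puncturedHalfPlane a b t,
      f z = F (cayley z) * (2 * Complex.I / (z + Complex.I) ^ 2)) {x : ℝ}
    (hx : (x : ℂ) ∈ puncturedHalfPlane a b t) :
    HasDerivAt (fun x : ℝ => radialPrimitive F (cayley x)) (f x) x := by
  have h1 := hF.hasDerivWithinAt_radialPrimitive (h.cayley_mem hx)
  have h2 : HasDerivAt (fun x : ℝ => cayley x) (2 * Complex.I / ((x : ℂ) + Complex.I) ^ 2) x :=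
    (hasDerivAt_cayley (z := (x : ℂ)) (by simp)).comp_ofReal
  have hev : ∀ᶠ y : ℝ in 𝓝 x, cayley y ∈ closedBall (0 : ℂ) 1 \ corners a b t := by
    have h3 : ∀ᶠ y : ℝ in 𝓝 x, ∀ k, y ≠ vtx a b t k := by
      rw [eventually_all]
      intro k
      refine isOpen_ne.mem_nhds fun h0 => hx.2 k ?_
      rw [h0]
    filter_upwards [h3] with y hy
    exact h.cayley_mem ⟨by simp, fun k hk => hy k (by exact_mod_cast hk)⟩
  have h4 := (h1.scomp x (h2.hasDerivWithinAt (s := {y : ℝ | cayley y ∈ closedBall (0 : ℂ) 1 \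
    corners a b t})) fun y hy => hy).hasDerivAt hev
  refine h4.congr_deriv ?_
  rw [hf x hx, smul_eq_mul, mul_comm]

/-- The integral of a form of constant direction along a real interval. -/
lemma Admissible.edge_integral (h : Admissible a b t) {F f : ℂ → ℂ}
    (hF : HalfSingular (corners a b t) F)
    (hf : ∀ z ∈ puncturedHalfPlane a b t,
      f z = F (cayley z) * (2 * Complex.I / (z + Complex.I) ^ 2)) {x y : ℝ} (hxy : x < y)
    (hP : ∀ s ∈ Ioo x y, (s : ℂ) ∈ puncturedHalfPlane a b t) {ω : ℂ} (hω : ‖ω‖ = 1)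
    (hdir : ∀ s ∈ Ioo x y, ∃ p : ℝ, 0 < p ∧ f s = ω * p) :
    IntervalIntegrable (fun s : ℝ => f s) MeasureTheory.volume x y ∧
      radialPrimitive F (cayley y) - radialPrimitive F (cayley x) =
        ω * ‖∫ s in x..y, f s‖ ∧
      0 < ‖∫ s in x..y, f s‖ := by
  have hω0 : ω ≠ 0 := fun h0 => by simp [h0] at hω
  set V : ℝ → ℂ := fun s => radialPrimitive F (cayley s) with hV
  have hVc : Continuous V := continuous_radialPrimitive_real hF
  have hVd : ∀ s ∈ Ioo x y, HasDerivAt V (f s) s := fun s hs => h.hasDerivAt_real hF hf (hP s hs)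
  -- Dividing by the constant direction reduces the integral to a real function with positive
  -- derivative.
  set g : ℝ → ℝ := fun s => (ω⁻¹ * V s).re with hg
  set g' : ℝ → ℝ := fun s => (ω⁻¹ * f s).re with hg'
  have hgd : ∀ s ∈ Ioo x y, HasDerivAt g (g' s) s := by
    intro s hs
    have h1 := (hVd s hs).const_mul ω⁻¹
    exact (Complex.reCLM.hasFDerivAt.comp_hasDerivAt s h1)
  have hfg : ∀ s ∈ Ioo x y, f s = ω * g' s ∧ 0 < g' s := by
    intro s hs
    obtain ⟨p, hp, e⟩ := hdir s hs
    have : g' s = p := by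
      rw [hg']
      simp only [e, inv_mul_cancel_left₀ hω0, Complex.ofReal_re]
    rw [this]
    exact ⟨e, hp⟩
  have hgc : Continuous g := by fun_prop
  -- Absolute convergence needs no estimate at the vertices: a nonnegative derivative of a function
  -- continuous on the closed interval is integrable.
  have hgint : MeasureTheory.IntegrableOn g' (Ioc x y) :=
    intervalIntegral.integrableOn_deriv_of_nonneg hgc.continuousOn hgd fun s hs => (hfg s hs).2.le
  have hfint : IntervalIntegrable (fun s : ℝ => f s) MeasureTheory.volume x y := by
    rw [intervalIntegrable_iff_integrableOn_Ioo_of_le hxy.le]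
    have h1 : MeasureTheory.IntegrableOn (fun s => ω * (g' s : ℂ)) (Ioo x y) :=
      ((hgint.mono_set Ioo_subset_Ioc_self).ofReal).const_mul ω
    exact h1.congr_fun (fun s hs => (hfg s hs).1.symm) measurableSet_Ioo
  have hI : ∫ s in x..y, f s = V y - V x :=
    intervalIntegral.integral_eq_sub_of_hasDerivAt_of_le hxy.le hVc.continuousOn hVd hfint
  have hI2 : ∫ s in x..y, f s = ω * ((g y - g x : ℝ) : ℂ) := by
    rw [← intervalIntegral.integral_eq_sub_of_hasDerivAt_of_le hxy.le hgc.continuousOn hgd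
      ((intervalIntegrable_iff_integrableOn_Ioc_of_le hxy.le).2 hgint),
      ← intervalIntegral.integral_ofReal, ← intervalIntegral.integral_const_mul]
    rw [intervalIntegral.integral_of_le hxy.le, intervalIntegral.integral_of_le hxy.le,
      MeasureTheory.integral_Ioc_eq_integral_Ioo, MeasureTheory.integral_Ioc_eq_integral_Ioo]
    exact MeasureTheory.setIntegral_congr_fun measurableSet_Ioo fun s hs => (hfg s hs).1
  have hmono : g x < g y := by
    have : StrictMonoOn g (Icc x y) := by
      refine strictMonoOn_of_deriv_pos (convex_Icc x y) hgc.continuousOn fun s hs => ?_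
      rw [interior_Icc] at hs
      rw [(hgd s hs).deriv]
      exact (hfg s hs).2
    exact this ⟨le_rfl, hxy.le⟩ ⟨hxy.le, le_rfl⟩ hxy
  have hnorm : ‖∫ s in x..y, f s‖ = g y - g x := by
    rw [hI2, norm_mul, hω, one_mul, Complex.norm_real, Real.norm_of_nonneg (by linarith)]
  refine ⟨hfint, ?_, ?_⟩
  · rw [hnorm, ← hI2, hI]
  · rw [hnorm]
    linarith

end

noncomputable section

open Filter Topology

/-! ### The coordinate functions of the surface on the disk -/

/-- The `x`-coordinate of the surface. -/
def surfX (a b t ρ : ℝ) (ζ : ℂ) : ℝ :=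
  ((radialPrimitive (disk2 a b t ρ) ζ - radialPrimitive (disk1 a b t ρ) ζ) / 2).re

/-- The `y`-coordinate of the surface. -/
def surfY (a b t ρ : ℝ) (ζ : ℂ) : ℝ :=
  (Complex.I / 2 * (radialPrimitive (disk2 a b t ρ) ζ + radialPrimitive (disk1 a b t ρ) ζ)).re

/-- The height on the surface. -/
def surfZ (a b t : ℝ) (ζ : ℂ) : ℝ := (radialPrimitive (disk3 a b t) ζ).re

/-- The surface, parametrized by the closed unit disk. -/
def surf (a b t ρ : ℝ) (ζ : ℂ) : E3 := !₂[surfX a b t ρ ζ, surfY a b t ρ ζ, surfZ a b t ζ]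

variable {a b t ρ : ℝ}

lemma surfX_neg (ζ : ℂ) : surfX a b t ρ (-ζ) = -surfX a b t ρ ζ := by
  rw [surfX, surfX, radialPrimitive_neg_of_even disk1_neg, radialPrimitive_neg_of_even disk2_neg,
    ← Complex.neg_re]
  congr 1
  ring

lemma surfY_neg (ζ : ℂ) : surfY a b t ρ (-ζ) = -surfY a b t ρ ζ := by
  rw [surfY, surfY, radialPrimitive_neg_of_even disk1_neg, radialPrimitive_neg_of_even disk2_neg,
    ← Complex.neg_re]
  congr 1
  ring

lemma surfZ_neg (ζ : ℂ) : surfZ a b t (-ζ) = -surfZ a b t ζ := by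
  rw [surfZ, surfZ, radialPrimitive_neg_of_even disk3_neg, Complex.neg_re]

lemma surf_neg (ζ : ℂ) : surf a b t ρ (-ζ) = -surf a b t ρ ζ := by
  ext i
  fin_cases i <;> simp [surf, surfX_neg, surfY_neg, surfZ_neg]

lemma surf_apply (ζ : ℂ) : surf a b t ρ ζ 0 = surfX a b t ρ ζ ∧ surf a b t ρ ζ 1 = surfY a b t ρ ζ ∧
    surf a b t ρ ζ 2 = surfZ a b t ζ := by
  simp [surf]

lemma mem_punctured_of_im_pos {z : ℂ} (hz : 0 < z.im) : z ∈ puncturedHalfPlane a b t := by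
  refine ⟨hz.le, fun k hk => ?_⟩
  rw [hk] at hz
  simp at hz

/-- With oddness of the coordinates, this reduces everything about the last four vertices to the
first four. -/
lemma cayley_vtx_natAdd {a b t : ℝ} (h : Admissible a b t) (k : Fin 4) :
    cayley (vtx a b t (Fin.natAdd 4 k)) = -cayley (vtx a b t (Fin.castAdd 4 k)) := by
  rw [vtx_natAdd, vtx_castAdd, ← cayley_neg_inv (by simp)]
  · push_cast; rfl
  · exact_mod_cast h.node_ne_zero k

lemma image_cayley_upper : cayley '' {z : ℂ | 0 < z.im} = ball 0 1 := by
  ext ζ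
  constructor
  · rintro ⟨z, hz, rfl⟩
    exact cayley_mem_ball hz
  · intro hζ
    have h1 : ζ ≠ 1 := by rintro rfl; simp at hζ
    obtain ⟨z, -, hz, hz', -⟩ := exists_cayley_eq (ball_subset_closedBall hζ) h1
    exact ⟨z, hz' hζ, hz⟩

lemma cayley_vtx_opposite {a b t : ℝ} (h : Admissible a b t) :
    cayley (vtx a b t 4) = -cayley (vtx a b t 0) ∧ cayley (vtx a b t 5) = -cayley (vtx a b t 1) ∧
      cayley (vtx a b t 6) = -cayley (vtx a b t 2) ∧ cayley (vtx a b t 7) = -cayley (vtx a b t 3) :=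
  ⟨cayley_vtx_natAdd h 0, cayley_vtx_natAdd h 1, cayley_vtx_natAdd h 2, cayley_vtx_natAdd h 3⟩

/-- The lengths of the edges in the image of `dh`. -/
def edgeH (a b t : ℝ) (k : Fin 7) : ℝ :=
  ‖∫ x in (vtx a b t k.castSucc)..(vtx a b t k.succ), dh t (x : ℂ)‖

variable (h : Admissible a b t)
include h

lemma continuousOn_surfX : ContinuousOn (surfX a b t ρ) (closedBall 0 1) :=
  Complex.continuous_re.comp_continuousOn
    (((halfSingular_disk2 h ρ).continuousOn_radialPrimitive.sub
      (halfSingular_disk1 h ρ).continuousOn_radialPrimitive).div_const 2)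

lemma continuousOn_surfY : ContinuousOn (surfY a b t ρ) (closedBall 0 1) :=
  Complex.continuous_re.comp_continuousOn (continuousOn_const.mul
    ((halfSingular_disk2 h ρ).continuousOn_radialPrimitive.add
      (halfSingular_disk1 h ρ).continuousOn_radialPrimitive))

lemma continuousOn_surfZ : ContinuousOn (surfZ a b t) (closedBall 0 1) :=
  Complex.continuous_re.comp_continuousOn (halfSingular_disk3 h).continuousOn_radialPrimitive

lemma continuousOn_surf : ContinuousOn (surf a b t ρ) (closedBall 0 1) := by
  refine (PiLp.continuous_toLp 2 _).comp_continuousOn (continuousOn_pi.2 fun i => ?_)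
  fin_cases i
  exacts [continuousOn_surfX h, continuousOn_surfY h, continuousOn_surfZ h]

/-- The Weierstrass map in terms of the map on the disk. -/
lemma weierstrassMap_eq (hρ : 0 < ρ) {z : ℂ} (hz : 0 ≤ z.im) :
    weierstrassMap a b t ρ z = surf a b t ρ (cayley z) := by
  have h1 := halfSingular_disk1 h ρ
  have h2 := halfSingular_disk2 h ρ
  have h3 := halfSingular_disk3 h
  have hc := mem_closedBall_zero_iff.1 (cayley_mem_closedBall hz)
  have e1 : integralFromI (fun w => (phi2 a b t ρ w - phi1 a b t ρ w) / 2) z =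
      (radialPrimitive (disk2 a b t ρ) (cayley z) -
        radialPrimitive (disk1 a b t ρ) (cayley z)) / 2 := by
    have hF := (h2.const_mul (1 / 2)).add (h1.const_mul (-1 / 2))
    rw [hF.integralFromI_eq (fun w hw => ?_) hz,
      HalfSingular.radialPrimitive_add (h2.const_mul (1 / 2)) (h1.const_mul (-1 / 2)) hc,
      HalfSingular.radialPrimitive_const_mul, HalfSingular.radialPrimitive_const_mul]
    · ring
    · rw [phi1_eq_disk1 h hρ (mem_punctured_of_im_pos hw),
        phi2_eq_disk2 h hρ (mem_punctured_of_im_pos hw)]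
      ring
  have e2 : integralFromI (fun w => Complex.I / 2 * (phi2 a b t ρ w + phi1 a b t ρ w)) z =
      Complex.I / 2 * (radialPrimitive (disk2 a b t ρ) (cayley z) +
        radialPrimitive (disk1 a b t ρ) (cayley z)) := by
    have hF := (h2.add h1).const_mul (Complex.I / 2)
    rw [hF.integralFromI_eq (fun w hw => ?_) hz, HalfSingular.radialPrimitive_const_mul,
      HalfSingular.radialPrimitive_add h2 h1 hc]
    rw [phi1_eq_disk1 h hρ (mem_punctured_of_im_pos hw),
      phi2_eq_disk2 h hρ (mem_punctured_of_im_pos hw)]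
    ring
  have e3 : integralFromI (dh t) z = radialPrimitive (disk3 a b t) (cayley z) :=
    h3.integralFromI_eq (fun w hw => dh_eq_disk3 h (mem_punctured_of_im_pos hw)) hz
  rw [weierstrassMap, e1, e2, e3]
  rfl

lemma weierstrassVertex_eq (hρ : 0 < ρ) (k : Fin 8) :
    weierstrassVertex a b t ρ k = surf a b t ρ (cayley (vtx a b t k)) :=
  weierstrassMap_eq h hρ (by simp)

/-- The closure of the Weierstrass image is the image of the closed disk. -/
lemma weierstrassImage_eq (hρ : 0 < ρ) :
    weierstrassImage a b t ρ = surf a b t ρ '' closedBall 0 1 := by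
  have h1 : weierstrassMap a b t ρ '' {z : ℂ | 0 < z.im} = surf a b t ρ '' ball 0 1 := by
    rw [← image_cayley_upper, image_image]
    exact image_congr fun z hz => weierstrassMap_eq h hρ (le_of_lt hz)
  rw [weierstrassImage, h1]
  refine Subset.antisymm ?_ ?_
  · refine closure_minimal (image_mono ball_subset_closedBall) ?_
    exact ((isCompact_closedBall 0 1).image_of_continuousOn (continuousOn_surf h)).isClosed
  · rw [← closure_ball (0 : ℂ) one_ne_zero]
    refine ContinuousOn.image_closure ?_
    rw [closure_ball (0 : ℂ) one_ne_zero]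
    exact continuousOn_surf h

lemma edge1 (hρ : 0 < ρ) (k : Fin 7) :
    IntervalIntegrable (fun x : ℝ => phi1 a b t ρ (x : ℂ)) MeasureTheory.volume
        (vtx a b t k.castSucc) (vtx a b t k.succ) ∧
      radialPrimitive (disk1 a b t ρ) (cayley (vtx a b t k.succ)) -
        radialPrimitive (disk1 a b t ρ) (cayley (vtx a b t k.castSucc)) =
          edgeDir1 k * edgeI a b t ρ k ∧ 0 < edgeI a b t ρ k :=
  h.edge_integral (halfSingular_disk1 h ρ) (fun _ hz => phi1_eq_disk1 h hρ hz)
    (h.vtx_strictMono k.castSucc_lt_succ) (fun _ hs => h.mem_punctured hs) (norm_edgeDir k).1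
    fun s hs => by
      obtain ⟨p, q, r, hp, hq, hr, e1, e2, e3⟩ := h.edge_forms hρ hs
      exact ⟨p, hp, e1⟩

lemma edge2 (hρ : 0 < ρ) (k : Fin 7) :
    IntervalIntegrable (fun x : ℝ => phi2 a b t ρ (x : ℂ)) MeasureTheory.volume
        (vtx a b t k.castSucc) (vtx a b t k.succ) ∧
      radialPrimitive (disk2 a b t ρ) (cayley (vtx a b t k.succ)) -
        radialPrimitive (disk2 a b t ρ) (cayley (vtx a b t k.castSucc)) =
          edgeDir2 k * edgeJ a b t ρ k ∧ 0 < edgeJ a b t ρ k :=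
  h.edge_integral (halfSingular_disk2 h ρ) (fun _ hz => phi2_eq_disk2 h hρ hz)
    (h.vtx_strictMono k.castSucc_lt_succ) (fun _ hs => h.mem_punctured hs) (norm_edgeDir k).2.1
    fun s hs => by
      obtain ⟨p, q, r, hp, hq, hr, e1, e2, e3⟩ := h.edge_forms hρ hs
      exact ⟨q, hq, e2⟩

lemma edge3 (k : Fin 7) :
    radialPrimitive (disk3 a b t) (cayley (vtx a b t k.succ)) -
        radialPrimitive (disk3 a b t) (cayley (vtx a b t k.castSucc)) =
          edgeDir3 k * edgeH a b t k ∧ 0 < edgeH a b t k :=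
  (h.edge_integral (halfSingular_disk3 h) (fun _ hz => dh_eq_disk3 h hz)
    (h.vtx_strictMono k.castSucc_lt_succ) (fun _ hs => h.mem_punctured hs) (norm_edgeDir k).2.2
    fun s hs => by
      obtain ⟨p, q, r, hp, hq, hr, e1, e2, e3⟩ := h.edge_forms one_pos hs
      exact ⟨r, hr, e3⟩).2

/-- It translates edge lengths into coordinates. The factor i/2 in the second Weierstrass coordinate
turns the real part into minus half an imaginary part. -/
lemma surf_edge (hρ : 0 < ρ) (k : Fin 7) :
    surfX a b t ρ (cayley (vtx a b t k.succ)) - surfX a b t ρ (cayley (vtx a b t k.castSucc)) =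
        (edgeDir2 k * edgeJ a b t ρ k - edgeDir1 k * edgeI a b t ρ k).re / 2 ∧
      surfY a b t ρ (cayley (vtx a b t k.succ)) - surfY a b t ρ (cayley (vtx a b t k.castSucc)) =
        -(edgeDir2 k * edgeJ a b t ρ k + edgeDir1 k * edgeI a b t ρ k).im / 2 ∧
      surfZ a b t (cayley (vtx a b t k.succ)) - surfZ a b t (cayley (vtx a b t k.castSucc)) =
        (edgeDir3 k).re * edgeH a b t k := by
  have e1 := (edge1 h hρ k).2.1
  have e2 := (edge2 h hρ k).2.1
  have e3 := (edge3 h k).1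
  rw [← e1, ← e2]
  refine ⟨?_, ?_, ?_⟩
  · simp [surfX]
    ring
  · simp [surfY]
    ring
  · rw [surfZ, surfZ, ← Complex.sub_re, e3, Complex.re_mul_ofReal]

end

/-! ### Dependence of the edge lengths on ρ -/

section

variable {a b t ρ : ℝ}

lemma edgeI_eq (hρ : 0 < ρ) (k : Fin 7) : edgeI a b t ρ k = ρ * edgeI a b t 1 k := by
  have : ∀ x : ℝ, phi1 a b t ρ x = ρ * phi1 a b t 1 x := by
    intro x
    simp only [phi1]
    push_cast
    ring
  simp only [edgeI, this, intervalIntegral.integral_const_mul, norm_mul, Complex.norm_real,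
    Real.norm_of_nonneg hρ.le]

lemma edgeJ_eq (hρ : 0 < ρ) (k : Fin 7) : edgeJ a b t ρ k = ρ⁻¹ * edgeJ a b t 1 k := by
  have : ∀ x : ℝ, phi2 a b t ρ x = (ρ⁻¹ : ℝ) * phi2 a b t 1 x := by
    intro x
    simp only [phi2]
    push_cast
    ring
  simp only [edgeJ, this, intervalIntegral.integral_const_mul, norm_mul, Complex.norm_real,
    Real.norm_of_nonneg (inv_nonneg.2 hρ.le)]

lemma quotI_eq (hρ : 0 < ρ) : quotI a b t ρ = quotI a b t 1 := by
  rw [quotI, edgeI_eq hρ, edgeI_eq hρ 1, edgeI_eq hρ 2, ← mul_add, mul_div_mul_left _ _ hρ.ne',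
    quotI]

lemma quotJ_eq (hρ : 0 < ρ) : quotJ a b t ρ = quotJ a b t 1 := by
  rw [quotJ, edgeJ_eq hρ, edgeJ_eq hρ 1, edgeJ_eq hρ 2, ← mul_add,
    mul_div_mul_left _ _ (inv_ne_zero hρ.ne'), quotJ]

/-- The period conditions determine the factor `ρ` and the quotient condition. -/
lemma periodConditions_iff (h : Admissible a b t) (hρ : 0 < ρ) : PeriodConditions a b t ρ ↔
    quotI a b t 1 = quotJ a b t 1 ∧ ρ ^ 2 = edgeJ a b t 1 1 / edgeI a b t 1 1 := by
  have hI := fun k => (edge1 h one_pos k).2.2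
  have hJ := fun k => (edge2 h one_pos k).2.2
  have hI1 := hI 1
  have hJ1 := hJ 1
  rw [PeriodConditions]
  rw [edgeI_eq hρ 0, edgeI_eq hρ 1, edgeI_eq hρ 2, edgeJ_eq hρ 0, edgeJ_eq hρ 1, edgeJ_eq hρ 2,
    quotI, quotJ]
  rw [← mul_add, ← mul_add]
  generalize edgeI a b t 1 0 + edgeI a b t 1 2 = p, edgeJ a b t 1 0 + edgeJ a b t 1 2 = q at *
  generalize edgeI a b t 1 1 = r, edgeJ a b t 1 1 = s at *
  rw [div_eq_div_iff hI1.ne' hJ1.ne', eq_div_iff hI1.ne']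
  have e : ∀ u v : ℝ, ρ * u = ρ⁻¹ * v ↔ ρ ^ 2 * u = v := by
    intro u v
    rw [eq_inv_mul_iff_mul_eq₀ hρ.ne', sq, mul_assoc]
  rw [e, e]
  constructor
  · rintro ⟨h1, h2⟩
    exact ⟨by rw [← h1, ← h2]; ring, h2⟩
  · rintro ⟨h1, h2⟩
    refine ⟨mul_right_cancel₀ hI1.ne' ?_, h2⟩
    rw [← h2] at h1
    linear_combination h1

end

noncomputable section

open Filter Topology

/-! ### Necessity of the period conditions -/

lemma circlePt_mem (s : ℝ) : circlePt s ∈ closedBall (0 : ℂ) 1 := by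
  rw [mem_closedBall_zero_iff, circlePt, Complex.norm_exp_ofReal_mul_I]

lemma continuous_circlePt : Continuous circlePt := by
  unfold circlePt
  fun_prop

/-- A continuous function that is constant along an arc has the same value at its end points. -/
lemma IsMinimalDisk.eq_at_vertices {u : ℂ → E3} {θ : Fin 9 → ℝ} {S : Set E3} {V : Fin 8 → E3}
    (hu : IsMinimalDisk u θ S V) (k : Fin 8) (i : Fin 3) (c : ℝ)
    (hk : ∀ z ∈ arc θ k, u z i = c) : V k i = c ∧ V (k + 1) i = c := by
  have hlt : θ k.castSucc < θ k.succ := hu.strictMono k.castSucc_lt_succ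
  have hcont : Continuous fun s => u (circlePt s) i :=
    (EuclideanSpace.proj (𝕜 := ℝ) i).continuous.comp
      (hu.continuousOn.comp_continuous continuous_circlePt circlePt_mem)
  have hcl : ∀ s ∈ Icc (θ k.castSucc) (θ k.succ), u (circlePt s) i = c := by
    have h1 : IsClosed {s | u (circlePt s) i = c} := isClosed_eq hcont continuous_const
    have h2 : Ioo (θ k.castSucc) (θ k.succ) ⊆ {s | u (circlePt s) i = c} :=
      fun s hs => hk _ ⟨s, hs, rfl⟩
    have h3 := closure_minimal h2 h1
    rwa [closure_Ioo hlt.ne] at h3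
  have hend : circlePt (θ k.succ) = corner θ (k + 1) := by
    by_cases hk7 : k = 7
    · subst hk7
      change circlePt (θ 8) = circlePt (θ 0)
      rw [hu.closes_up, circlePt, circlePt]
      push_cast
      rw [add_mul, Complex.exp_add, Complex.exp_two_pi_mul_I, mul_one]
    · rw [corner]
      congr 2
      fin_cases k <;> first | rfl | exact absurd rfl hk7
  constructor
  · rw [← hu.vertex k]
    exact hcl _ ⟨le_rfl, hlt.le⟩
  · rw [← hu.vertex (k + 1), ← hend]
    exact hcl _ ⟨hlt.le, le_rfl⟩

/-- Relations between the vertices of a box octagon. -/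
lemma IsBoxOctagon.vertex_relations {A B : ℝ} {S : Set E3} {V : Fin 8 → E3}
    (hS : IsBoxOctagon A B S V) :
    V 3 0 = V 0 0 ∧ V 3 1 = V 0 1 ∧ V 2 0 = V 1 0 ∧ V 2 1 = V 1 1 ∧ V 7 1 = V 0 1 ∧
      V 7 2 = V 0 2 := by
  obtain ⟨u, θ, hu, h0, h1, h2, h3, h4, h5, h6, h7⟩ := hS.disk
  have e0 := hu.eq_at_vertices 0 0 A fun z hz => (h0 z hz).1
  have e1 := hu.eq_at_vertices 1 1 (-B) fun z hz => (h1 z hz).1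
  have e2 := hu.eq_at_vertices 2 0 A fun z hz => (h2 z hz).1
  have m3 : ∀ z ∈ arc θ 3, u z ∈ openSegmentAt A (-1) := fun z hz => h3 ▸ mem_image_of_mem u hz
  have m7 : ∀ z ∈ arc θ 7, u z ∈ openSegmentAt A 1 := fun z hz => h7 ▸ mem_image_of_mem u hz
  have e3 := hu.eq_at_vertices 3 1 0 fun z hz => (m3 z hz).2.1
  have e7 := hu.eq_at_vertices 7 1 0 fun z hz => (m7 z hz).2.1
  have e7' := hu.eq_at_vertices 7 2 1 fun z hz => (m7 z hz).2.2
  simp only [Fin.isValue, Fin.reduceAdd] at e0 e1 e2 e3 e7 e7'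
  refine ⟨?_, ?_, ?_, ?_, ?_, ?_⟩ <;> linarith [e0.1, e0.2, e1.1, e1.2, e2.1, e2.2, e3.1, e3.2,
    e7.1, e7.2, e7'.1, e7'.2]

variable {a b t ρ : ℝ}

/-- Only distances, orthogonality and parallelism survive an unknown similarity. These facts about
four vertices and the edge V₈V₁ already force V₄ - V₁ to be vertical in the original coordinates. -/
lemma periodConditions_of_isFundamentalOctagon (h : Admissible a b t) (hρ : 0 < ρ)
    (hO : IsFundamentalOctagonUpToSimilarity (weierstrassImage a b t ρ)
      (weierstrassVertex a b t ρ)) : PeriodConditions a b t ρ := by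
  obtain ⟨c, T, hc, M, -, A, B, hS, -⟩ := hO
  obtain ⟨r1, r2, r3, r4, r5, r6⟩ := hS.vertex_relations
  set V := weierstrassVertex a b t ρ with hV
  set W : Fin 8 → E3 := fun k => T (c • V k) with hW
  -- Differences of vertices remove the translation part of the isometry.
  have hL : ∀ j k, T.linearIsometryEquiv (c • (V j - V k)) = W j - W k := by
    intro j k
    have := T.map_vsub (c • V j) (c • V k)
    rw [vsub_eq_sub, vsub_eq_sub, ← smul_sub] at this
    exact this
  have hVk : ∀ k, V k = surf a b t ρ (cayley (vtx a b t k)) := weierstrassVertex_eq h hρ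
  have hx : ∀ k, V k 0 = surfX a b t ρ (cayley (vtx a b t k)) := fun k => by rw [hVk, surf_apply _ |>.1]
  have hy : ∀ k, V k 1 = surfY a b t ρ (cayley (vtx a b t k)) := fun k => by
    rw [hVk, surf_apply _ |>.2.1]
  have hz : ∀ k, V k 2 = surfZ a b t (cayley (vtx a b t k)) := fun k => by
    rw [hVk, surf_apply _ |>.2.2]
  have d0 := surf_edge h hρ 0
  have d1 := surf_edge h hρ 1
  have d2 := surf_edge h hρ 2
  have d3 := surf_edge h hρ 3
  simp only [← hx, ← hy, ← hz] at d0 d1 d2 d3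
  simp [edgeDir1, edgeDir2, edgeDir3] at d0 d1 d2 d3
  have n4 : V 4 = -V 0 := by
    rw [hVk, hVk, ← surf_neg, (cayley_vtx_opposite h).1]
  have n7 : V 7 = -V 3 := by
    rw [hVk, hVk, ← surf_neg, (cayley_vtx_opposite h).2.2.2]
  have hH := (edge3 h 1).2
  have hI3 := (edge1 h hρ 3).2.2
  have hJ3 := (edge2 h hρ 3).2.2
  rw [n4] at d3
  simp at d3
  have hc0 : c ≠ 0 := hc.ne'
  -- the top edge is orthogonal to the vertical direction
  have hort : inner ℝ (V 3 - V 0) (V 0 - V 7) = 0 := by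
    have h1 : inner ℝ (c • (V 3 - V 0)) (c • (V 0 - V 7)) = (0 : ℝ) := by
      rw [← T.linearIsometryEquiv.inner_map_map, hL, hL, PiLp.inner_apply]
      simp [Fin.sum_univ_three]
      rw [show W 3 0 - W 0 0 = 0 by linarith, show W 0 1 - W 7 1 = 0 by linarith,
        show W 0 2 - W 7 2 = 0 by linarith]
      ring
    rw [inner_smul_left, inner_smul_right] at h1
    simpa [hc0] using h1
  -- In the box both differences are vertical. Crosswise multiplication by their heights states that
  -- they are parallel without any division.
  have hpar : (W 2 2 - W 1 2) • (V 3 - V 0) = (W 3 2 - W 0 2) • (V 2 - V 1) := by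
    have h1 : T.linearIsometryEquiv (c • ((W 2 2 - W 1 2) • (V 3 - V 0))) =
        T.linearIsometryEquiv (c • ((W 3 2 - W 0 2) • (V 2 - V 1))) := by
      rw [smul_comm, map_smul, hL, smul_comm, map_smul, hL]
      ext i
      fin_cases i
      · simp
        rw [show W 3 0 - W 0 0 = 0 by linarith, show W 2 0 - W 1 0 = 0 by linarith]
        ring
      · simp
        rw [show W 3 1 - W 0 1 = 0 by linarith, show W 2 1 - W 1 1 = 0 by linarith]
        ring
      · simp
        ring
    exact smul_right_injective _ hc0 (T.linearIsometryEquiv.injective h1)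
  -- A zero height would make the whole difference vanish, but on the Weierstrass side this edge has
  -- height change of size `edgeH a b t 1` > 0.
  have hne : W 2 2 - W 1 2 ≠ 0 := by
    intro h0
    have h1 : T.linearIsometryEquiv (c • (V 2 - V 1)) = 0 := by
      rw [hL]
      ext i
      fin_cases i
      · simp; linarith
      · simp; linarith
      · simp; linarith
    have h2 : V 2 - V 1 = 0 := by
      have := (map_eq_zero_iff _ T.linearIsometryEquiv.injective).1 h1
      exact (smul_eq_zero.1 this).resolve_left hc0
    have h3 := congrArg (fun p : E3 => p 2) h2
    simp at h3
    linarith [d1.2.2]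
  -- Here V 7 = -V 3, and V 0 + V 3 is a nonzero multiple of the x-direction, with length (I₄ +
  -- J₄)/2.
  have hX : V 3 0 - V 0 0 = 0 := by
    rw [n7, PiLp.inner_apply] at hort
    simp [Fin.sum_univ_three] at hort
    have e1 : V 0 1 + V 3 1 = 0 := by linarith [d3.2.1]
    have e2 : V 0 2 + V 3 2 = 0 := by linarith [d3.2.2]
    rw [e1, e2] at hort
    simp at hort
    rcases hort with h5 | h5 <;> linarith [d3.1]
  have hY : V 3 1 - V 0 1 = 0 := by
    have h1 := congrArg (fun p : E3 => p 1) hpar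
    simp at h1
    have e : V 2 1 - V 1 1 = 0 := by linarith [d1.2.1]
    rw [e, mul_zero, mul_eq_zero] at h1
    exact h1.resolve_left hne
  constructor
  · linarith [d0.2.1, d1.2.1, d2.2.1]
  · linarith [d0.1, d1.1, d2.1]

end

noncomputable section

open Filter Topology

/-! ### Signs of the forms in the upper half-plane -/

/-- The square root halves an argument in (0, π). -/
lemma cpow_half_mem_quadrant {z : ℂ} (hz : 0 < z.im) :
    0 < (z ^ (1 / 2 : ℂ)).re ∧ 0 < (z ^ (1 / 2 : ℂ)).im := by
  have h0 : z ≠ 0 := by rintro rfl; simp at hz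
  have h1 : 0 < z.arg := by
    refine lt_of_le_of_ne (Complex.arg_nonneg_iff.2 hz.le) fun h => ?_
    exact hz.ne' (Complex.arg_eq_zero_iff.1 h.symm).2
  have h2 : z.arg < Real.pi := Complex.arg_lt_pi_iff.2 (Or.inr hz.ne')
  have e : Complex.log z * (1 / 2) = ((Real.log ‖z‖ / 2 : ℝ) : ℂ) + ((z.arg / 2 : ℝ) : ℂ) * Complex.I := by
    rw [Complex.log]
    push_cast
    ring
  rw [Complex.cpow_def_of_ne_zero h0, e, Complex.exp_re, Complex.exp_im]
  simp only [Complex.add_re, Complex.add_im, Complex.ofReal_re, Complex.ofReal_im, Complex.re_ofReal_mul,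
    Complex.im_ofReal_mul, Complex.I_re, Complex.I_im, mul_zero, mul_one, zero_add, add_zero]
  constructor
  · exact mul_pos (Real.exp_pos _) (Real.cos_pos_of_mem_Ioo ⟨by linarith, by linarith⟩)
  · exact mul_pos (Real.exp_pos _) (Real.sin_pos_of_pos_of_lt_pi (by linarith) (by linarith))

/-- Quotients of square roots lie in the fourth quadrant. -/
lemma quotient_mem_quadrant {z : ℂ} (hz : 0 < z.im) {r s : ℝ} (hrs : r < s) :
    0 < ((z + s) ^ (1 / 2 : ℂ) * ((z + r) ^ (1 / 2 : ℂ))⁻¹).re ∧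
      ((z + s) ^ (1 / 2 : ℂ) * ((z + r) ^ (1 / 2 : ℂ))⁻¹).im < 0 := by
  have h1 := cpow_half_mem_quadrant (z := z + s) (by simpa using hz)
  have h2 := cpow_half_mem_quadrant (z := z + r) (by simpa using hz)
  have hne : z + r ≠ 0 := fun h => by
    have := congrArg Complex.im h
    simp at this
    exact hz.ne' this
  have h4 := Complex.normSq_pos.2 (cpow_half_ne_zero hne)
  -- The real part is positive because both roots lie in the first quadrant. The sign of the
  -- imaginary part is then read off from the square, the quotient (z + s)/(z + r).
  have hsq : ((z + s) ^ (1 / 2 : ℂ) * ((z + r) ^ (1 / 2 : ℂ))⁻¹) ^ 2 = (z + s) * (z + r)⁻¹ := by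
    rw [mul_pow, inv_pow, cpow_half_sq, cpow_half_sq]
  have hre : 0 < ((z + s) ^ (1 / 2 : ℂ) * ((z + r) ^ (1 / 2 : ℂ))⁻¹).re := by
    rw [Complex.mul_re, Complex.inv_re, Complex.inv_im]
    have := mul_pos h1.1 (div_pos h2.1 h4)
    have := mul_pos h1.2 (div_pos h2.2 h4)
    rw [neg_div, mul_neg]
    linarith
  refine ⟨hre, ?_⟩
  have him := congrArg Complex.im hsq
  have h5 : ((z + s) * (z + r)⁻¹).im < 0 := by
    have h6 := Complex.normSq_pos.2 hne
    rw [Complex.mul_im, Complex.inv_re, Complex.inv_im]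
    have : (z + s).re * (-(z + r).im / Complex.normSq (z + r)) +
        (z + s).im * ((z + r).re / Complex.normSq (z + r)) =
        -(z.im * (s - r)) / Complex.normSq (z + r) := by
      simp
      ring
    rw [this]
    exact div_neg_of_neg_of_pos (by have := mul_pos hz (sub_pos.2 hrs); linarith) h6
  rw [sq, Complex.mul_im] at him
  by_contra hcon
  push Not at hcon
  have := mul_nonneg hre.le hcon
  linarith

variable {a b t ρ : ℝ}

lemma sub_inv_im_pos {z : ℂ} (hz : 0 < z.im) : 0 < (z - 1 / z).im := by
  have h0 : z ≠ 0 := by rintro rfl; simp at hz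
  have := Complex.normSq_pos.2 h0
  rw [Complex.sub_im, one_div, Complex.inv_im, neg_div, sub_neg_eq_add]
  positivity

/-- The variable w = z - 1/z is invariant under z ↦ -1/z and maps the half-plane to itself, so each
pair of factors becomes a single linear factor in w. -/
lemma mul_factor_eq {z : ℂ} (hz : z ≠ 0) {s : ℝ} (hs : s ≠ 0) :
    (z + s) * (z - 1 / s) = z * (z - 1 / z - ((1 / s - s : ℝ) : ℂ)) := by
  have : (s : ℂ) ≠ 0 := by exact_mod_cast hs
  push_cast
  field_simp
  ring

lemma Admissible.gaussSq_eq (h : Admissible a b t) {z : ℂ} (hz : z ≠ 0) :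
    gaussSq a b z =
      (z - 1 / z - ((1 / a - a : ℝ) : ℂ)) / (z - 1 / z - ((b - 1 / b : ℝ) : ℂ)) := by
  have e1 := mul_factor_eq hz h.a_pos.ne'
  have e2 := mul_factor_eq hz (s := 1 / b) (one_div_ne_zero h.b_pos.ne')
  have e3 : (z + 1 / b) * (z - b) = z * (z - 1 / z - ((b - 1 / b : ℝ) : ℂ)) := by
    rw [one_div_one_div] at e2
    rw [← e2]
    push_cast
    rw [one_div_one_div]
  rw [gaussSq, e1, e3, mul_div_mul_left _ _ hz]

lemma Admissible.nodes_lt (h : Admissible a b t) : 1 / a - a < b - 1 / b := by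
  have o := h.order
  linarith [o.2.1, o.2.2.2.2.2.2.1]

/-- In terms of w this is the map (w - n)/(w - m) with real n < m; its determinant n - m is
negative, so it exchanges the two half-planes. -/
lemma Admissible.gaussSq_im_neg (h : Admissible a b t) {z : ℂ} (hz : 0 < z.im) :
    (gaussSq a b z).im < 0 := by
  have h0 : z ≠ 0 := by rintro rfl; simp at hz
  have hw := sub_inv_im_pos hz
  rw [h.gaussSq_eq h0]
  generalize z - 1 / z = w at hw
  have hne : w - ((b - 1 / b : ℝ) : ℂ) ≠ 0 := fun h => by
    have := congrArg Complex.im h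
    rw [Complex.sub_im, Complex.ofReal_im, Complex.zero_im] at this
    linarith
  have h6 := Complex.normSq_pos.2 hne
  have hlt := h.nodes_lt
  generalize 1 / a - a = n at *
  generalize b - 1 / b = m at *
  rw [Complex.div_im]
  have : (w - n).im * (w - m).re / Complex.normSq (w - m) -
      (w - n).re * (w - m).im / Complex.normSq (w - m) =
      -(w.im * (m - n)) / Complex.normSq (w - m) := by
    simp
    ring
  rw [this]
  exact div_neg_of_neg_of_pos (by have := mul_pos hw (sub_pos.2 hlt); linarith) h6

/-- The Gauss map `φ₁ / dh` takes the upper half-plane to the first quadrant. -/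
lemma Admissible.gauss_mem_quadrant (h : Admissible a b t) (hρ : 0 < ρ) {z : ℂ} (hz : 0 < z.im) :
    ∃ G : ℂ, 0 < G.re ∧ 0 < G.im ∧ phi1 a b t ρ z = G * dh t z ∧ phi2 a b t ρ z = G⁻¹ * dh t z := by
  have hz' := mem_punctured_of_im_pos (a := a) (b := b) (t := t) hz
  obtain ⟨-, n1, n2, n3, n4⟩ := puncturedHalfPlane_ne hz'
  have hD := wDenom_ne_zero hz'
  have o := h.order
  set p := (z + a) ^ (1 / 2 : ℂ) * ((z + 1 / b) ^ (1 / 2 : ℂ))⁻¹ with hp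
  set q := (z - 1 / a) ^ (1 / 2 : ℂ) * ((z - b) ^ (1 / 2 : ℂ))⁻¹ with hq
  have hp4 : 0 < p.re ∧ p.im < 0 := by
    have := quotient_mem_quadrant hz (r := 1 / b) (s := a) (by linarith)
    push_cast at this
    exact this
  have hq4 : 0 < q.re ∧ q.im < 0 := by
    have := quotient_mem_quadrant hz (r := -b) (s := -(1 / a)) (by linarith)
    push_cast at this
    simpa only [← sub_eq_add_neg] using this
  have him : (p * q).im < 0 := by
    rw [Complex.mul_im]
    have := mul_neg_of_pos_of_neg hp4.1 hq4.2
    have := mul_neg_of_neg_of_pos hp4.2 hq4.1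
    linarith
  -- Two factors from the fourth quadrant give only Im(pq) < 0. The sign of the real part comes from
  -- Im((pq)²) = 2 Re(pq) Im(pq) < 0.
  have hre : 0 < (p * q).re := by
    have hsq : (p * q) ^ 2 = gaussSq a b z := by
      rw [hp, hq, mul_pow, mul_pow, mul_pow, inv_pow, inv_pow, cpow_half_sq, cpow_half_sq,
        cpow_half_sq, cpow_half_sq, gaussSq]
      field_simp
    have h1 := h.gaussSq_im_neg hz
    rw [← hsq, sq, Complex.mul_im] at h1
    by_contra hcon
    push Not at hcon
    have := mul_nonneg_of_nonpos_of_nonpos hcon him.le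
    linarith
  have hρ' : (ρ : ℂ) ≠ 0 := by exact_mod_cast hρ.ne'
  have e1 : phi1 a b t ρ z = Complex.I * ρ * (p * q) * dh t z := by
    rw [phi1, dh, cpow_neg_half, cpow_neg_half, hp, hq]
    have hI := Complex.I_sq
    field_simp
    rw [hI]
    ring
  have hpq : p * q ≠ 0 := fun h0 => by rw [h0] at hre; simp at hre
  have hG : Complex.I * ρ * (p * q) ≠ 0 := mul_ne_zero (mul_ne_zero Complex.I_ne_zero hρ') hpq
  refine ⟨Complex.I * ρ * (p * q), ?_, ?_, e1, ?_⟩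
  · rw [mul_assoc, Complex.I_mul_re, Complex.im_ofReal_mul]
    have := mul_neg_of_pos_of_neg hρ him
    linarith
  · rw [mul_assoc, Complex.I_mul_im, Complex.re_ofReal_mul]
    exact mul_pos hρ hre
  · have h1 := phi1_mul_phi2 hρ hz'
    rw [e1, sq, mul_assoc, mul_left_comm] at h1
    rw [eq_inv_mul_iff_mul_eq₀ hG]
    exact mul_left_cancel₀ (dh_ne_zero hz') (by rw [← h1])

/-- The square is the negative number -1 - s², and the product of two numbers in the first quadrant
has positive imaginary part. -/
lemma I_factor (s : ℝ) : ∃ κ : ℝ, 0 < κ ∧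
    (Complex.I + s) ^ (1 / 2 : ℂ) * (Complex.I - s) ^ (1 / 2 : ℂ) = Complex.I * κ := by
  have h1 := cpow_half_mem_quadrant (z := Complex.I + s) (by simp)
  have h2 := cpow_half_mem_quadrant (z := Complex.I - s) (by simp)
  have hsq : ((Complex.I + s) ^ (1 / 2 : ℂ) * (Complex.I - s) ^ (1 / 2 : ℂ)) ^ 2 =
      ((-1 - s ^ 2 : ℝ) : ℂ) := by
    rw [mul_pow, cpow_half_sq, cpow_half_sq]
    push_cast
    linear_combination Complex.I_sq
  set p := (Complex.I + s) ^ (1 / 2 : ℂ) * (Complex.I - s) ^ (1 / 2 : ℂ) with hp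
  have him : 0 < p.im := by
    rw [hp, Complex.mul_im]
    have := mul_pos h1.1 h2.2
    have := mul_pos h1.2 h2.1
    linarith
  have hre : p.re = 0 := by
    have := congrArg Complex.im hsq
    rw [sq, Complex.mul_im, Complex.ofReal_im] at this
    have h3 : p.re * p.im = 0 := by linarith
    exact (mul_eq_zero.1 h3).resolve_right him.ne'
  exact ⟨p.im, him, Complex.ext (by simp [hre]) (by simp)⟩

/-- The height increases along the rays from the origin. -/
lemma Admissible.dh_mul_re_pos (h : Admissible a b t) {z : ℂ} (hz : 0 < z.im) :
    0 < (dh t z * z).re := by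
  have ht0 : 0 < t := by linarith [h.one_lt_t]
  set U : Set ℂ := {z | 0 < z.im} with hU
  have hcont : ContinuousOn (fun z => (dh t z * z).re) U :=
    Complex.continuous_re.comp_continuousOn
      ((continuousOn_dh (a := a) (b := b) (t := t)).mono (fun z hz => mem_punctured_of_im_pos hz)
        |>.mul continuousOn_id)
  -- With κ = z dh/dz and m = t - 1/t one has κ²(w² - m²) = -1. If κ were imaginary, then w² would
  -- be a positive real number, which is impossible for w in the open upper half-plane.
  have hne : ∀ z ∈ U, (dh t z * z).re ≠ 0 := by
    intro z hz h0
    have hz0 : z ≠ 0 := by rintro rfl; simp [hU] at hz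
    have hz' := mem_punctured_of_im_pos (a := a) (b := b) (t := t) hz
    have hD := wDenom_ne_zero hz'
    set m : ℝ := t - 1 / t with hm
    set w := z - 1 / z with hw
    have e1 := mul_factor_eq hz0 ht0.ne'
    have e2 := mul_factor_eq hz0 (s := 1 / t) (by positivity)
    have hsq : wDenom t z ^ 2 = z ^ 2 * (w ^ 2 - (m : ℂ) ^ 2) := by
      rw [wDenom_sq, e1]
      have e3 : (z + 1 / t) * (z - t) = z * (w - ((t - 1 / t : ℝ) : ℂ)) := by
        rw [one_div_one_div] at e2
        rw [← e2]
        push_cast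
        rw [one_div_one_div]
      rw [e3, hm, hw]
      push_cast
      ring
    set κ : ℂ := dh t z * z with hκ
    have hκ0 : κ ≠ 0 := mul_ne_zero (dh_ne_zero hz') hz0
    have hκ2 : κ ^ 2 * (w ^ 2 - (m : ℂ) ^ 2) = -1 := by
      have : κ ^ 2 = -z ^ 2 / wDenom t z ^ 2 := by
        rw [hκ, dh]
        have hI := Complex.I_sq
        field_simp
        rw [hI]
      rw [this, hsq]
      have h5 : z ^ 2 * (w ^ 2 - (m : ℂ) ^ 2) ≠ 0 := hsq ▸ pow_ne_zero 2 hD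
      have h6 : w ^ 2 - (m : ℂ) ^ 2 ≠ 0 := right_ne_zero_of_mul h5
      field_simp
    have hκI : κ = κ.im * Complex.I := Complex.ext (by simp [h0]) (by simp)
    have him0 : κ.im ≠ 0 := fun h1 => hκ0 (Complex.ext h0 h1)
    have hw2 : w ^ 2 = ((m ^ 2 + 1 / κ.im ^ 2 : ℝ) : ℂ) := by
      rw [hκI, mul_pow, Complex.I_sq] at hκ2
      have h7 : (κ.im : ℂ) ≠ 0 := by exact_mod_cast him0
      push_cast
      field_simp
      linear_combination -hκ2
    have hwim := sub_inv_im_pos hz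
    rw [← hw] at hwim
    have i1 := congrArg Complex.im hw2
    have i2 := congrArg Complex.re hw2
    rw [sq, Complex.mul_im, Complex.ofReal_im] at i1
    rw [sq, Complex.mul_re, Complex.ofReal_re] at i2
    have hre : w.re = 0 := by
      have h3 : w.re * w.im = 0 := by linarith
      exact (mul_eq_zero.1 h3).resolve_right hwim.ne'
    rw [hre] at i2
    have : 0 < m ^ 2 + 1 / κ.im ^ 2 := by positivity
    nlinarith
  have hI : 0 < (dh t Complex.I * Complex.I).re := by
    obtain ⟨κ₁, h1, e1⟩ := I_factor t
    obtain ⟨κ₂, h2, e2⟩ := I_factor (1 / t)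
    push_cast at e2
    have hD : wDenom t Complex.I = ((-(κ₁ * κ₂) : ℝ) : ℂ) := by
      rw [wDenom]
      push_cast
      linear_combination (Complex.I - t) ^ (1 / 2 : ℂ) * (Complex.I + t) ^ (1 / 2 : ℂ) * e2 +
        (Complex.I * κ₂) * e1 + κ₁ * κ₂ * Complex.I_sq
    rw [dh, hD, div_mul_eq_mul_div, Complex.I_mul_I]
    have : (-1 : ℂ) / ((-(κ₁ * κ₂) : ℝ) : ℂ) = ((1 / (κ₁ * κ₂) : ℝ) : ℂ) := by
      push_cast
      rw [neg_div_neg_eq]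
    rw [this, Complex.ofReal_re]
    positivity
  by_contra hcon
  push Not at hcon
  -- The sign is constant on the connected half-plane and is positive at i.
  have hconn : IsPreconnected U := (convex_halfSpace_im_gt 0).isPreconnected
  obtain ⟨y, hy, hy0⟩ := hconn.intermediate_value (a := z) (b := Complex.I) hz (by simp [hU]) hcont
    ⟨hcon, hI.le⟩
  exact hne y hy hy0

end

noncomputable section

open Filter Topology

/-! ### Level curves of the height -/

/-- If `Re A` is constant along the curve `θ ↦ r θ + i θ`, then the derivative of `Re B` along this
curve has the sign of `-Im (B' / A')`. -/
lemma hasDerivAt_along_level {A B : ℂ → ℂ} {A' B' : ℂ} {r : ℝ → ℝ} {θ₀ c : ℝ}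
    (hA : HasDerivAt A A' (r θ₀ + θ₀ * Complex.I)) (hB : HasDerivAt B B' (r θ₀ + θ₀ * Complex.I))
    (hA' : A'.re ≠ 0) (hr : ContinuousAt r θ₀)
    (hc : ∀ᶠ θ in 𝓝 θ₀, (A (r θ + θ * Complex.I)).re = c) :
    HasDerivAt (fun θ : ℝ => (B (r θ + θ * Complex.I)).re)
      (-(B' * (starRingEnd ℂ) A').im / A'.re) θ₀ := by
  set γ : ℝ → ℂ := fun θ => r θ + θ * Complex.I with hγ
  have hγc : ContinuousAt γ θ₀ := by
    have : ContinuousAt (fun θ => (r θ : ℂ)) θ₀ := Complex.continuous_ofReal.continuousAt.comp hr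
    exact this.add (by fun_prop)
  -- This is Re(A'·(γ θ - γ θ₀)), of lower order since Re A is constant along the curve. It is
  -- implicit differentiation from continuity of r and differentiability at the single point.
  set f : ℝ → ℝ := fun θ => A'.re * (r θ - r θ₀) - A'.im * (θ - θ₀) with hf
  have ho : f =o[𝓝 θ₀] fun θ => γ θ - γ θ₀ := by
    have h1 := (hA.isLittleO.comp_tendsto hγc.tendsto)
    have h2 : (fun θ => (A (γ θ) - A (γ θ₀) - (γ θ - γ θ₀) * A').re) =o[𝓝 θ₀]
        fun θ => γ θ - γ θ₀ := by
      refine Asymptotics.IsBigO.trans_isLittleO ?_ h1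
      refine Asymptotics.IsBigO.of_bound 1 (Eventually.of_forall fun θ => ?_)
      rw [one_mul]
      simpa using Complex.abs_re_le_norm (A (γ θ) - A (γ θ₀) - (γ θ - γ θ₀) * A')
    refine (h2.congr' ?_ EventuallyEq.rfl).neg_left.congr_left fun θ => neg_neg (f θ)
    filter_upwards [hc] with θ hθ
    have h3 : (A (γ θ₀)).re = c := hc.self_of_nhds
    rw [Complex.sub_re, Complex.sub_re, hθ, h3]
    simp [hf, hγ]
    ring
  -- Subtracting the negligible term f/Re A' leaves a fixed multiple of θ - θ₀, so increments of the
  -- curve are controlled by increments of the angle.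
  have hO : (fun θ => γ θ - γ θ₀) =O[𝓝 θ₀] fun θ => θ - θ₀ := by
    have h1 : (fun θ => ((f θ / A'.re : ℝ) : ℂ)) =o[𝓝 θ₀] fun θ => γ θ - γ θ₀ := by
      refine Asymptotics.IsBigO.trans_isLittleO ?_ ho
      refine Asymptotics.IsBigO.of_bound ‖A'.re‖⁻¹ (Eventually.of_forall fun θ => ?_)
      rw [Complex.norm_real, norm_div, div_eq_inv_mul]
    refine h1.right_isBigO_sub.trans ?_
    refine Asymptotics.IsBigO.of_bound ‖(A'.im / A'.re : ℂ) + Complex.I‖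
      (Eventually.of_forall fun θ => ?_)
    have e : γ θ - γ θ₀ - ((f θ / A'.re : ℝ) : ℂ) =
        ((A'.im / A'.re : ℂ) + Complex.I) * ((θ - θ₀ : ℝ) : ℂ) := by
      have : (A'.re : ℂ) ≠ 0 := by exact_mod_cast hA'
      simp only [hγ, hf]
      push_cast
      field_simp
      ring
    rw [e, norm_mul, Complex.norm_real]
  have hrd : HasDerivAt r (A'.im / A'.re) θ₀ := by
    rw [hasDerivAt_iff_isLittleO]
    refine ((ho.trans_isBigO hO).const_mul_left (A'.re)⁻¹).congr_left fun θ => ?_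
    simp only [hf, smul_eq_mul]
    field_simp
  have hγd : HasDerivAt γ ((A'.im / A'.re : ℝ) + Complex.I) θ₀ := by
    have h1 := hrd.ofReal_comp.add ((Complex.ofRealCLM.hasDerivAt (x := θ₀)).mul_const Complex.I)
    refine h1.congr_deriv ?_
    simp
  have h2 := Complex.reCLM.hasFDerivAt.comp_hasDerivAt θ₀ (hB.scomp_of_eq θ₀ hγd rfl)
  refine h2.congr_deriv ?_
  simp [Complex.mul_re, Complex.mul_im]
  field_simp
  ring

lemma eq_left_of_hasDerivAt_zero {f : ℝ → ℝ} {p q : ℝ} (hc : ContinuousOn f (Icc p q))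
    (hd : ∀ x ∈ Ioo p q, HasDerivAt f 0 x) : ∀ x ∈ Icc p q, f x = f p := by
  intro x hx
  rcases hx.1.eq_or_lt with rfl | hlt
  · rfl
  · obtain ⟨y, -, hy⟩ := exists_hasDerivAt_eq_slope f (fun _ => 0) hlt
      (hc.mono (Icc_subset_Icc_right hx.2)) fun y hy => hd y ⟨hy.1, hy.2.trans_le hx.2⟩
    rw [eq_div_iff (by linarith)] at hy
    linarith

/-! ### Polar coordinates and the height along rays -/

/-- Polar coordinates on the disk without the points `±1`. -/
def polar (r θ : ℝ) : ℂ := cayley (Complex.exp (r + θ * Complex.I))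

lemma exp_polar_im (r θ : ℝ) :
    (Complex.exp (r + θ * Complex.I)).im = Real.exp r * Real.sin θ := by
  rw [Complex.exp_im]
  simp

lemma exp_polar_im_nonneg (r : ℝ) {θ : ℝ} (hθ : θ ∈ Icc 0 Real.pi) :
    0 ≤ (Complex.exp (r + θ * Complex.I)).im := by
  rw [exp_polar_im]
  exact mul_nonneg (Real.exp_pos _).le (Real.sin_nonneg_of_mem_Icc hθ)

lemma exp_polar_im_pos (r : ℝ) {θ : ℝ} (hθ : θ ∈ Ioo 0 Real.pi) :
    0 < (Complex.exp (r + θ * Complex.I)).im := by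
  rw [exp_polar_im]
  exact mul_pos (Real.exp_pos _) (Real.sin_pos_of_mem_Ioo hθ)

lemma polar_mem (r : ℝ) {θ : ℝ} (hθ : θ ∈ Icc 0 Real.pi) : polar r θ ∈ closedBall (0 : ℂ) 1 :=
  cayley_mem_closedBall (exp_polar_im_nonneg r hθ)

lemma continuousOn_polar :
    ContinuousOn (fun p : ℝ × ℝ => polar p.1 p.2) {p | p.2 ∈ Icc 0 Real.pi} := by
  intro p hp
  have h1 : ContinuousAt (fun p : ℝ × ℝ => Complex.exp (p.1 + p.2 * Complex.I)) p := by fun_prop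
  exact ((hasDerivAt_cayley (exp_polar_im_nonneg p.1 hp)).continuousAt.comp_of_eq h1
    rfl).continuousWithinAt

lemma polar_pi (r : ℝ) : polar r Real.pi = cayley ((-Real.exp r : ℝ) : ℂ) := by
  rw [polar, Complex.exp_add, Complex.exp_pi_mul_I]
  push_cast
  ring_nf

lemma polar_zero (r : ℝ) : polar r 0 = cayley ((Real.exp r : ℝ) : ℂ) := by
  simp [polar]

/-- In the coordinate r + iθ = log z, the map z ↦ -1/z is (r, θ) ↦ (-r, π - θ). -/
lemma polar_neg {r θ : ℝ} (hθ : θ ∈ Icc 0 Real.pi) :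
    polar (-r) (Real.pi - θ) = -polar r θ := by
  rw [polar, polar, ← cayley_neg_inv (exp_polar_im_nonneg r hθ) (Complex.exp_ne_zero _)]
  congr 1
  rw [neg_div, one_div, ← Complex.exp_neg,
    show ((-r : ℝ) : ℂ) + ((Real.pi - θ : ℝ) : ℂ) * Complex.I =
      -((r : ℂ) + θ * Complex.I) + Real.pi * Complex.I by push_cast; ring,
    Complex.exp_add, Complex.exp_pi_mul_I]
  ring

lemma exists_polar {ζ : ℂ} (hζ : ζ ∈ closedBall (0 : ℂ) 1) (h1 : ζ ≠ 1) (h2 : ζ ≠ -1) :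
    ∃ r, ∃ θ ∈ Icc 0 Real.pi, polar r θ = ζ := by
  obtain ⟨z, hz, rfl, -⟩ := exists_cayley_eq hζ h1
  have hz0 : z ≠ 0 := by
    rintro rfl
    exact h2 (by simp [cayley])
  refine ⟨Real.log ‖z‖, z.arg, ⟨Complex.arg_nonneg_iff.2 hz, Complex.arg_le_pi z⟩, ?_⟩
  rw [polar]
  congr 1
  exact Complex.exp_log hz0

lemma cayley_zero : cayley 0 = -1 := by simp [cayley]

lemma tendsto_polar_atBot {θ : ℝ} :
    Tendsto (fun r => polar r θ) atBot (𝓝 (-1)) := by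
  have h1 : Tendsto (fun r : ℝ => Complex.exp (r + θ * Complex.I)) atBot (𝓝 0) := by
    rw [tendsto_zero_iff_norm_tendsto_zero]
    refine Real.tendsto_exp_atBot.congr fun r => ?_
    rw [Complex.norm_exp]
    simp
  have h2 := (hasDerivAt_cayley (z := 0) le_rfl).continuousAt.tendsto.comp h1
  rwa [cayley_zero] at h2

variable {a b t ρ : ℝ}

/-- The height of the upper horizontal edge. -/
def topHeight (a b t : ℝ) : ℝ := surfZ a b t (cayley (vtx a b t 0))

lemma continuousOn_comp_polar {f : ℂ → ℝ} (hf : ContinuousOn f (closedBall 0 1)) {r θ : ℝ → ℝ}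
    {s : Set ℝ} (hr : ContinuousOn r s) (hθ : ContinuousOn θ s) (hm : ∀ x ∈ s, θ x ∈ Icc 0 Real.pi) :
    ContinuousOn (fun x => f (polar (r x) (θ x))) s := by
  have h1 : ContinuousOn (fun x => polar (r x) (θ x)) s :=
    ContinuousOn.comp (g := fun p : ℝ × ℝ => polar p.1 p.2) (f := fun x => (r x, θ x))
      continuousOn_polar (hr.prodMk hθ) hm
  exact hf.comp h1 fun x hx => polar_mem _ (hm x hx)

lemma surfZ_polar_neg {r θ : ℝ} (hθ : θ ∈ Icc 0 Real.pi) :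
    surfZ a b t (polar (-r) (Real.pi - θ)) = -surfZ a b t (polar r θ) := by
  rw [polar_neg hθ, surfZ_neg]

/-- With z = exp u one has dz = z du; this is why the sign of Re(z dh/dz) controls the height along
rays. -/
lemma hasDerivAt_radialPrimitive_exp {F f : ℂ → ℂ}
    (hF : HalfSingular (corners a b t) F)
    (hf : ∀ z ∈ puncturedHalfPlane a b t,
      f z = F (cayley z) * (2 * Complex.I / (z + Complex.I) ^ 2)) {u : ℂ}
    (hu : 0 < (Complex.exp u).im) :
    HasDerivAt (fun u => radialPrimitive F (cayley (Complex.exp u)))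
      (f (Complex.exp u) * Complex.exp u) u := by
  have h1 := (hF.hasDerivAt_radialPrimitive (cayley_mem_ball hu)).comp_of_eq _
    (hasDerivAt_cayley hu.le) rfl
  have h2 := h1.comp_of_eq u (Complex.hasDerivAt_exp u) rfl
  refine h2.congr_deriv ?_
  rw [hf _ (mem_punctured_of_im_pos hu)]

variable (h : Admissible a b t)
include h

/-- The height along the real axis. -/
lemma hasDerivAt_surfZ_real {x : ℝ} (hx : (x : ℂ) ∈ puncturedHalfPlane a b t) :
    HasDerivAt (fun x : ℝ => surfZ a b t (cayley x)) (dh t x).re x :=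
  Complex.reCLM.hasFDerivAt.comp_hasDerivAt x
    (h.hasDerivAt_real (halfSingular_disk3 h) (fun _ hz => dh_eq_disk3 h hz) hx)

lemma continuous_surfZ_real : Continuous fun x : ℝ => surfZ a b t (cayley x) :=
  Complex.continuous_re.comp (continuous_radialPrimitive_real (halfSingular_disk3 h))

lemma surfZ_strictAntiOn : StrictAntiOn (fun x : ℝ => surfZ a b t (cayley x)) (Icc (-t) (-1 / t)) := by
  have key : ∀ k : Fin 7, edgeDir3 k = -1 → StrictAntiOn (fun x : ℝ => surfZ a b t (cayley x))
      (Icc (vtx a b t k.castSucc) (vtx a b t k.succ)) := by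
    intro k hk
    refine strictAntiOn_of_deriv_neg (convex_Icc _ _) (continuous_surfZ_real h).continuousOn
      fun x hx => ?_
    rw [interior_Icc] at hx
    rw [(hasDerivAt_surfZ_real h (h.mem_punctured hx)).deriv]
    obtain ⟨p, q, r, hp, hq, hr, e1, e2, e3⟩ := h.edge_forms one_pos hx
    rw [e3, hk]
    simpa using hr
  have o := h.order
  have k0 : StrictAntiOn (fun x : ℝ => surfZ a b t (cayley x)) (Icc (-t) (-a)) := key 0 rfl
  have k1 : StrictAntiOn (fun x : ℝ => surfZ a b t (cayley x)) (Icc (-a) (-1 / b)) := key 1 rfl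
  have k2 : StrictAntiOn (fun x : ℝ => surfZ a b t (cayley x)) (Icc (-1 / b) (-1 / t)) := key 2 rfl
  rw [neg_div] at k1 k2 ⊢
  rw [neg_div] at k2
  have k01 := k0.union k1 (isGreatest_Icc (by linarith)) (isLeast_Icc (by linarith))
  rw [Icc_union_Icc_eq_Icc (by linarith) (by linarith)] at k01
  have k02 := k01.union k2 (isGreatest_Icc (by linarith)) (isLeast_Icc (by linarith))
  rwa [Icc_union_Icc_eq_Icc (by linarith) (by linarith)] at k02

/-- Between the two middle vertices `dh` is imaginary, so the height is constant. Its value is found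
at the right end 1/t, the antipode of the first vertex. -/
lemma surfZ_bottom {x : ℝ} (hx : x ∈ Icc (-1 / t) (1 / t)) :
    surfZ a b t (cayley x) = -topHeight a b t := by
  have o := h.order
  have hle : -1 / t ≤ 1 / t := by rw [neg_div]; linarith
  have hconst : ∀ y ∈ Icc (-1 / t) (1 / t),
      surfZ a b t (cayley y) = surfZ a b t (cayley ((-1 / t : ℝ) : ℂ)) := by
    refine eq_left_of_hasDerivAt_zero (continuous_surfZ_real h).continuousOn fun x hx => ?_
    have hx' := h.mem_punctured (k := 3) hx
    refine (hasDerivAt_surfZ_real h hx').congr_deriv ?_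
    obtain ⟨p, q, r, hp, hq, hr, e1, e2, e3⟩ := h.edge_forms one_pos (k := 3) hx
    rw [e3]
    simp [edgeDir3]
  have h4 := surfZ_neg (a := a) (b := b) (t := t) (cayley (vtx a b t 0))
  rw [← (cayley_vtx_opposite h).1] at h4
  rw [hconst x hx, topHeight, ← h4]
  exact (hconst (1 / t) ⟨hle, le_rfl⟩).symm

/-- The upper edge passes through z = ∞, so it is handled as the antipode of the lower edge. -/
lemma surfZ_top {x : ℝ} (hx : t ≤ |x|) : surfZ a b t (cayley x) = topHeight a b t := by
  have ht : 0 < t := by linarith [h.one_lt_t]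
  have hx0 : x ≠ 0 := by
    rintro rfl
    rw [abs_zero] at hx
    linarith
  have h1 := cayley_neg_inv (z := (x : ℂ)) (by simp) (by exact_mod_cast hx0)
  have h2 := surfZ_bottom h (x := -1 / x) (by
    have h3 : |(-1) / x| ≤ 1 / t := by
      rw [abs_div, abs_neg, abs_one]
      exact one_div_le_one_div_of_le ht hx
    rw [abs_le, ← neg_div] at h3
    exact h3)
  push_cast at h2
  rw [h1, surfZ_neg] at h2
  linarith

lemma topHeight_pos : 0 < topHeight a b t := by
  have o := h.order
  have hle : -t < -1 / t := by rw [neg_div]; linarith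
  have h1 := surfZ_strictAntiOn h ⟨le_rfl, hle.le⟩ ⟨hle.le, le_rfl⟩ hle
  have h2 := surfZ_bottom h (x := -1 / t) ⟨le_rfl, by rw [neg_div]; linarith⟩
  have h3 := surfZ_top h (x := -t) (by rw [abs_neg]; exact le_abs_self t)
  simp only at h1
  linarith

lemma surfZ_polar_strictMono {θ : ℝ} (hθ : θ ∈ Ioo 0 Real.pi) :
    StrictMono fun r : ℝ => surfZ a b t (polar r θ) := by
  have hd : ∀ r : ℝ, HasDerivAt (fun r : ℝ => surfZ a b t (polar r θ))
      (dh t (Complex.exp (r + θ * Complex.I)) * Complex.exp (r + θ * Complex.I)).re r := by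
    intro r
    have him := exp_polar_im_pos r hθ
    have d1 := hasDerivAt_radialPrimitive_exp (halfSingular_disk3 h)
      (fun _ hz => dh_eq_disk3 h hz) him
    have d2 : HasDerivAt (fun r : ℝ => (r : ℂ) + θ * Complex.I) 1 r :=
      (Complex.ofRealCLM.hasDerivAt (x := r)).add_const _
    have d3 := d1.scomp_of_eq r d2 rfl
    rw [one_smul] at d3
    exact Complex.reCLM.hasFDerivAt.comp_hasDerivAt r d3
  refine strictMono_of_deriv_pos fun r => ?_
  rw [(hd r).deriv]
  exact h.dh_mul_re_pos (exp_polar_im_pos r hθ)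

/-- Rays in the open half-plane give strict monotonicity. The two boundary rays contain parts of the
horizontal edges, where the height is constant, so there strictness needs values away from the
extreme heights. -/
lemma surfZ_polar_mono {θ : ℝ} (hθ : θ ∈ Icc 0 Real.pi) {r₁ r₂ : ℝ} (hr : r₁ < r₂) :
    surfZ a b t (polar r₁ θ) ≤ surfZ a b t (polar r₂ θ) ∧
      (surfZ a b t (polar r₁ θ) < topHeight a b t → -topHeight a b t < surfZ a b t (polar r₂ θ) →
        surfZ a b t (polar r₁ θ) < surfZ a b t (polar r₂ θ)) := by
  have ht : 0 < t := by linarith [h.one_lt_t]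
  have o := h.order
  have hT := topHeight_pos h
  have hpi : ∀ {r₁ r₂ : ℝ}, r₁ < r₂ →
      surfZ a b t (polar r₁ Real.pi) ≤ surfZ a b t (polar r₂ Real.pi) ∧
      (surfZ a b t (polar r₁ Real.pi) < topHeight a b t →
        -topHeight a b t < surfZ a b t (polar r₂ Real.pi) →
        surfZ a b t (polar r₁ Real.pi) < surfZ a b t (polar r₂ Real.pi)) := by
    intro r₁ r₂ hr
    rw [polar_pi, polar_pi]
    have hlt : -Real.exp r₂ < -Real.exp r₁ := neg_lt_neg (Real.exp_lt_exp.2 hr)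
    have p1 : -Real.exp r₁ < 0 := neg_lt_zero.2 (Real.exp_pos r₁)
    have p2 : -Real.exp r₂ < 0 := neg_lt_zero.2 (Real.exp_pos r₂)
    generalize -Real.exp r₁ = x at *
    generalize -Real.exp r₂ = y at *
    have hlo : ∀ x : ℝ, x < 0 → -1 / t ≤ x → surfZ a b t (cayley x) = -topHeight a b t :=
      fun x h0 hx => surfZ_bottom h ⟨hx, by linarith⟩
    have hhi : ∀ x : ℝ, x ≤ -t → surfZ a b t (cayley x) = topHeight a b t :=
      fun x hx => surfZ_top h (by rw [abs_of_nonpos (by linarith)]; linarith)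
    have hle : -t < -1 / t := by rw [neg_div]; linarith
    -- On the negative axis the height depends only on the point truncated to [-t, -1/t], the
    -- interval on which it is strictly decreasing.
    have hcl : ∀ x : ℝ, x < 0 → surfZ a b t (cayley x) =
        surfZ a b t (cayley ((max (-t) (min x (-1 / t)) : ℝ) : ℂ)) := by
      intro x hx
      rcases le_total x (-t) with h1 | h1
      · rw [hhi x h1, min_eq_left (by linarith), max_eq_left h1, hhi _ le_rfl]
      · rcases le_total x (-1 / t) with h2 | h2
        · rw [min_eq_left h2, max_eq_right h1]
        · rw [hlo x hx h2, min_eq_right h2, max_eq_right hle.le,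
            hlo _ (by rw [neg_div]; linarith) le_rfl]
    have hmem : ∀ x : ℝ, max (-t) (min x (-1 / t)) ∈ Icc (-t) (-1 / t) := fun x =>
      ⟨le_max_left _ _, max_le hle.le (min_le_right _ _)⟩
    have hanti := surfZ_strictAntiOn h
    rw [hcl x p1, hcl y p2]
    constructor
    · exact hanti.antitoneOn (hmem y) (hmem x) (max_le_max le_rfl (min_le_min_right _ hlt.le))
    · rw [← hcl x p1, ← hcl y p2]
      intro h1 h2
      rw [hcl x p1, hcl y p2]
      have hx : -t < x := lt_of_not_ge fun hx => h1.ne (hhi x hx)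
      have hy : y < -1 / t := lt_of_not_ge fun hy => h2.ne' (hlo y p2 hy)
      refine hanti (hmem y) (hmem x) ?_
      rw [min_eq_left hy.le]
      exact max_lt (lt_max_of_lt_right (lt_min hx hle)) (lt_max_of_lt_right (lt_min hlt hy))
  rcases hθ.1.eq_or_lt with rfl | h0
  · have e : ∀ r, surfZ a b t (polar r 0) = -surfZ a b t (polar (-r) Real.pi) := by
      intro r
      have := surfZ_polar_neg (a := a) (b := b) (t := t) (r := r) hθ
      rw [sub_zero] at this
      linarith
    obtain ⟨h1, h2⟩ := hpi (neg_lt_neg hr)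
    rw [e, e]
    refine ⟨by linarith, fun h3 h4 => ?_⟩
    have := h2 (by linarith) (by linarith)
    linarith
  rcases hθ.2.eq_or_lt with rfl | h1
  · exact hpi hr
  have hmono := surfZ_polar_strictMono h ⟨h0, h1⟩
  exact ⟨(hmono hr).le, fun _ _ => hmono hr⟩

/-- As r → -∞ the ray tends to z = 0, an interior point of the lower edge. -/
lemma tendsto_surfZ_atBot {θ : ℝ} (hθ : θ ∈ Icc 0 Real.pi) :
    Tendsto (fun r => surfZ a b t (polar r θ)) atBot (𝓝 (-topHeight a b t)) := by
  have h1 : Tendsto (fun r => polar r θ) atBot (𝓝[closedBall 0 1] (-1)) :=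
    tendsto_nhdsWithin_iff.2 ⟨tendsto_polar_atBot, Eventually.of_forall fun r => polar_mem r hθ⟩
  have h2 := (continuousOn_surfZ h (-1) (by simp)).tendsto.comp h1
  have o := h.order
  have h3 := surfZ_bottom h (x := 0) ⟨by rw [neg_div]; linarith, by linarith⟩
  rw [Complex.ofReal_zero, cayley_zero] at h3
  rwa [h3] at h2

lemma tendsto_surfZ_atTop {θ : ℝ} (hθ : θ ∈ Icc 0 Real.pi) :
    Tendsto (fun r => surfZ a b t (polar r θ)) atTop (𝓝 (topHeight a b t)) := by
  have hθ' : Real.pi - θ ∈ Icc 0 Real.pi := ⟨by linarith [hθ.2], by linarith [hθ.1]⟩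
  have h1 := ((tendsto_surfZ_atBot h hθ').comp tendsto_neg_atTop_atBot).neg
  rw [neg_neg] at h1
  refine h1.congr fun r => ?_
  rw [Function.comp_apply, surfZ_polar_neg hθ, neg_neg]

lemma exists_level {c : ℝ} (hc : |c| < topHeight a b t) {θ : ℝ} (hθ : θ ∈ Icc 0 Real.pi) :
    ∃ r, surfZ a b t (polar r θ) = c := by
  rw [abs_lt] at hc
  have hcont : Continuous fun r => surfZ a b t (polar r θ) :=
    continuousOn_univ.1 (continuousOn_comp_polar (r := fun r => r) (θ := fun _ => θ)
      (continuousOn_surfZ h) continuousOn_id continuousOn_const fun _ _ => hθ)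
  have h1 := ((tendsto_surfZ_atBot h hθ).eventually_lt_const hc.1).exists
  have h2 := ((tendsto_surfZ_atTop h hθ).eventually_const_lt hc.2).exists
  obtain ⟨r₁, h1⟩ := h1
  obtain ⟨r₂, h2⟩ := h2
  exact mem_range_of_exists_le_of_exists_ge hcont ⟨r₁, h1.le⟩ ⟨r₂, h2.le⟩

/-- The level curves of the height join the two sides of the half-plane. The `x`-coordinate
increases and the `y`-coordinate decreases along them. -/
lemma exists_level_curve (hρ : 0 < ρ) {c : ℝ} (hc : |c| < topHeight a b t) :
    ∃ r : ℝ → ℝ, (∀ θ ∈ Icc 0 Real.pi, surfZ a b t (polar (r θ) θ) = c) ∧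
      (∀ θ ∈ Icc 0 Real.pi, ∀ s, surfZ a b t (polar s θ) = c → s = r θ) ∧
      StrictMonoOn (fun θ => surfX a b t ρ (polar (r θ) θ)) (Icc 0 Real.pi) ∧
      StrictAntiOn (fun θ => surfY a b t ρ (polar (r θ) θ)) (Icc 0 Real.pi) := by
  have hex : ∀ θ : ℝ, ∃ r, θ ∈ Icc 0 Real.pi → surfZ a b t (polar r θ) = c := by
    intro θ
    by_cases hθ : θ ∈ Icc 0 Real.pi
    · obtain ⟨r, hr⟩ := exists_level h hc hθ
      exact ⟨r, fun _ => hr⟩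
    · exact ⟨0, fun h => absurd h hθ⟩
  choose r hr using hex
  have hc' := abs_lt.1 hc
  have hlt : ∀ θ ∈ Icc 0 Real.pi, ∀ s, s < r θ → surfZ a b t (polar s θ) < c := by
    intro θ hθ s hs
    obtain ⟨h1, h2⟩ := surfZ_polar_mono h hθ hs
    rw [hr θ hθ] at h1 h2
    exact h2 (by linarith) hc'.1
  have hgt : ∀ θ ∈ Icc 0 Real.pi, ∀ s, r θ < s → c < surfZ a b t (polar s θ) := by
    intro θ hθ s hs
    obtain ⟨h1, h2⟩ := surfZ_polar_mono h hθ hs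
    rw [hr θ hθ] at h1 h2
    exact h2 hc'.2 (by linarith)
  have huniq : ∀ θ ∈ Icc 0 Real.pi, ∀ s, surfZ a b t (polar s θ) = c → s = r θ := by
    intro θ hθ s hs
    rcases lt_trichotomy s (r θ) with h1 | h1 | h1
    · exact absurd hs (hlt θ hθ s h1).ne
    · exact h1
    · exact absurd hs (hgt θ hθ s h1).ne'
  have hZc : ∀ s, ContinuousOn (fun θ => surfZ a b t (polar s θ)) (Icc 0 Real.pi) := fun s =>
    continuousOn_comp_polar (r := fun _ => s) (θ := fun θ => θ) (continuousOn_surfZ h)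
      continuousOn_const continuousOn_id fun θ hθ => hθ
  -- Monotonicity along rays makes the level function continuous up to the boundary rays, where the
  -- forms may be singular.
  have hrc : ContinuousOn r (Icc 0 Real.pi) := by
    intro θ₀ hθ₀
    rw [ContinuousWithinAt, tendsto_order]
    constructor
    · intro s hs
      have h1 := (hZc s θ₀ hθ₀).eventually_lt_const (hlt θ₀ hθ₀ s hs)
      filter_upwards [h1, self_mem_nhdsWithin] with θ h2 hθ
      by_contra hcon
      push Not at hcon
      have := (surfZ_polar_mono h hθ (lt_of_le_of_ne hcon fun e => by
        rw [← e, hr θ hθ] at h2; exact lt_irrefl _ h2)).1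
      rw [hr θ hθ] at this
      linarith
    · intro s hs
      have h1 := (hZc s θ₀ hθ₀).eventually_const_lt (hgt θ₀ hθ₀ s hs)
      filter_upwards [h1, self_mem_nhdsWithin] with θ h2 hθ
      by_contra hcon
      push Not at hcon
      have := (surfZ_polar_mono h hθ (lt_of_le_of_ne hcon fun e => by
        rw [e, hr θ hθ] at h2; exact lt_irrefl _ h2)).1
      rw [hr θ hθ] at this
      linarith
  have hcurve : ∀ {f : ℂ → ℝ}, ContinuousOn f (closedBall 0 1) →
      ContinuousOn (fun θ => f (polar (r θ) θ)) (Icc 0 Real.pi) := fun hf =>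
    continuousOn_comp_polar (θ := fun θ => θ) hf hrc continuousOn_id fun θ hθ => hθ
  have hd : ∀ θ ∈ Ioo 0 Real.pi, ∃ p q : ℝ, 0 < p ∧ q < 0 ∧
      HasDerivAt (fun θ => surfX a b t ρ (polar (r θ) θ)) p θ ∧
      HasDerivAt (fun θ => surfY a b t ρ (polar (r θ) θ)) q θ := by
    intro θ hθ
    have him := exp_polar_im_pos (r θ) hθ
    have d1 := hasDerivAt_radialPrimitive_exp (halfSingular_disk1 h ρ)
      (fun _ hz => phi1_eq_disk1 h hρ hz) him
    have d2 := hasDerivAt_radialPrimitive_exp (halfSingular_disk2 h ρ)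
      (fun _ hz => phi2_eq_disk2 h hρ hz) him
    have d3 := hasDerivAt_radialPrimitive_exp (halfSingular_disk3 h)
      (fun _ hz => dh_eq_disk3 h hz) him
    obtain ⟨G, hG1, hG2, e1, e2⟩ := h.gauss_mem_quadrant hρ him
    have hpos := h.dh_mul_re_pos him
    rw [e1] at d1
    rw [e2] at d2
    generalize Complex.exp ((r θ : ℂ) + θ * Complex.I) = z at *
    -- Relative to A', the derivatives of x and y are the multiples (G⁻¹ - G)/2 and i(G⁻¹ + G)/2.
    -- For G in the open first quadrant the first has negative and the second positive imaginary
    -- part, and `hasDerivAt_along_level` reverses these signs.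
    set A' := dh t z * z with hA'
    have hn : 0 < Complex.normSq A' := Complex.normSq_pos.2 fun h0 => by simp [h0] at hpos
    have hGn : 0 < Complex.normSq G := Complex.normSq_pos.2 fun h0 => by simp [h0] at hG1
    have hrcA : ContinuousAt r θ := hrc.continuousAt (Icc_mem_nhds hθ.1 hθ.2)
    have hlev : ∀ᶠ θ in 𝓝 θ, (radialPrimitive (disk3 a b t)
        (cayley (Complex.exp (r θ + θ * Complex.I)))).re = c := by
      filter_upwards [Icc_mem_nhds hθ.1 hθ.2] with θ hθ
      exact hr θ hθ
    have k1 := hasDerivAt_along_level d3 ((d2.sub d1).div_const 2) hpos.ne' hrcA hlev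
    have k2 := hasDerivAt_along_level d3 ((d2.add d1).const_mul (Complex.I / 2)) hpos.ne' hrcA hlev
    refine ⟨_, _, ?_, ?_, k1, k2⟩
    · refine div_pos ?_ hpos
      have : (G⁻¹ * dh t z * z - G * dh t z * z) / 2 * (starRingEnd ℂ) A' =
          ((Complex.normSq A' : ℝ) : ℂ) * ((G⁻¹ - G) / 2) := by
        rw [← Complex.mul_conj, hA']
        ring
      rw [this, Complex.im_ofReal_mul, Complex.div_ofNat_im, Complex.sub_im, Complex.inv_im]
      have : 0 < G.im / Complex.normSq G := div_pos hG2 hGn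
      rw [neg_div, ← mul_neg]
      refine mul_pos hn ?_
      linarith
    · refine div_neg_of_neg_of_pos ?_ hpos
      have : Complex.I / 2 * (G⁻¹ * dh t z * z + G * dh t z * z) * (starRingEnd ℂ) A' =
          ((Complex.normSq A' : ℝ) : ℂ) * (Complex.I * ((G⁻¹ + G) / 2)) := by
        rw [← Complex.mul_conj, hA']
        ring
      rw [this, Complex.im_ofReal_mul, Complex.I_mul_im, Complex.div_ofNat_re, Complex.add_re,
        Complex.inv_re]
      have : 0 < G.re / Complex.normSq G := div_pos hG1 hGn
      rw [← mul_neg]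
      refine mul_neg_of_pos_of_neg hn ?_
      linarith
  refine ⟨r, hr, huniq, ?_, ?_⟩
  · refine strictMonoOn_of_deriv_pos (convex_Icc _ _) (hcurve (continuousOn_surfX h)) fun θ hθ => ?_
    rw [interior_Icc] at hθ
    obtain ⟨p, q, hp, hq, h1, h2⟩ := hd θ hθ
    rwa [h1.deriv]
  · refine strictAntiOn_of_deriv_neg (convex_Icc _ _) (hcurve (continuousOn_surfY h)) fun θ hθ => ?_
    rw [interior_Icc] at hθ
    obtain ⟨p, q, hp, hq, h1, h2⟩ := hd θ hθ
    rwa [h2.deriv]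

lemma surfZ_polar_mem {θ : ℝ} (hθ : θ ∈ Icc 0 Real.pi) (r : ℝ) :
    -topHeight a b t ≤ surfZ a b t (polar r θ) ∧ surfZ a b t (polar r θ) ≤ topHeight a b t := by
  have hmono : Monotone fun r => surfZ a b t (polar r θ) :=
    monotone_iff_forall_lt.2 fun _ _ hr => (surfZ_polar_mono h hθ hr).1
  exact ⟨hmono.le_of_tendsto (tendsto_surfZ_atBot h hθ) r,
    hmono.ge_of_tendsto (tendsto_surfZ_atTop h hθ) r⟩

/-- Strict monotonicity between -t and -1/t excludes the extreme heights in the interior of this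
interval. -/
lemma surfZ_real_neg {x : ℝ} (hx : x < 0) :
    (surfZ a b t (cayley x) = -topHeight a b t → -1 / t ≤ x) ∧
      (surfZ a b t (cayley x) = topHeight a b t → x ≤ -t) := by
  have o := h.order
  have hT := topHeight_pos h
  have hle : -t < -1 / t := by rw [neg_div]; linarith
  have hhi := surfZ_top h (x := -t) (by rw [abs_neg]; exact le_abs_self t)
  have hlo := surfZ_bottom h (x := -1 / t) ⟨le_rfl, by rw [neg_div]; linarith⟩
  constructor
  · intro e
    by_contra! hcon
    rcases le_total x (-t) with h1 | h1
    · have := surfZ_top h (x := x) (by rw [abs_of_neg hx]; linarith)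
      linarith
    · have := surfZ_strictAntiOn h ⟨h1, hcon.le⟩ ⟨hle.le, le_rfl⟩ hcon
      simp only at this
      linarith
  · intro e
    by_contra! hcon
    rcases le_total x (-1 / t) with h1 | h1
    · have := surfZ_strictAntiOn h ⟨le_rfl, hle.le⟩ ⟨hcon.le, h1⟩ hcon
      simp only at this
      linarith
    · have := surfZ_bottom h (x := x) ⟨h1, by linarith⟩
      linarith

/-- On an interior ray the height is strictly increasing and bounded below by the bottom value, so
it never attains it. The positive ray is transferred to the negative one by z ↦ -1/z. -/
lemma surfZ_eq_bottom {ζ : ℂ} (hζ : ζ ∈ closedBall (0 : ℂ) 1)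
    (hz : surfZ a b t ζ = -topHeight a b t) : ∃ x ∈ Icc (-1 / t) (1 / t), ζ = cayley (x : ℝ) := by
  have ht : 0 < t := by linarith [h.one_lt_t]
  have hT := topHeight_pos h
  have h0 : (0 : ℝ) ∈ Icc (-1 / t) (1 / t) := by
    rw [neg_div]
    have : 0 < 1 / t := by positivity
    constructor <;> linarith
  have hb0 := surfZ_bottom h h0
  rw [Complex.ofReal_zero, cayley_zero] at hb0
  by_cases h1 : ζ = 1
  · subst h1
    rw [surfZ_neg] at hb0
    linarith
  by_cases h2 : ζ = -1
  · subst h2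
    exact ⟨0, h0, by simp [cayley_zero]⟩
  obtain ⟨r, θ, hθ, rfl⟩ := exists_polar hζ h1 h2
  rcases hθ.1.eq_or_lt with rfl | hθ0
  · rw [polar_zero] at hz ⊢
    have hx : 0 < Real.exp r := Real.exp_pos r
    refine ⟨Real.exp r, ⟨by linarith [h0.1], ?_⟩, rfl⟩
    generalize Real.exp r = x at *
    have e := cayley_neg_inv (z := (x : ℂ)) (by simp) (by exact_mod_cast hx.ne')
    have hneg : -1 / x < 0 := div_neg_of_neg_of_pos (by norm_num) hx
    have h3 := (surfZ_real_neg h hneg).2 (by push_cast; rw [e, surfZ_neg, hz, neg_neg])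
    rw [div_le_iff₀ hx] at h3
    rw [le_div_iff₀ ht]
    linarith
  rcases hθ.2.eq_or_lt with rfl | hθ1
  · rw [polar_pi] at hz ⊢
    have hx : -Real.exp r < 0 := neg_lt_zero.2 (Real.exp_pos r)
    exact ⟨-Real.exp r, ⟨(surfZ_real_neg h hx).1 hz, by linarith [h0.2]⟩, rfl⟩
  · have h3 := surfZ_polar_strictMono h ⟨hθ0, hθ1⟩ (sub_one_lt r)
    have h4 := (surfZ_polar_mem h hθ (r - 1)).1
    simp only at h3
    linarith

/-- Every point of the closed disk lies on a level curve or on one of the horizontal edges. -/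
lemma level_cases {ζ : ℂ} (hζ : ζ ∈ closedBall (0 : ℂ) 1) :
    (|surfZ a b t ζ| < topHeight a b t ∧ ∃ r, ∃ θ ∈ Icc 0 Real.pi, polar r θ = ζ) ∨
      (surfZ a b t ζ = -topHeight a b t ∧ ∃ x ∈ Icc (-1 / t) (1 / t), ζ = cayley (x : ℝ)) ∨
      (surfZ a b t ζ = topHeight a b t ∧ ∃ x ∈ Icc (-1 / t) (1 / t), ζ = -cayley (x : ℝ)) := by
  by_cases hlo : surfZ a b t ζ = -topHeight a b t
  · exact Or.inr (Or.inl ⟨hlo, surfZ_eq_bottom h hζ hlo⟩)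
  by_cases hhi : surfZ a b t ζ = topHeight a b t
  · refine Or.inr (Or.inr ⟨hhi, ?_⟩)
    obtain ⟨x, hx, e⟩ := surfZ_eq_bottom h (ζ := -ζ) (by simpa using hζ) (by rw [surfZ_neg, hhi])
    exact ⟨x, hx, by rw [← e, neg_neg]⟩
  left
  have ht : 0 < 1 / t := by have := h.one_lt_t; positivity
  have hb0 := surfZ_bottom h (x := 0) ⟨by rw [neg_div]; linarith, ht.le⟩
  rw [Complex.ofReal_zero, cayley_zero] at hb0
  have h1 : ζ ≠ 1 := by
    rintro rfl
    rw [surfZ_neg] at hb0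
    exact hhi (by linarith)
  have h2 : ζ ≠ -1 := by
    rintro rfl
    exact hlo hb0
  obtain ⟨r, θ, hθ, rfl⟩ := exists_polar hζ h1 h2
  have h3 := surfZ_polar_mem h hθ r
  exact ⟨abs_lt.2 ⟨lt_of_le_of_ne h3.1 (Ne.symm hlo), lt_of_le_of_ne h3.2 hhi⟩, r, θ, hθ, rfl⟩

end

noncomputable section

open Filter Topology

/-! ### The boundary of the surface -/

/-- A function whose derivative changes its sign at most once, from plus to minus, exceeds the
minimum of its boundary values. -/
lemma min_lt_of_hasDerivAt {f f' : ℝ → ℝ} {p q : ℝ} (hc : ContinuousOn f (Icc p q))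
    (hd : ∀ x ∈ Ioo p q, HasDerivAt f (f' x) x)
    (hs : ∀ x ∈ Ioo p q, ∀ y ∈ Ioo p q, x < y → f' x ≤ 0 → f' y < 0) {x : ℝ} (hx : x ∈ Ioo p q) :
    min (f p) (f q) < f x := by
  by_contra! hcon
  obtain ⟨h1, h2⟩ := le_min_iff.1 hcon
  -- If f x were at most both boundary values, the mean value theorem would give a nonpositive slope
  -- before x and a nonnegative one after it, against the sign pattern.
  obtain ⟨u, hu, eu⟩ := exists_hasDerivAt_eq_slope f f' hx.1 (hc.mono (Icc_subset_Icc_right hx.2.le))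
    fun y hy => hd y ⟨hy.1, hy.2.trans hx.2⟩
  obtain ⟨v, hv, ev⟩ := exists_hasDerivAt_eq_slope f f' hx.2 (hc.mono (Icc_subset_Icc_left hx.1.le))
    fun y hy => hd y ⟨hx.1.trans hy.1, hy.2⟩
  have h3 : f' u ≤ 0 := by
    rw [eu]
    exact div_nonpos_of_nonpos_of_nonneg (by linarith) (by linarith [hx.1])
  have h4 : 0 ≤ f' v := by
    rw [ev]
    exact div_nonneg (by linarith) (by linarith [hx.2])
  have := hs u ⟨hu.1, hu.2.trans hx.2⟩ v ⟨hx.1.trans hv.1, hv.2⟩ (hu.2.trans hv.1) h3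
  linarith

/-- The quotient `gaussSq` on the real axis. -/
def gaussRatio (a b x : ℝ) : ℝ := 1 + ((b - 1 / b) - (1 / a - a)) / (x - 1 / x - (b - 1 / b))

variable {a b t ρ : ℝ}

/-- Half the width of the box of the surface. -/
def boxX (a b t ρ : ℝ) : ℝ := surfX a b t ρ (cayley (vtx a b t 0))

/-- Half the depth of the box of the surface. -/
def boxY (a b t ρ : ℝ) : ℝ := -surfY a b t ρ (cayley (vtx a b t 1))

lemma sub_one_div_strictMono {x y : ℝ} (hxy : x < y) (hy : y < 0) : x - 1 / x < y - 1 / y := by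
  have := one_div_lt_one_div_of_neg_of_lt hy hxy
  linarith

variable (h : Admissible a b t)
include h

lemma gaussSq_ofReal {x : ℝ} (hx : x < 0) (hxb : x ≠ -1 / b) :
    gaussSq a b x = gaussRatio a b x := by
  have hb := h.b_pos
  rw [h.gaussSq_eq (by exact_mod_cast hx.ne), gaussRatio]
  have : x - 1 / x - (b - 1 / b) ≠ 0 := by
    intro h0
    have hx0 := hx.ne
    field_simp at h0
    have : (b * x + 1) * (x - b) = 0 := by linear_combination h0
    rcases mul_eq_zero.1 this with h1 | h1
    · apply hxb
      field_simp
      linarith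
    · linarith
  rw [one_add_div this]
  push_cast
  congr 1
  ring

lemma gaussRatio_lt_one {x : ℝ} (hx : x < -1 / b) : gaussRatio a b x < 1 := by
  have hb := h.b_pos
  have h1 := sub_one_div_strictMono hx (div_neg_of_neg_of_pos (by norm_num) hb)
  have e : 1 / (-1 / b) = -b := by field_simp
  rw [e] at h1
  have h2 : x - 1 / x - (b - 1 / b) < 0 := by
    rw [neg_div] at h1
    linarith
  rw [gaussRatio]
  have := div_neg_of_pos_of_neg (sub_pos.2 h.nodes_lt) h2
  linarith

lemma one_lt_gaussRatio {x : ℝ} (hx : -1 / b < x) (hx0 : x < 0) : 1 < gaussRatio a b x := by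
  have hb := h.b_pos
  have h1 := sub_one_div_strictMono hx hx0
  have e : 1 / (-1 / b) = -b := by field_simp
  rw [e] at h1
  have h2 : 0 < x - 1 / x - (b - 1 / b) := by
    rw [neg_div] at h1
    linarith
  rw [gaussRatio]
  have := div_pos (sub_pos.2 h.nodes_lt) h2
  linarith

/-- The ratio is 1 + (m - n)/(ξ - m) with ξ = x - 1/x increasing and m > n. It decreases on either
side of its only pole on the negative axis, -1/b. -/
lemma gaussRatio_anti {x y : ℝ} (hxy : x < y) (hy : y < 0) (hb : y < -1 / b ∨ -1 / b < x) :
    gaussRatio a b y < gaussRatio a b x := by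
  have hbp := h.b_pos
  have h1 := sub_one_div_strictMono hxy hy
  have e : 1 / (-1 / b) = -b := by field_simp
  have hn := sub_pos.2 h.nodes_lt
  rw [gaussRatio, gaussRatio]
  rcases hb with h2 | h2
  · have h3 := sub_one_div_strictMono h2 (div_neg_of_neg_of_pos (by norm_num) hbp)
    rw [e, neg_div] at h3
    have := one_div_lt_one_div_of_neg_of_lt (a := x - 1 / x - (b - 1 / b))
      (b := y - 1 / y - (b - 1 / b)) (by linarith) (by linarith)
    have := mul_lt_mul_of_pos_left this hn
    rw [mul_one_div, mul_one_div] at this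
    linarith
  · have h3 := sub_one_div_strictMono h2 (hxy.trans hy)
    rw [e, neg_div] at h3
    have := one_div_lt_one_div_of_lt (a := x - 1 / x - (b - 1 / b))
      (b := y - 1 / y - (b - 1 / b)) (by linarith) (by linarith)
    have := mul_lt_mul_of_pos_left this hn
    rw [mul_one_div, mul_one_div] at this
    linarith

lemma hasDerivAt_surfX_real (hρ : 0 < ρ) {x : ℝ} (hx : (x : ℂ) ∈ puncturedHalfPlane a b t) :
    HasDerivAt (fun x : ℝ => surfX a b t ρ (cayley x))
      ((phi2 a b t ρ x - phi1 a b t ρ x) / 2).re x :=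
  Complex.reCLM.hasFDerivAt.comp_hasDerivAt x
    (((h.hasDerivAt_real (halfSingular_disk2 h ρ) (fun _ hz => phi2_eq_disk2 h hρ hz) hx).sub
      (h.hasDerivAt_real (halfSingular_disk1 h ρ) (fun _ hz => phi1_eq_disk1 h hρ hz) hx)).div_const 2)

lemma hasDerivAt_surfY_real (hρ : 0 < ρ) {x : ℝ} (hx : (x : ℂ) ∈ puncturedHalfPlane a b t) :
    HasDerivAt (fun x : ℝ => surfY a b t ρ (cayley x))
      (Complex.I / 2 * (phi2 a b t ρ x + phi1 a b t ρ x)).re x :=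
  Complex.reCLM.hasFDerivAt.comp_hasDerivAt x
    (((h.hasDerivAt_real (halfSingular_disk2 h ρ) (fun _ hz => phi2_eq_disk2 h hρ hz) hx).add
      (h.hasDerivAt_real (halfSingular_disk1 h ρ) (fun _ hz => phi1_eq_disk1 h hρ hz) hx)).const_mul
        (Complex.I / 2))

lemma continuous_surfX_real : Continuous fun x : ℝ => surfX a b t ρ (cayley x) :=
  (continuousOn_surfX h).comp_continuous continuous_cayley_ofReal fun x =>
    cayley_mem_closedBall (z := (x : ℂ)) (by simp)

lemma continuous_surfY_real : Continuous fun x : ℝ => surfY a b t ρ (cayley x) :=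
  (continuousOn_surfY h).comp_continuous continuous_cayley_ofReal fun x =>
    cayley_mem_closedBall (z := (x : ℂ)) (by simp)

/-- The derivatives of the coordinates along the edges in the faces `x = const`. -/
lemma slope_of_face_x (hρ : 0 < ρ) {k : Fin 7} (hk : k = 0 ∨ k = 2) {x : ℝ}
    (hx : x ∈ Ioo (vtx a b t k.castSucc) (vtx a b t k.succ)) :
    HasDerivAt (fun x : ℝ => surfX a b t ρ (cayley x)) 0 x ∧
      ∃ q, 0 < q ∧ HasDerivAt (fun x : ℝ => surfY a b t ρ (cayley x))
        (q * (ρ ^ 2 * gaussRatio a b x - 1)) x := by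
  have hP := h.mem_punctured hx
  obtain ⟨p, q, r, hp, hq, hr, e1, e2, e3⟩ := h.edge_forms hρ hx
  have o := h.order
  have hx0 : x < 0 ∧ x ≠ -1 / b := by
    rcases hk with rfl | rfl
    · have hx2 : x < -a := hx.2
      rw [neg_div]
      exact ⟨by linarith, by linarith⟩
    · have hx1 : -1 / b < x := hx.1
      have hx2 : x < -1 / t := hx.2
      rw [neg_div] at hx2
      exact ⟨by linarith, hx1.ne'⟩
  have e := phi1_eq_mul_phi2 hρ hP
  rw [gaussSq_ofReal h hx0.1 hx0.2] at e
  have d : edgeDir1 k = -Complex.I ∧ edgeDir2 k = Complex.I := by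
    rcases hk with rfl | rfl <;> simp [edgeDir1, edgeDir2]
  rw [d.1] at e1
  rw [d.2] at e2
  have dX := hasDerivAt_surfX_real h hρ hP
  have dY := hasDerivAt_surfY_real h hρ hP
  -- The relation between the two forms becomes a relation between their moduli, so the sign of the
  -- slope depends on the ratio alone.
  have hpq : p = ρ ^ 2 * gaussRatio a b x * q := by
    rw [e1, e2] at e
    have := congrArg Complex.im e
    have h1 : (-(ρ : ℂ) ^ 2 * (gaussRatio a b x : ℂ) * (Complex.I * q)) =
        Complex.I * ((-(ρ ^ 2 * gaussRatio a b x * q) : ℝ) : ℂ) := by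
      push_cast
      ring
    rw [h1] at this
    simp only [neg_mul, Complex.neg_im, Complex.I_mul_im, Complex.ofReal_re] at this
    linarith
  rw [e1, e2] at dX dY
  refine ⟨dX.congr_deriv ?_, q / 2, by positivity, dY.congr_deriv ?_⟩
  · simp
  · have : Complex.I / 2 * (Complex.I * q + -Complex.I * p) = ((p - q) / 2 : ℝ) := by
      push_cast
      linear_combination ((q - p) / 2 : ℂ) * Complex.I_sq
    rw [this, Complex.ofReal_re, hpq]
    ring

/-- The derivatives of the coordinates along the edge in the face `y = const`. -/
lemma slope_of_face_y (hρ : 0 < ρ) {x : ℝ} (hx : x ∈ Ioo (-a) (-1 / b)) :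
    HasDerivAt (fun x : ℝ => surfY a b t ρ (cayley x)) 0 x ∧
      ∃ q, 0 < q ∧ HasDerivAt (fun x : ℝ => surfX a b t ρ (cayley x))
        (q * (-(ρ ^ 2 * gaussRatio a b x) - 1)) x := by
  have hx' : x ∈ Ioo (vtx a b t (1 : Fin 7).castSucc) (vtx a b t (1 : Fin 7).succ) := hx
  have hP := h.mem_punctured hx'
  obtain ⟨p, q, r, hp, hq, hr, e1, e2, e3⟩ := h.edge_forms hρ hx'
  have o := h.order
  have hx0 : x < 0 := by
    have hx2 := hx.2
    rw [neg_div] at hx2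
    linarith
  have e := phi1_eq_mul_phi2 hρ hP
  rw [gaussSq_ofReal h hx0 hx.2.ne] at e
  have d : edgeDir1 1 = -1 ∧ edgeDir2 1 = -1 := by simp [edgeDir1, edgeDir2]
  rw [d.1] at e1
  rw [d.2] at e2
  have dX := hasDerivAt_surfX_real h hρ hP
  have dY := hasDerivAt_surfY_real h hρ hP
  have hpq : p = -(ρ ^ 2 * gaussRatio a b x) * q := by
    rw [e1, e2] at e
    have h1 : ((p : ℝ) : ℂ) = ((-(ρ ^ 2 * gaussRatio a b x) * q : ℝ) : ℂ) := by
      push_cast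
      linear_combination -e
    exact_mod_cast h1
  rw [e1, e2] at dX dY
  refine ⟨dY.congr_deriv ?_, q / 2, by positivity, dX.congr_deriv ?_⟩
  · simp
  · have : ((-1 * (q : ℂ) - -1 * p) / 2 : ℂ) = ((p - q) / 2 : ℝ) := by
      push_cast
      ring
    rw [this, Complex.ofReal_re, hpq]
    ring

/-- The `x`-coordinate decreases along the lower horizontal edge. -/
lemma surfX_strictAntiOn (hρ : 0 < ρ) :
    StrictAntiOn (fun x : ℝ => surfX a b t ρ (cayley x)) (Icc (-1 / t) (1 / t)) := by
  refine strictAntiOn_of_deriv_neg (convex_Icc _ _) (continuous_surfX_real h).continuousOn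
    fun x hx => ?_
  rw [interior_Icc] at hx
  have hx' : x ∈ Ioo (vtx a b t (3 : Fin 7).castSucc) (vtx a b t (3 : Fin 7).succ) := hx
  obtain ⟨p, q, r, hp, hq, hr, e1, e2, e3⟩ := h.edge_forms hρ hx'
  rw [(hasDerivAt_surfX_real h hρ (h.mem_punctured hx')).deriv, e1, e2]
  simp [edgeDir1, edgeDir2]
  linarith

lemma surfY_bottom_eq (hρ : 0 < ρ) {x : ℝ} (hx : x ∈ Icc (-1 / t) (1 / t)) :
    surfY a b t ρ (cayley x) = surfY a b t ρ (cayley (vtx a b t 3)) := by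
  refine eq_left_of_hasDerivAt_zero (f := fun x : ℝ => surfY a b t ρ (cayley x))
    (continuous_surfY_real h).continuousOn (fun x hx => ?_) x hx
  have hx' : x ∈ Ioo (vtx a b t (3 : Fin 7).castSucc) (vtx a b t (3 : Fin 7).succ) := hx
  obtain ⟨p, q, r, hp, hq, hr, e1, e2, e3⟩ := h.edge_forms hρ hx'
  refine (hasDerivAt_surfY_real h hρ (h.mem_punctured hx')).congr_deriv ?_
  rw [e1, e2]
  simp [edgeDir1, edgeDir2]

/-- The positions of the vertices when the periods close. -/
lemma vertex_positions (hρ : 0 < ρ) (hP : PeriodConditions a b t ρ) :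
    (∀ k : Fin 8, k = 1 ∨ k = 2 ∨ k = 3 → surfX a b t ρ (cayley (vtx a b t k)) = boxX a b t ρ) ∧
      surfY a b t ρ (cayley (vtx a b t 0)) = 0 ∧ surfY a b t ρ (cayley (vtx a b t 3)) = 0 ∧
      surfY a b t ρ (cayley (vtx a b t 1)) = -boxY a b t ρ ∧
      surfY a b t ρ (cayley (vtx a b t 2)) = -boxY a b t ρ ∧ 0 < boxX a b t ρ := by
  obtain ⟨p1, p2⟩ := hP
  have x0 := surf_edge h hρ 0
  have x1 := surf_edge h hρ 1
  have x2 := surf_edge h hρ 2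
  have x3 := surf_edge h hρ 3
  have i3 := (edge1 h hρ 3).2.2
  have j3 := (edge2 h hρ 3).2.2
  have n4X := surfX_neg (a := a) (b := b) (t := t) (ρ := ρ) (cayley (vtx a b t 0))
  have n4Y := surfY_neg (a := a) (b := b) (t := t) (ρ := ρ) (cayley (vtx a b t 0))
  rw [← (cayley_vtx_opposite h).1] at n4X n4Y
  simp [edgeDir1, edgeDir2, edgeDir3] at x0 x1 x2 x3
  have hX1 : surfX a b t ρ (cayley (vtx a b t 1)) = boxX a b t ρ := by rw [boxX]; linarith [x0.1]
  have hX2 : surfX a b t ρ (cayley (vtx a b t 2)) = boxX a b t ρ := by linarith [x1.1]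
  have hX3 : surfX a b t ρ (cayley (vtx a b t 3)) = boxX a b t ρ := by linarith [x2.1]
  refine ⟨?_, ?_, ?_, ?_, ?_, ?_⟩
  · rintro k (rfl | rfl | rfl)
    exacts [hX1, hX2, hX3]
  · linarith [x0.2.1, x1.2.1, x2.2.1, x3.2.1]
  · linarith [x0.2.1, x1.2.1, x2.2.1, x3.2.1]
  · rw [boxY]; ring
  · rw [boxY]; linarith [x1.2.1]
  · rw [boxX] at *
    linarith [x3.1]

/-- Otherwise mean slopes on the first and third edges would give points u < -a and v > -1/b with ρ²
times the ratio at least 1 at u and at most 1 at v. But the ratio is below 1 at u and above 1 at v.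
-/
lemma boxY_pos (hρ : 0 < ρ) (hP : PeriodConditions a b t ρ) : 0 < boxY a b t ρ := by
  obtain ⟨-, y0, y3, y1, y2, -⟩ := vertex_positions h hρ hP
  have o := h.order
  have hc : ∀ s : Set ℝ, ContinuousOn (fun x : ℝ => surfY a b t ρ (cayley x)) s := fun s =>
    (continuous_surfY_real h).continuousOn
  by_contra! hcon
  have l0 : vtx a b t 0 < vtx a b t 1 := h.vtx_strictMono (by decide)
  have l2 : vtx a b t 2 < vtx a b t 3 := h.vtx_strictMono (by decide)
  obtain ⟨u, hu, eu⟩ := exists_deriv_eq_slope _ l0 (hc _) fun x hx =>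
    ((slope_of_face_x h hρ (k := 0) (Or.inl rfl) hx).2.choose_spec.2).differentiableAt.differentiableWithinAt
  obtain ⟨v, hv, ev⟩ := exists_deriv_eq_slope _ l2 (hc _) fun x hx =>
    ((slope_of_face_x h hρ (k := 2) (Or.inr rfl) hx).2.choose_spec.2).differentiableAt.differentiableWithinAt
  obtain ⟨-, p, hp, du⟩ := slope_of_face_x h hρ (k := 0) (Or.inl rfl) hu
  obtain ⟨-, q, hq, dv⟩ := slope_of_face_x h hρ (k := 2) (Or.inr rfl) hv
  rw [du.deriv, y0, y1] at eu
  rw [dv.deriv, y2, y3] at ev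
  have h1 : 0 ≤ p * (ρ ^ 2 * gaussRatio a b u - 1) := by
    rw [eu]
    exact div_nonneg (by linarith) (by linarith)
  have h2 : q * (ρ ^ 2 * gaussRatio a b v - 1) ≤ 0 := by
    rw [ev]
    exact div_nonpos_of_nonpos_of_nonneg (by linarith) (by linarith)
  have h3 := nonneg_of_mul_nonneg_right h1 hp
  have h4 := nonpos_of_mul_nonpos_right h2 hq
  have hu2 : u < -a := hu.2
  have hv1 : -1 / b < v := hv.1
  have hv2 : v < -1 / t := hv.2
  have r1 := gaussRatio_lt_one h (x := u) (by rw [neg_div]; linarith)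
  have r2 := one_lt_gaussRatio h hv1 (by rw [neg_div] at hv2; linarith)
  have hρ2 : 0 < ρ ^ 2 := by positivity
  have := mul_lt_mul_of_pos_left (r1.trans r2) hρ2
  linarith

/-- The coordinates along the part of the boundary over the negative real axis. -/
lemma left_boundary (hρ : 0 < ρ) (hP : PeriodConditions a b t ρ) {x : ℝ}
    (hx : x ∈ Icc (-t) (-1 / t)) :
    (x ∈ Icc (-t) (-a) ∪ Icc (-1 / b) (-1 / t) → surfX a b t ρ (cayley x) = boxX a b t ρ) ∧
    (x ∈ Icc (-a) (-1 / b) → surfY a b t ρ (cayley x) = -boxY a b t ρ) ∧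
    (x ∈ Ico (-t) (-a) ∪ Ioc (-1 / b) (-1 / t) → -boxY a b t ρ < surfY a b t ρ (cayley x)) ∧
    (x ∈ Ioo (-a) (-1 / b) → surfX a b t ρ (cayley x) < boxX a b t ρ) := by
  obtain ⟨xk, y0, y3, y1, y2, -⟩ := vertex_positions h hρ hP
  have hB := boxY_pos h hρ hP
  have o := h.order
  have hcX : ∀ s : Set ℝ, ContinuousOn (fun x : ℝ => surfX a b t ρ (cayley x)) s := fun s =>
    (continuous_surfX_real h).continuousOn
  have hcY : ∀ s : Set ℝ, ContinuousOn (fun x : ℝ => surfY a b t ρ (cayley x)) s := fun s =>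
    (continuous_surfY_real h).continuousOn
  have hρ2 : 0 < ρ ^ 2 := by positivity
  have hY : ∀ (k : Fin 7) (hk : k = 0 ∨ k = 2), ∀ x ∈ Ioo (vtx a b t k.castSucc) (vtx a b t k.succ),
      min (surfY a b t ρ (cayley (vtx a b t k.castSucc)))
        (surfY a b t ρ (cayley (vtx a b t k.succ))) < surfY a b t ρ (cayley x) := by
    intro k hk x hx
    have hd : ∀ x : ℝ, ∃ q, x ∈ Ioo (vtx a b t k.castSucc) (vtx a b t k.succ) → 0 < q ∧
        HasDerivAt (fun x : ℝ => surfY a b t ρ (cayley x)) (q * (ρ ^ 2 * gaussRatio a b x - 1)) x := by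
      intro x
      by_cases hx : x ∈ Ioo (vtx a b t k.castSucc) (vtx a b t k.succ)
      · obtain ⟨q, hq⟩ := (slope_of_face_x h hρ hk hx).2
        exact ⟨q, fun _ => hq⟩
      · exact ⟨0, fun hx' => absurd hx' hx⟩
    choose q hq using hd
    refine min_lt_of_hasDerivAt (f := fun x : ℝ => surfY a b t ρ (cayley x)) (hcY _)
      (fun x hx => (hq x hx).2) (fun x hx y hy hxy hle => ?_) hx
    have h1 := nonpos_of_mul_nonpos_right hle (hq x hx).1
    refine mul_neg_of_pos_of_neg (hq y hy).1 ?_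
    -- The ratio decreases along each of the two edges, so the slope turns from plus to minus at
    -- most once, and y stays above the smaller of its end values.
    have h2 : gaussRatio a b y < gaussRatio a b x := by
      rcases hk with rfl | rfl
      · have hy2 : y < -a := hy.2
        exact gaussRatio_anti h hxy (by linarith) (Or.inl (by rw [neg_div]; linarith))
      · have hy2 : y < -1 / t := hy.2
        rw [neg_div] at hy2
        exact gaussRatio_anti h hxy (by linarith) (Or.inr hx.1)
    have := mul_lt_mul_of_pos_left h2 hρ2
    linarith
  refine ⟨?_, ?_, ?_, ?_⟩
  · rintro (hx | hx)
    · exact eq_left_of_hasDerivAt_zero (hcX _)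
        (fun x hx => (slope_of_face_x h hρ (k := 0) (Or.inl rfl) hx).1) x hx
    · rw [← xk 2 (by simp)]
      exact eq_left_of_hasDerivAt_zero (hcX _)
        (fun x hx => (slope_of_face_x h hρ (k := 2) (Or.inr rfl) hx).1) x hx
  · intro hx
    rw [← y1]
    exact eq_left_of_hasDerivAt_zero (hcY _) (fun x hx => (slope_of_face_y h hρ hx).1) x hx
  · rintro (hx | hx)
    · rcases hx.1.eq_or_lt with rfl | h1
      · have : surfY a b t ρ (cayley ((-t : ℝ) : ℂ)) = 0 := y0
        linarith
      · have := hY 0 (Or.inl rfl) x ⟨h1, hx.2⟩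
        simp only [Fin.isValue, Fin.castSucc_zero, Fin.succ_zero_eq_one, y0, y1] at this
        rwa [min_eq_right (by linarith)] at this
    · rcases hx.2.eq_or_lt with rfl | h1
      · have : surfY a b t ρ (cayley ((-1 / t : ℝ) : ℂ)) = 0 := y3
        linarith
      · have := hY 2 (Or.inr rfl) x ⟨hx.1, h1⟩
        simp only [Fin.isValue, Fin.reduceCastSucc, Fin.reduceSucc, y2, y3] at this
        rwa [min_eq_left (by linarith)] at this
  · intro hx
    have hd : ∀ x : ℝ, ∃ q, x ∈ Ioo (-a) (-1 / b) → 0 < q ∧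
        HasDerivAt (fun x : ℝ => surfX a b t ρ (cayley x))
          (q * (-(ρ ^ 2 * gaussRatio a b x) - 1)) x := by
      intro x
      by_cases hx : x ∈ Ioo (-a) (-1 / b)
      · obtain ⟨q, hq⟩ := (slope_of_face_y h hρ hx).2
        exact ⟨q, fun _ => hq⟩
      · exact ⟨0, fun hx' => absurd hx' hx⟩
    choose q hq using hd
    have e1 : surfX a b t ρ (cayley ((-a : ℝ) : ℂ)) = boxX a b t ρ := xk 1 (by simp)
    have e2 : surfX a b t ρ (cayley ((-1 / b : ℝ) : ℂ)) = boxX a b t ρ := xk 2 (by simp)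
    -- Along this edge the slope of x turns from minus to plus, so the argument applies to -x, whose
    -- end values coincide.
    have := min_lt_of_hasDerivAt (f := fun x : ℝ => -surfX a b t ρ (cayley x)) (hcX _).neg
      (fun x hx => (hq x hx).2.neg) (fun x hx y hy hxy hle => ?_) hx
    · rw [e1, e2, min_self] at this
      linarith
    · rw [neg_nonpos] at hle
      rw [neg_lt_zero]
      have h1 := nonneg_of_mul_nonneg_right hle (hq x hx).1
      refine mul_pos (hq y hy).1 ?_
      have hy2 := hy.2
      have h2 := gaussRatio_anti h hxy (by rw [neg_div] at hy2; linarith) (Or.inl hy2)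
      have := mul_lt_mul_of_pos_left h2 hρ2
      linarith

end

noncomputable section

open Filter Topology

/-! ### The surface in its box -/

variable {a b t ρ : ℝ} (h : Admissible a b t)
include h

lemma left_boundary_le (hρ : 0 < ρ) (hP : PeriodConditions a b t ρ) {x : ℝ}
    (hx : x ∈ Icc (-t) (-1 / t)) :
    surfX a b t ρ (cayley x) ≤ boxX a b t ρ ∧ -boxY a b t ρ ≤ surfY a b t ρ (cayley x) ∧
      (surfX a b t ρ (cayley x) = boxX a b t ρ → surfY a b t ρ (cayley x) = -boxY a b t ρ →
        x = -a ∨ x = -1 / b) := by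
  obtain ⟨h1, h2, h3, h4⟩ := left_boundary h hρ hP hx
  have o := h.order
  rcases lt_trichotomy x (-a) with ha | ha | ha
  · exact ⟨(h1 (Or.inl ⟨hx.1, ha.le⟩)).le, (h3 (Or.inl ⟨hx.1, ha⟩)).le,
      fun _ e => absurd e (h3 (Or.inl ⟨hx.1, ha⟩)).ne'⟩
  · refine ⟨(h1 (Or.inl ⟨hx.1, ha.le⟩)).le, (h2 ⟨ha.ge, ?_⟩).ge, fun _ _ => Or.inl ha⟩
    rw [neg_div]
    linarith
  rcases lt_trichotomy x (-1 / b) with hb | hb | hb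
  · exact ⟨(h4 ⟨ha, hb⟩).le, (h2 ⟨ha.le, hb.le⟩).ge, fun e _ => absurd e (h4 ⟨ha, hb⟩).ne⟩
  · exact ⟨(h1 (Or.inr ⟨hb.ge, hx.2⟩)).le, (h2 ⟨ha.le, hb.le⟩).ge, fun _ _ => Or.inr hb⟩
  · exact ⟨(h1 (Or.inr ⟨hb.le, hx.2⟩)).le, (h3 (Or.inr ⟨hb, hx.2⟩)).le,
      fun _ e => absurd e (h3 (Or.inr ⟨hb, hx.2⟩)).ne'⟩

/-- The level curve through the point ends at θ = π, on the negative axis. Along it x increases and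
y decreases, so the boundary values there bound x from above and y from below, with equality only at
that end. -/
lemma level_bounds_left (hρ : 0 < ρ) (hP : PeriodConditions a b t ρ) {ζ : ℂ}
    (hζ : ζ ∈ closedBall (0 : ℂ) 1) (hZ : |surfZ a b t ζ| < topHeight a b t) :
    surfX a b t ρ ζ ≤ boxX a b t ρ ∧ -boxY a b t ρ ≤ surfY a b t ρ ζ ∧
      (surfX a b t ρ ζ = boxX a b t ρ ∨ surfY a b t ρ ζ = -boxY a b t ρ →
        ∃ x ∈ Ioo (-t) (-1 / t), ζ = cayley (x : ℝ)) := by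
  have ht : 0 < 1 / t := by have := h.one_lt_t; positivity
  have hpi : Real.pi ∈ Icc 0 Real.pi := ⟨Real.pi_pos.le, le_rfl⟩
  rcases level_cases h hζ with ⟨-, s, θ, hθ, rfl⟩ | ⟨h1, -⟩ | ⟨h1, -⟩
  · obtain ⟨r, hr, huniq, hX, hY⟩ := exists_level_curve h hρ hZ
    obtain rfl := huniq θ hθ s rfl
    have hx0 : -Real.exp (r Real.pi) < 0 := neg_lt_zero.2 (Real.exp_pos _)
    have e := hr _ hpi
    have eπ := polar_pi (r Real.pi)
    generalize -Real.exp (r Real.pi) = x at hx0 eπ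
    rw [← e, eπ] at hZ
    have hT := topHeight_pos h
    have hx1 : -t < x := by
      by_contra! hcon
      rw [surfZ_top h (by rw [abs_of_neg hx0]; linarith), abs_of_pos hT] at hZ
      exact lt_irrefl _ hZ
    have hx2 : x < -1 / t := by
      by_contra! hcon
      rw [surfZ_bottom h ⟨hcon, by linarith⟩, abs_neg, abs_of_pos hT] at hZ
      exact lt_irrefl _ hZ
    obtain ⟨l1, l2, -⟩ := left_boundary_le h hρ hP (x := x) ⟨hx1.le, hx2.le⟩
    rcases hθ.2.eq_or_lt with rfl | hlt
    · rw [eπ]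
      exact ⟨l1, l2, fun _ => ⟨x, ⟨hx1, hx2⟩, rfl⟩⟩
    · have k1 := hX hθ hpi hlt
      have k2 := hY hθ hpi hlt
      simp only [eπ] at k1 k2
      refine ⟨by linarith, by linarith, ?_⟩
      rintro (e | e) <;> linarith
  · rw [h1, abs_neg] at hZ
    exact absurd (le_abs_self _) (not_le.2 hZ)
  · rw [h1] at hZ
    exact absurd (le_abs_self _) (not_le.2 hZ)

/-- The points of the surface strictly between the two horizontal edges. -/
lemma level_bounds (hρ : 0 < ρ) (hP : PeriodConditions a b t ρ) {ζ : ℂ}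
    (hζ : ζ ∈ closedBall (0 : ℂ) 1) (hZ : |surfZ a b t ζ| < topHeight a b t) :
    |surfX a b t ρ ζ| ≤ boxX a b t ρ ∧ |surfY a b t ρ ζ| ≤ boxY a b t ρ ∧
      ¬ (surfX a b t ρ ζ = boxX a b t ρ ∧ surfY a b t ρ ζ = boxY a b t ρ) ∧
      ¬ (surfX a b t ρ ζ = -boxX a b t ρ ∧ surfY a b t ρ ζ = -boxY a b t ρ) ∧
      (|surfX a b t ρ ζ| = boxX a b t ρ → |surfY a b t ρ ζ| = boxY a b t ρ →
        ∃ k, ζ = cayley (vtx a b t k)) := by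
  have hζ' : -ζ ∈ closedBall (0 : ℂ) 1 := by simpa using hζ
  have l := level_bounds_left h hρ hP hζ hZ
  have r := level_bounds_left h hρ hP hζ' (by rwa [surfZ_neg, abs_neg])
  rw [surfX_neg, surfY_neg] at r
  -- A point and its antipode cannot both lie over the negative axis, since z ↦ -1/z changes the
  -- sign of a real number. This excludes the two vertical lines.
  have hno : ∀ {η : ℂ}, (∃ x ∈ Ioo (-t) (-1 / t), η = cayley (x : ℝ)) →
      (∃ x ∈ Ioo (-t) (-1 / t), -η = cayley (x : ℝ)) → False := by
    rintro η ⟨x, hx, rfl⟩ ⟨y, hy, e⟩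
    have o := h.order
    have hx0 : x < 0 := by
      have := hx.2
      rw [neg_div] at this
      linarith
    have hy0 : y < 0 := by
      have := hy.2
      rw [neg_div] at this
      linarith
    rw [← cayley_neg_inv (by simp) (by exact_mod_cast hx0.ne)] at e
    have e' : cayley ((-1 / x : ℝ) : ℂ) = cayley (y : ℂ) := by
      push_cast
      exact e
    have := cayley_injOn (by simp) (by simp) e'
    have h2 : -1 / x = y := by exact_mod_cast this
    have : 0 < -1 / x := div_pos_of_neg_of_neg (by norm_num) hx0
    linarith
  have hcorner : ∀ {η : ℂ}, (∃ x ∈ Ioo (-t) (-1 / t), η = cayley (x : ℝ)) →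
      surfX a b t ρ η = boxX a b t ρ → surfY a b t ρ η = -boxY a b t ρ →
      η = cayley (vtx a b t 1) ∨ η = cayley (vtx a b t 2) := by
    rintro η ⟨x, hx, rfl⟩ e1 e2
    rcases (left_boundary_le h hρ hP ⟨hx.1.le, hx.2.le⟩).2.2 e1 e2 with rfl | rfl
    exacts [Or.inl rfl, Or.inr rfl]
  have c1 : ¬ (surfX a b t ρ ζ = boxX a b t ρ ∧ surfY a b t ρ ζ = boxY a b t ρ) := fun e =>
    hno (l.2.2 (Or.inl e.1)) (r.2.2 (Or.inr (by rw [e.2])))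
  have c2 : ¬ (surfX a b t ρ ζ = -boxX a b t ρ ∧ surfY a b t ρ ζ = -boxY a b t ρ) := fun e =>
    hno (l.2.2 (Or.inr e.2)) (r.2.2 (Or.inl (by rw [e.1, neg_neg])))
  have hX : |surfX a b t ρ ζ| ≤ boxX a b t ρ := abs_le.2 ⟨by linarith [r.1], l.1⟩
  have hY : |surfY a b t ρ ζ| ≤ boxY a b t ρ := abs_le.2 ⟨l.2.1, by linarith [r.2.1]⟩
  refine ⟨hX, hY, c1, c2, fun e1 e2 => ?_⟩
  obtain ⟨-, o5, o6, -⟩ := cayley_vtx_opposite h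
  rcases eq_or_eq_neg_of_abs_eq e1 with e1 | e1 <;> rcases eq_or_eq_neg_of_abs_eq e2 with e2 | e2
  · exact absurd ⟨e1, e2⟩ c1
  · rcases hcorner (l.2.2 (Or.inl e1)) e1 e2 with e | e
    exacts [⟨1, e⟩, ⟨2, e⟩]
  · rcases hcorner (r.2.2 (Or.inl (by rw [e1, neg_neg]))) (by rw [surfX_neg, e1, neg_neg])
      (by rw [surfY_neg, e2]) with e | e
    · exact ⟨5, by rw [o5, ← e, neg_neg]⟩
    · exact ⟨6, by rw [o6, ← e, neg_neg]⟩
  · exact absurd ⟨e1, e2⟩ c2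

/-- The points on the lower horizontal edge. -/
lemma bottom_bounds (hρ : 0 < ρ) (hP : PeriodConditions a b t ρ) {x : ℝ}
    (hx : x ∈ Icc (-1 / t) (1 / t)) :
    surfY a b t ρ (cayley x) = 0 ∧ |surfX a b t ρ (cayley x)| ≤ boxX a b t ρ ∧
      (|surfX a b t ρ (cayley x)| = boxX a b t ρ → x = -1 / t ∨ x = 1 / t) := by
  obtain ⟨xk, y0, y3, y1, y2, -⟩ := vertex_positions h hρ hP
  have hX := surfX_strictAntiOn h hρ
  have ht : -1 / t ≤ 1 / t := hx.1.trans hx.2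
  have e3 : surfX a b t ρ (cayley ((-1 / t : ℝ) : ℂ)) = boxX a b t ρ := xk 3 (by simp)
  have e4 : surfX a b t ρ (cayley ((1 / t : ℝ) : ℂ)) = -boxX a b t ρ := by
    have : cayley ((1 / t : ℝ) : ℂ) = -cayley (vtx a b t 0) := (cayley_vtx_opposite h).1
    rw [this, surfX_neg, boxX]
  have hle := hX.antitoneOn ⟨le_rfl, ht⟩ hx hx.1
  have hge := hX.antitoneOn hx ⟨ht, le_rfl⟩ hx.2
  simp only [e3, e4] at hle hge
  refine ⟨by rw [surfY_bottom_eq h hρ hx, y3], abs_le.2 ⟨hge, hle⟩, fun e => ?_⟩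
  rcases eq_or_eq_neg_of_abs_eq e with e | e
  · exact Or.inl (hX.injOn hx ⟨le_rfl, ht⟩ (by simp only [e, e3]))
  · exact Or.inr (hX.injOn hx ⟨ht, le_rfl⟩ (by simp only [e, e4]))

/-- The points on the two horizontal edges. -/
lemma top_bounds (hρ : 0 < ρ) (hP : PeriodConditions a b t ρ) {ζ : ℂ}
    (hζ : ζ ∈ closedBall (0 : ℂ) 1) (hZ : topHeight a b t ≤ |surfZ a b t ζ|) :
    |surfZ a b t ζ| = topHeight a b t ∧ surfY a b t ρ ζ = 0 ∧ |surfX a b t ρ ζ| ≤ boxX a b t ρ ∧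
      (|surfX a b t ρ ζ| = boxX a b t ρ → ∃ k, ζ = cayley (vtx a b t k)) := by
  have hT := topHeight_pos h
  obtain ⟨o4, -, -, o7⟩ := cayley_vtx_opposite h
  rcases level_cases h hζ with ⟨h1, -⟩ | ⟨h1, x, hx, rfl⟩ | ⟨h1, x, hx, rfl⟩
  · exact absurd hZ (not_le.2 h1)
  · obtain ⟨b1, b2, b3⟩ := bottom_bounds h hρ hP hx
    refine ⟨by rw [h1, abs_neg, abs_of_pos hT], b1, b2, fun e => ?_⟩
    rcases b3 e with rfl | rfl
    exacts [⟨3, rfl⟩, ⟨4, rfl⟩]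
  · obtain ⟨b1, b2, b3⟩ := bottom_bounds h hρ hP hx
    rw [surfX_neg, surfY_neg, abs_neg, b1, neg_zero]
    refine ⟨by rw [h1, abs_of_pos hT], rfl, b2, fun e => ?_⟩
    rcases b3 e with rfl | rfl
    · exact ⟨7, o7.symm⟩
    · refine ⟨0, ?_⟩
      rw [← neg_neg (cayley (vtx a b t 0)), ← o4]
      rfl

/-- The height selects a level curve or a horizontal edge, and the x-coordinate is strictly monotone
along each of these. No period condition is needed. -/
lemma surf_injOn (hρ : 0 < ρ) : InjOn (surf a b t ρ) (closedBall 0 1) := by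
  have hT := topHeight_pos h
  have hcomp : ∀ {ζ ξ : ℂ}, surf a b t ρ ζ = surf a b t ρ ξ →
      surfX a b t ρ ζ = surfX a b t ρ ξ ∧ surfZ a b t ζ = surfZ a b t ξ := by
    intro ζ ξ e
    have e0 := congrArg (fun p : E3 => p 0) e
    have e2 := congrArg (fun p : E3 => p 2) e
    simp only [surf_apply] at e0 e2
    exact ⟨e0, e2⟩
  intro ζ hζ ξ hξ e
  obtain ⟨e0, e2⟩ := hcomp e
  rcases level_cases h hζ with ⟨h1, s, θ, hθ, rfl⟩ | ⟨h1, x, hx, rfl⟩ | ⟨h1, x, hx, rfl⟩ <;>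
    rcases level_cases h hξ with ⟨h2, u, η, hη, rfl⟩ | ⟨h2, y, hy, rfl⟩ | ⟨h2, y, hy, rfl⟩
  · obtain ⟨r, hr, huniq, hX, -⟩ := exists_level_curve h hρ h1
    obtain rfl := huniq θ hθ s rfl
    obtain rfl := huniq η hη u e2.symm
    obtain rfl := hX.injOn hθ hη e0
    rfl
  · rw [e2, h2, abs_neg, abs_of_pos hT] at h1
    exact absurd h1 (lt_irrefl _)
  · rw [e2, h2, abs_of_pos hT] at h1
    exact absurd h1 (lt_irrefl _)
  · rw [← e2, h1, abs_neg, abs_of_pos hT] at h2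
    exact absurd h2 (lt_irrefl _)
  · rw [(surfX_strictAntiOn h hρ).injOn hx hy e0]
  · linarith
  · rw [← e2, h1, abs_of_pos hT] at h2
    exact absurd h2 (lt_irrefl _)
  · linarith
  · rw [surfX_neg, surfX_neg, neg_inj] at e0
    rw [(surfX_strictAntiOn h hρ).injOn hx hy e0]

end

noncomputable section

open Filter Topology

/-! ### The derivative of the surface -/

lemma evenProduct_mul {d : Fin 4 → ℂ} (hd : ∀ k, ‖d k‖ = 1) (e f : Fin 4 → ℝ) {ζ : ℂ}
    (hζ : ζ ∈ closedBall (0 : ℂ) 1 \ squareRoots d) :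
    evenProduct d e ζ * evenProduct d f ζ = evenProduct d (fun k => e k + f k) ζ := by
  rw [evenProduct, evenProduct, evenProduct, ← Finset.prod_mul_distrib]
  refine Finset.prod_congr rfl fun k _ => ?_
  rw [Complex.ofReal_add,
    Complex.cpow_add _ _ (Complex.slitPlane_ne_zero (one_sub_sq_div_mem_slitPlane hd hζ k))]

/-- The nullity relation holds up to the punctured circle because the exponents add factor by
factor; the constant is compared at z = i. -/
lemma disk1_mul_disk2 {a b t ρ : ℝ} (hρ : 0 < ρ) {ζ : ℂ}
    (hζ : ζ ∈ closedBall (0 : ℂ) 1 \ corners a b t) :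
    disk1 a b t ρ ζ * disk2 a b t ρ ζ = disk3 a b t ζ ^ 2 := by
  have e1 := evenProduct_mul (norm_cornerSq a b t)
    (fun k => ((![-1, 1, -1, -1] : Fin 4 → ℤ) k : ℝ) / 2)
    (fun k => ((![-1, -1, 1, -1] : Fin 4 → ℤ) k : ℝ) / 2) hζ
  have e2 := evenProduct_mul (norm_cornerSq a b t)
    (fun k => ((![-1, 0, 0, -1] : Fin 4 → ℤ) k : ℝ) / 2)
    (fun k => ((![-1, 0, 0, -1] : Fin 4 → ℤ) k : ℝ) / 2) hζ
  have e3 : (fun k => ((![-1, 1, -1, -1] : Fin 4 → ℤ) k : ℝ) / 2 +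
      ((![-1, -1, 1, -1] : Fin 4 → ℤ) k : ℝ) / 2) = fun k =>
      ((![-1, 0, 0, -1] : Fin 4 → ℤ) k : ℝ) / 2 + ((![-1, 0, 0, -1] : Fin 4 → ℤ) k : ℝ) / 2 := by
    funext k
    fin_cases k <;> norm_num
  have e4 := phi1_mul_phi2 hρ (mem_punctured_of_im_pos (a := a) (b := b) (t := t) (z := Complex.I)
    (by simp))
  rw [disk1, disk2, disk3]
  rw [e3, ← e2] at e1
  linear_combination (2 * Complex.I * phi1 a b t ρ Complex.I) *
    (2 * Complex.I * phi2 a b t ρ Complex.I) * e1 + (2 * Complex.I) ^ 2 *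
    evenProduct (cornerSq a b t) (fun k => ((![-1, 0, 0, -1] : Fin 4 → ℤ) k : ℝ) / 2) ζ ^ 2 * e4

lemma disk3_ne_zero {a b t : ℝ} {ζ : ℂ} (hζ : ζ ∈ closedBall (0 : ℂ) 1 \ corners a b t) :
    disk3 a b t ζ ≠ 0 := by
  refine mul_ne_zero (mul_ne_zero (by simp) ?_) (evenProduct_ne_zero (norm_cornerSq a b t) _ hζ)
  exact dh_ne_zero (mem_punctured_of_im_pos (a := a) (b := b) (t := t) (z := Complex.I) (by simp))

/-- The real-linear functional `v ↦ Re (w v)`. -/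
def reMul (w : ℂ) : ℂ →L[ℝ] ℝ := Complex.reCLM.comp (w • ContinuousLinearMap.id ℝ ℂ)

lemma reMul_apply (w v : ℂ) : reMul w v = (w * v).re := by simp [reMul]

/-- The real-linear map whose components are the real parts of multiples of the forms. -/
def weierstrassDeriv (F₁ F₂ F₃ : ℂ) : ℂ →L[ℝ] E3 :=
  (EuclideanSpace.equiv (Fin 3) ℝ).symm.toContinuousLinearMap.comp
    (ContinuousLinearMap.pi
      ![reMul ((F₂ - F₁) / 2), reMul (Complex.I / 2 * (F₂ + F₁)), reMul F₃])

lemma weierstrassDeriv_apply (F₁ F₂ F₃ v : ℂ) : weierstrassDeriv F₁ F₂ F₃ v =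
    !₂[((F₂ - F₁) / 2 * v).re, (Complex.I / 2 * (F₂ + F₁) * v).re, (F₃ * v).re] := by
  ext i
  fin_cases i <;> simp [weierstrassDeriv, reMul_apply]

/-- The sum of the squares of the three components is F₃² - F₁F₂ = 0, which removes the complex
bilinear part of the pulled back metric. The Hermitian part is the conformal factor, positive since
F₃ ≠ 0. -/
lemma isConformalMap_weierstrassDeriv {F₁ F₂ F₃ : ℂ} (h : F₁ * F₂ = F₃ ^ 2) (h3 : F₃ ≠ 0) {c : ℝ}
    (hc : c ≠ 0) : IsConformalMap (c • weierstrassDeriv F₁ F₂ F₃) := by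
  rw [isConformalMap_iff]
  refine ⟨c ^ 2 * ((Complex.normSq F₁ + Complex.normSq F₂) / 4 + Complex.normSq F₃ / 2), ?_,
    fun u v => ?_⟩
  · have := Complex.normSq_pos.2 h3
    have := Complex.normSq_nonneg F₁
    have := Complex.normSq_nonneg F₂
    positivity
  · have hre := congrArg Complex.re h
    have him := congrArg Complex.im h
    simp only [Complex.mul_re, Complex.mul_im, sq] at hre him
    simp only [smul_apply, weierstrassDeriv_apply, inner_smul_left,
      inner_smul_right, PiLp.inner_apply, Fin.sum_univ_three, Complex.inner, Complex.normSq_apply]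
    simp
    linear_combination (c ^ 2 * (-(u.re * v.re - u.im * v.im) / 2)) * hre +
      (c ^ 2 * ((u.re * v.im + u.im * v.re) / 2)) * him

variable {a b t ρ : ℝ} (h : Admissible a b t)
include h

lemma hasFDerivWithinAt_surf {ζ : ℂ} (hζ : ζ ∈ closedBall (0 : ℂ) 1 \ corners a b t) :
    HasFDerivWithinAt (surf a b t ρ)
      (weierstrassDeriv (disk1 a b t ρ ζ) (disk2 a b t ρ ζ) (disk3 a b t ζ)) (closedBall 0 1) ζ := by
  have hcl : IsClosed (corners a b t) := by
    have : corners a b t = ⋃ k, {ζ : ℂ | ζ ^ 2 = cornerSq a b t k} := by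
      ext; simp [squareRoots]
    rw [this]
    exact isClosed_iUnion_of_finite fun k => isClosed_eq (by fun_prop) continuous_const
  -- The finite union defining the corners is closed, so derivatives within the punctured disk are
  -- derivatives within the closed disk.
  have hm : closedBall (0 : ℂ) 1 \ corners a b t ∈ 𝓝[closedBall 0 1] ζ :=
    inter_mem_nhdsWithin _ (hcl.isOpen_compl.mem_nhds hζ.2)
  have d1 := (halfSingular_disk1 h ρ).hasDerivWithinAt_radialPrimitive hζ |>.mono_of_mem_nhdsWithin hm
  have d2 := (halfSingular_disk2 h ρ).hasDerivWithinAt_radialPrimitive hζ |>.mono_of_mem_nhdsWithin hm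
  have d3 := (halfSingular_disk3 h).hasDerivWithinAt_radialPrimitive hζ |>.mono_of_mem_nhdsWithin hm
  have key : ∀ {f : ℂ → ℂ} {f' : ℂ}, HasDerivWithinAt f f' (closedBall 0 1) ζ →
      HasFDerivWithinAt (fun z => (f z).re) (reMul f') (closedBall 0 1) ζ := by
    intro f f' hf
    refine (Complex.reCLM.hasFDerivAt.comp_hasFDerivWithinAt ζ
      (hf.hasFDerivWithinAt.restrictScalars ℝ)).congr_fderiv ?_
    ext v; simp [reMul, mul_comm]
  rw [hasFDerivWithinAt_euclidean]
  intro i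
  fin_cases i
  · exact (key ((d2.sub d1).div_const 2)).congr_fderiv (by ext; simp [weierstrassDeriv])
  · exact (key ((d2.add d1).const_mul (Complex.I / 2))).congr_fderiv
      (by ext; simp [weierstrassDeriv])
  · exact (key d3).congr_fderiv (by ext; simp [weierstrassDeriv])

lemma fderivWithin_smul_surf (c : ℝ) {ζ : ℂ} (hζ : ζ ∈ closedBall (0 : ℂ) 1 \ corners a b t) :
    fderivWithin ℝ (fun ζ => c • surf a b t ρ ζ) (closedBall 0 1) ζ =
      c • weierstrassDeriv (disk1 a b t ρ ζ) (disk2 a b t ρ ζ) (disk3 a b t ζ) := by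
  refine ((hasFDerivWithinAt_surf h hζ).const_smul c).fderivWithin ?_
  exact uniqueDiffOn_convex (convex_closedBall _ _) (by simp [interior_closedBall]) ζ hζ.1

/-- The punctured disk is convex with nonempty interior, so the one-sided complex derivatives are
unique, and they are the continuous functions F. -/
lemma contDiffOn_surf : ContDiffOn ℝ 1 (surf a b t ρ) (closedBall 0 1 \ corners a b t) := by
  have hsub := squareRoots_subset_sphere (norm_cornerSq a b t)
  have hU : UniqueDiffOn ℂ (closedBall (0 : ℂ) 1 \ corners a b t) :=
    uniqueDiffOn_convex_of_isRCLikeNormedField (convex_closedBall_diff hsub)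
      ⟨0, interior_mono (ball_subset_diff hsub) (by rw [isOpen_ball.interior_eq]; simp)⟩
  have key : ∀ {F : ℂ → ℂ}, HalfSingular (corners a b t) F →
      ContDiffOn ℝ 1 (radialPrimitive F) (closedBall 0 1 \ corners a b t) := by
    intro F hF
    have : ContDiffOn ℂ 1 (radialPrimitive F) (closedBall 0 1 \ corners a b t) := by
      rw [contDiffOn_one_iff_derivWithin hU]
      refine ⟨fun ζ hζ => (hF.hasDerivWithinAt_radialPrimitive hζ).differentiableWithinAt, ?_⟩
      exact hF.differentiableOn.continuousOn.congr fun ζ hζ =>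
        (hF.hasDerivWithinAt_radialPrimitive hζ).derivWithin (hU ζ hζ)
    exact this.restrict_scalars ℝ
  have k1 := key (halfSingular_disk1 h ρ)
  have k2 := key (halfSingular_disk2 h ρ)
  have k3 := key (halfSingular_disk3 h)
  rw [contDiffOn_euclidean]
  intro i
  fin_cases i
  · exact Complex.reCLM.contDiff.comp_contDiffOn ((k2.sub k1).div_const 2)
  · exact Complex.reCLM.contDiff.comp_contDiffOn (contDiffOn_const.mul (k2.add k1))
  · exact Complex.reCLM.contDiff.comp_contDiffOn k3

lemma harmonicOnNhd_smul_surf (c : ℝ) :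
    InnerProductSpace.HarmonicOnNhd (fun ζ => c • surf a b t ρ ζ) (ball 0 1) := by
  intro ζ hζ
  have key : ∀ {F : ℂ → ℂ}, HalfSingular (corners a b t) F → AnalyticAt ℂ (radialPrimitive F) ζ := by
    intro F hF
    refine DifferentiableOn.analyticAt (s := ball 0 1) (fun z hz => ?_) (isOpen_ball.mem_nhds hζ)
    exact (hF.hasDerivAt_radialPrimitive hz).differentiableAt.differentiableWithinAt
  have k1 := key (halfSingular_disk1 h ρ)
  have k2 := key (halfSingular_disk2 h ρ)
  have k3 := key (halfSingular_disk3 h)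
  have hX : InnerProductSpace.HarmonicAt (surfX a b t ρ) ζ :=
    ((k2.sub k1).div_const).harmonicAt_re
  have hY : InnerProductSpace.HarmonicAt (surfY a b t ρ) ζ :=
    (analyticAt_const.mul (k2.add k1)).harmonicAt_re
  have hZ : InnerProductSpace.HarmonicAt (surfZ a b t) ζ := k3.harmonicAt_re
  have hl := ((hX.comp_CLM (ContinuousLinearMap.toSpanSingleton ℝ (EuclideanSpace.single 0 1 : E3))).add
    (hY.comp_CLM (ContinuousLinearMap.toSpanSingleton ℝ (EuclideanSpace.single 1 1 : E3)))).add
    (hZ.comp_CLM (ContinuousLinearMap.toSpanSingleton ℝ (EuclideanSpace.single 2 1 : E3)))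
  have e : (fun ζ => c • surf a b t ρ ζ) = c • (
      ⇑(ContinuousLinearMap.toSpanSingleton ℝ (EuclideanSpace.single 0 1 : E3)) ∘ surfX a b t ρ +
      ⇑(ContinuousLinearMap.toSpanSingleton ℝ (EuclideanSpace.single 1 1 : E3)) ∘ surfY a b t ρ +
      ⇑(ContinuousLinearMap.toSpanSingleton ℝ (EuclideanSpace.single 2 1 : E3)) ∘ surfZ a b t) := by
    funext ζ
    ext i
    fin_cases i <;> simp [surf]
  rw [e]
  exact hl.const_smul

end

noncomputable section

open Filter Topology

/-! ### The boundary arcs -/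

/-- The angle of the image of a real number under the Cayley transform. -/
def cayleyAngle (x : ℝ) : ℝ := Real.pi + 2 * Real.arctan x

lemma cayleyAngle_strictMono : StrictMono cayleyAngle := fun _ _ hxy =>
  add_lt_add_right (mul_lt_mul_of_pos_left (Real.arctan_strictMono hxy) two_pos) _

lemma circlePt_add_pi (s : ℝ) : circlePt (s + Real.pi) = -circlePt s := by
  rw [circlePt, circlePt]
  push_cast
  rw [add_mul, Complex.exp_add, Complex.exp_pi_mul_I]
  ring

/-- Here exp(2i arctan x) = (1 + ix)²/(1 + x²) = (1 + ix)/(1 - ix), which is minus the Cayley image;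
the term π supplies the sign. -/
lemma circlePt_cayleyAngle (x : ℝ) : circlePt (cayleyAngle x) = cayley x := by
  have hx := add_I_ne_zero (z := (x : ℂ)) (by simp)
  have hq : (Real.sqrt (1 + x ^ 2) : ℂ) ≠ 0 := by
    have : 0 < 1 + x ^ 2 := by positivity
    exact_mod_cast (Real.sqrt_pos.2 this).ne'
  have hs : (Real.sqrt (1 + x ^ 2) : ℂ) ^ 2 = 1 + x ^ 2 := by
    have : 0 ≤ 1 + x ^ 2 := by positivity
    exact_mod_cast Real.sq_sqrt this
  have e : Complex.exp (Real.arctan x * Complex.I) = (1 + x * Complex.I) / Real.sqrt (1 + x ^ 2) := by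
    rw [Complex.exp_mul_I, ← Complex.ofReal_cos, ← Complex.ofReal_sin, Real.cos_arctan,
      Real.sin_arctan]
    push_cast
    field_simp
  have e2 : Complex.exp (((2 * Real.arctan x : ℝ) : ℂ) * Complex.I) =
      Complex.exp (Real.arctan x * Complex.I) ^ 2 := by
    rw [← Complex.exp_nat_mul]
    push_cast
    ring_nf
  rw [cayleyAngle, add_comm, circlePt_add_pi, circlePt, e2, e, div_pow, hs, cayley]
  have h1 : (1 + (x : ℂ) ^ 2) ≠ 0 := by rw [← hs]; exact pow_ne_zero 2 hq
  rw [← neg_div, div_eq_div_iff h1 hx]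
  linear_combination (-(x : ℂ) ^ 3 - (x : ℂ) ^ 2 * Complex.I - 2 * x) *
    Complex.I_sq

/-- For negative x no multiple of 2π intervenes, so opposite corners have angles differing by
exactly π. -/
lemma cayleyAngle_neg_inv {x : ℝ} (hx : x < 0) :
    cayleyAngle (-1 / x) = cayleyAngle x + Real.pi := by
  have h1 := Real.arctan_inv_of_neg hx
  have : Real.arctan (-1 / x) = -Real.arctan x⁻¹ := by
    rw [← Real.arctan_neg, neg_div, one_div]
  rw [cayleyAngle, cayleyAngle, this, h1]
  ring

/-- Points of the unit circle with angles between two given ones. -/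
lemma exists_cayley_of_mem_Ioo {v w s : ℝ} (hs : s ∈ Ioo (cayleyAngle v) (cayleyAngle w)) :
    ∃ x ∈ Ioo v w, circlePt s = cayley (x : ℝ) := by
  obtain ⟨h1, h2⟩ := hs
  rw [cayleyAngle] at h1 h2
  have hv := Real.neg_pi_div_two_lt_arctan v
  have hw := Real.arctan_lt_pi_div_two w
  have e : Real.arctan (Real.tan ((s - Real.pi) / 2)) = (s - Real.pi) / 2 :=
    Real.arctan_tan (by linarith) (by linarith)
  refine ⟨Real.tan ((s - Real.pi) / 2), ⟨?_, ?_⟩, ?_⟩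
  · rw [← Real.arctan_strictMono.lt_iff_lt, e]
    linarith
  · rw [← Real.arctan_strictMono.lt_iff_lt, e]
    linarith
  · rw [← circlePt_cayleyAngle, cayleyAngle, e]
    ring_nf

/-- The angles of the corners. -/
def cornerAngle (a b t : ℝ) : Fin 9 → ℝ :=
  Fin.snoc (α := fun _ => ℝ) (fun k => cayleyAngle (vtx a b t k)) (cayleyAngle (vtx a b t 0) + 2 * Real.pi)

variable {a b t ρ : ℝ}

lemma cornerAngle_castSucc (k : Fin 8) :
    cornerAngle a b t k.castSucc = cayleyAngle (vtx a b t k) := by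
  rw [cornerAngle, Fin.snoc_castSucc]

lemma cornerAngle_last : cornerAngle a b t 8 = cornerAngle a b t 0 + 2 * Real.pi := by
  have h0 : cornerAngle a b t 0 = cayleyAngle (vtx a b t 0) := cornerAngle_castSucc 0
  rw [h0]
  exact Fin.snoc_last (α := fun _ => ℝ) _ _

lemma corner_cornerAngle (k : Fin 8) : corner (cornerAngle a b t) k = cayley (vtx a b t k) := by
  rw [corner, cornerAngle_castSucc, circlePt_cayleyAngle]

variable (h : Admissible a b t)
include h

lemma cornerAngle_strictMono : StrictMono (cornerAngle a b t) := by
  rw [Fin.strictMono_iff_lt_succ]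
  intro k
  rw [cornerAngle_castSucc]
  refine Fin.lastCases ?_ (fun j => ?_) k
  · have e : cornerAngle a b t (Fin.last 7).succ = cornerAngle a b t 8 := rfl
    have h0 : cornerAngle a b t 0 = cayleyAngle (vtx a b t 0) := cornerAngle_castSucc 0
    rw [e, cornerAngle_last, h0, cayleyAngle, cayleyAngle]
    have := Real.neg_pi_div_two_lt_arctan (vtx a b t 0)
    have := Real.arctan_lt_pi_div_two (vtx a b t (Fin.last 7))
    linarith
  · rw [Fin.succ_castSucc, cornerAngle_castSucc]
    exact cayleyAngle_strictMono (h.vtx_strictMono j.castSucc_lt_succ)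

lemma range_corner : range (corner (cornerAngle a b t)) = corners a b t := by
  ext ζ
  constructor
  · rintro ⟨k, rfl⟩
    rw [corner_cornerAngle]
    refine Fin.addCases (m := 4) (n := 4) (fun j => ?_) (fun j => ?_) k
    · exact ⟨j, by rw [vtx_castAdd, cornerSq]⟩
    · exact ⟨j, by rw [cayley_vtx_natAdd h, vtx_castAdd, cornerSq, neg_sq]⟩
  · rintro ⟨j, hj⟩
    rw [cornerSq, sq_eq_sq_iff_eq_or_eq_neg] at hj
    rcases hj with hj | hj
    · exact ⟨Fin.castAdd 4 j, by rw [corner_cornerAngle, vtx_castAdd, hj]⟩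
    · exact ⟨Fin.natAdd 4 j, by rw [corner_cornerAngle, cayley_vtx_natAdd h, vtx_castAdd, hj]⟩

omit h in
/-- The points of the first seven arcs come from the real intervals between the vertices. -/
lemma exists_of_mem_arc (k : Fin 7) {ζ : ℂ} (hζ : ζ ∈ arc (cornerAngle a b t) k.castSucc) :
    ∃ x ∈ Ioo (vtx a b t k.castSucc) (vtx a b t k.succ), ζ = cayley (x : ℝ) := by
  obtain ⟨s, hs, rfl⟩ := hζ
  rw [Fin.succ_castSucc, cornerAngle_castSucc, cornerAngle_castSucc] at hs
  exact exists_cayley_of_mem_Ioo hs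

omit h in
lemma cayley_mem_arc (k : Fin 7) {x : ℝ}
    (hx : x ∈ Ioo (vtx a b t k.castSucc) (vtx a b t k.succ)) :
    cayley x ∈ arc (cornerAngle a b t) k.castSucc := by
  refine ⟨cayleyAngle x, ?_, circlePt_cayleyAngle x⟩
  rw [Fin.succ_castSucc, cornerAngle_castSucc, cornerAngle_castSucc]
  exact ⟨cayleyAngle_strictMono hx.1, cayleyAngle_strictMono hx.2⟩

lemma cornerAngle_add_pi :
    cornerAngle a b t 4 = cornerAngle a b t 0 + Real.pi ∧
      cornerAngle a b t 5 = cornerAngle a b t 1 + Real.pi ∧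
      cornerAngle a b t 6 = cornerAngle a b t 2 + Real.pi ∧
      cornerAngle a b t 7 = cornerAngle a b t 3 + Real.pi ∧
      cornerAngle a b t 8 = cornerAngle a b t 4 + Real.pi := by
  have key : ∀ j : Fin 4, cornerAngle a b t (Fin.natAdd 4 j).castSucc =
      cornerAngle a b t (Fin.castAdd 4 j).castSucc + Real.pi := by
    intro j
    rw [cornerAngle_castSucc, cornerAngle_castSucc, vtx_castAdd, vtx_natAdd,
      cayleyAngle_neg_inv (h.node_neg j)]
  have k0 : cornerAngle a b t 4 = cornerAngle a b t 0 + Real.pi := key 0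
  refine ⟨k0, key 1, key 2, key 3, ?_⟩
  rw [cornerAngle_last, k0]
  ring

/-- Opposite arcs. -/
lemma mem_arc_opposite {ζ : ℂ} : (ζ ∈ arc (cornerAngle a b t) 4 ↔ -ζ ∈ arc (cornerAngle a b t) 0) ∧
    (ζ ∈ arc (cornerAngle a b t) 5 ↔ -ζ ∈ arc (cornerAngle a b t) 1) ∧
    (ζ ∈ arc (cornerAngle a b t) 6 ↔ -ζ ∈ arc (cornerAngle a b t) 2) ∧
    (ζ ∈ arc (cornerAngle a b t) 7 ↔ -ζ ∈ arc (cornerAngle a b t) 3) := by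
  obtain ⟨e4, e5, e6, e7, e8⟩ := cornerAngle_add_pi h
  have key : ∀ p q : ℝ, ζ ∈ circlePt '' Ioo (p + Real.pi) (q + Real.pi) ↔ -ζ ∈ circlePt '' Ioo p q := by
    intro p q
    constructor
    · rintro ⟨s, hs, rfl⟩
      refine ⟨s - Real.pi, ⟨by linarith [hs.1], by linarith [hs.2]⟩, ?_⟩
      have := circlePt_add_pi (s - Real.pi)
      rw [sub_add_cancel] at this
      rw [this, neg_neg]
    · rintro ⟨s, hs, e⟩
      refine ⟨s + Real.pi, ⟨by linarith [hs.1], by linarith [hs.2]⟩, ?_⟩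
      rw [circlePt_add_pi, e, neg_neg]
  have k0 := key (cornerAngle a b t 0) (cornerAngle a b t 1)
  have k1 := key (cornerAngle a b t 1) (cornerAngle a b t 2)
  have k2 := key (cornerAngle a b t 2) (cornerAngle a b t 3)
  have k3 := key (cornerAngle a b t 3) (cornerAngle a b t 4)
  rw [← e4, ← e5] at k0
  rw [← e5, ← e6] at k1
  rw [← e6, ← e7] at k2
  rw [← e7, ← e8] at k3
  exact ⟨k0, k1, k2, k3⟩

/-- Along an arc, the derivative of the surface in terms of the forms on the real axis. -/
lemma weierstrassDeriv_cayley (hρ : 0 < ρ) {x : ℝ} (hx : (x : ℂ) ∈ puncturedHalfPlane a b t) (v : ℂ) :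
    weierstrassDeriv (disk1 a b t ρ (cayley x)) (disk2 a b t ρ (cayley x)) (disk3 a b t (cayley x))
      (2 * Complex.I / ((x : ℂ) + Complex.I) ^ 2 * v) =
      !₂[((phi2 a b t ρ x - phi1 a b t ρ x) / 2 * v).re,
        (Complex.I / 2 * (phi2 a b t ρ x + phi1 a b t ρ x) * v).re, (dh t x * v).re] := by
  rw [weierstrassDeriv_apply, phi1_eq_disk1 h hρ hx, phi2_eq_disk2 h hρ hx, dh_eq_disk3 h hx]
  generalize 2 * Complex.I / ((x : ℂ) + Complex.I) ^ 2 = κ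
  have e1 : ∀ F₁ F₂ : ℂ, (F₂ - F₁) / 2 * (κ * v) = (F₂ * κ - F₁ * κ) / 2 * v := fun _ _ => by ring
  have e2 : ∀ F₁ F₂ : ℂ, Complex.I / 2 * (F₂ + F₁) * (κ * v) =
      Complex.I / 2 * (F₂ * κ + F₁ * κ) * v := fun _ _ => by ring
  rw [e1, e2, ← mul_assoc]

/-- Along the edges in the faces `x = const`, the tangent planes contain the `x`-direction. -/
lemma single_zero_mem_range (hρ : 0 < ρ) {k : Fin 7} (hk : k = 0 ∨ k = 2) {x : ℝ}
    (hx : x ∈ Ioo (vtx a b t k.castSucc) (vtx a b t k.succ)) :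
    EuclideanSpace.single 0 (1 : ℝ) ∈ range (weierstrassDeriv (disk1 a b t ρ (cayley x))
      (disk2 a b t ρ (cayley x)) (disk3 a b t (cayley x))) := by
  obtain ⟨p, q, r, hp, hq, hr, e1, e2, e3⟩ := h.edge_forms hρ hx
  have d : edgeDir1 k = -Complex.I ∧ edgeDir2 k = Complex.I ∧ edgeDir3 k = -1 := by
    rcases hk with rfl | rfl <;> simp [edgeDir1, edgeDir2, edgeDir3]
  rw [d.1] at e1
  rw [d.2.1] at e2
  rw [d.2.2] at e3
  have hpq : p + q ≠ 0 := by positivity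
  obtain ⟨s, hs⟩ : ∃ s, (p + q) * s = -2 := ⟨-2 / (p + q), mul_div_cancel₀ _ hpq⟩
  -- The preimage is the direction i s normal to the real axis. There `dh` and the form of the
  -- y-coordinate are real, so only the x-component survives, and s normalizes it to 1.
  refine ⟨_, (weierstrassDeriv_cayley h hρ (h.mem_punctured hx) (Complex.I * (s : ℂ))).trans ?_⟩
  rw [e1, e2, e3]
  ext i
  fin_cases i
  · simp
    linarith
  · simp
  · simp

/-- Along the edge in the face `y = const`, the tangent planes contain the `y`-direction. -/
lemma single_one_mem_range (hρ : 0 < ρ) {x : ℝ}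
    (hx : x ∈ Ioo (vtx a b t (1 : Fin 7).castSucc) (vtx a b t (1 : Fin 7).succ)) :
    EuclideanSpace.single 1 (1 : ℝ) ∈ range (weierstrassDeriv (disk1 a b t ρ (cayley x))
      (disk2 a b t ρ (cayley x)) (disk3 a b t (cayley x))) := by
  obtain ⟨p, q, r, hp, hq, hr, e1, e2, e3⟩ := h.edge_forms hρ hx
  have hpq : p + q ≠ 0 := by positivity
  obtain ⟨s, hs⟩ : ∃ s, (p + q) * s = 2 := ⟨2 / (p + q), mul_div_cancel₀ _ hpq⟩
  refine ⟨_, (weierstrassDeriv_cayley h hρ (h.mem_punctured hx) (Complex.I * (s : ℂ))).trans ?_⟩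
  rw [e1, e2, e3]
  ext i
  fin_cases i
  · simp [edgeDir1, edgeDir2]
  · simp [edgeDir1, edgeDir2]
    linarith
  · simp [edgeDir3]

end

noncomputable section

open Filter Topology

/-! ### The octagon -/

variable {a b t ρ : ℝ} (h : Admissible a b t)
include h

lemma isMinimalDisk_surf (hρ : 0 < ρ) {c : ℝ} (hc : 0 < c) :
    IsMinimalDisk (fun ζ => c • surf a b t ρ ζ) (cornerAngle a b t)
      ((fun ζ => c • surf a b t ρ ζ) '' closedBall 0 1)
      (fun k => c • surf a b t ρ (cayley (vtx a b t k))) where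
  strictMono := cornerAngle_strictMono h
  closes_up := cornerAngle_last
  continuousOn := (continuousOn_surf h).const_smul c
  injOn := fun _ hζ _ hξ e => surf_injOn h hρ hζ hξ (smul_right_injective E3 hc.ne' e)
  image_eq := rfl
  harmonic := harmonicOnNhd_smul_surf h c
  contDiffOn := by
    rw [range_corner h]
    exact (contDiffOn_surf h).const_smul c
  conformal := by
    rw [range_corner h]
    intro ζ hζ
    rw [fderivWithin_smul_surf h c hζ]
    exact isConformalMap_weierstrassDeriv (disk1_mul_disk2 hρ hζ) (disk3_ne_zero hζ) hc.ne'
  vertex := fun k => by rw [corner_cornerAngle]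

/-- The free boundary condition in terms of the unscaled surface. -/
lemma freeBoundary_of {c : ℝ} (hc : 0 < c) {γ : Set ℂ} {i : Fin 3} {m : ℝ}
    (hγ : ∀ ζ ∈ γ, ζ ∈ closedBall (0 : ℂ) 1 \ corners a b t ∧ surf a b t ρ ζ i = m ∧
      EuclideanSpace.single i (1 : ℝ) ∈
        range (weierstrassDeriv (disk1 a b t ρ ζ) (disk2 a b t ρ ζ) (disk3 a b t ζ))) :
    FreeBoundary (fun ζ => c • surf a b t ρ ζ) γ i (c * m) := by
  intro ζ hζ
  obtain ⟨h1, h2, v, hv⟩ := hγ ζ hζ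
  refine ⟨by simp [h2], c⁻¹ • v, ?_⟩
  rw [fderivWithin_smul_surf h c h1, smul_apply, map_smul, hv, smul_inv_smul₀ hc.ne']

omit h in
/-- The data of the free boundary condition on an arc and on the opposite arc. -/
lemma freeBoundary_data_neg {ζ : ℂ} {i : Fin 3} {m : ℝ}
    (hζ : -ζ ∈ closedBall (0 : ℂ) 1 \ corners a b t ∧ surf a b t ρ (-ζ) i = m ∧
      EuclideanSpace.single i (1 : ℝ) ∈
        range (weierstrassDeriv (disk1 a b t ρ (-ζ)) (disk2 a b t ρ (-ζ)) (disk3 a b t (-ζ)))) :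
    ζ ∈ closedBall (0 : ℂ) 1 \ corners a b t ∧ surf a b t ρ ζ i = -m ∧
      EuclideanSpace.single i (1 : ℝ) ∈
        range (weierstrassDeriv (disk1 a b t ρ ζ) (disk2 a b t ρ ζ) (disk3 a b t ζ)) := by
  obtain ⟨h1, h2, h3⟩ := hζ
  rw [disk1_neg, disk2_neg, disk3_neg] at h3
  rw [surf_neg, PiLp.neg_apply] at h2
  refine ⟨⟨by simpa using h1.1, fun hm => h1.2 ?_⟩, by linarith, h3⟩
  obtain ⟨k, hk⟩ := hm
  exact ⟨k, by rw [neg_sq, hk]⟩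

lemma freeBoundary_data_x (hρ : 0 < ρ) (hP : PeriodConditions a b t ρ) {k : Fin 7}
    (hk : k = 0 ∨ k = 2) {ζ : ℂ} (hζ : ζ ∈ arc (cornerAngle a b t) k.castSucc) :
    ζ ∈ closedBall (0 : ℂ) 1 \ corners a b t ∧ surf a b t ρ ζ 0 = boxX a b t ρ ∧
      EuclideanSpace.single 0 (1 : ℝ) ∈
        range (weierstrassDeriv (disk1 a b t ρ ζ) (disk2 a b t ρ ζ) (disk3 a b t ζ)) := by
  obtain ⟨x, hx, rfl⟩ := exists_of_mem_arc k hζ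
  refine ⟨h.cayley_mem (h.mem_punctured hx), ?_, single_zero_mem_range h hρ hk hx⟩
  rw [(surf_apply _).1]
  have o := h.order
  have e1 : -1 / b = -(1 / b) := neg_div _ _
  have e2 : -1 / t = -(1 / t) := neg_div _ _
  rcases hk with rfl | rfl
  · have h1 : -t < x := hx.1
    have h2 : x < -a := hx.2
    exact (left_boundary h hρ hP ⟨h1.le, by linarith⟩).1 (Or.inl ⟨h1.le, h2.le⟩)
  · have h1 : -1 / b < x := hx.1
    have h2 : x < -1 / t := hx.2
    exact (left_boundary h hρ hP ⟨by linarith, h2.le⟩).1 (Or.inr ⟨h1.le, h2.le⟩)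

lemma freeBoundary_data_y (hρ : 0 < ρ) (hP : PeriodConditions a b t ρ) {ζ : ℂ}
    (hζ : ζ ∈ arc (cornerAngle a b t) 1) :
    ζ ∈ closedBall (0 : ℂ) 1 \ corners a b t ∧ surf a b t ρ ζ 1 = -boxY a b t ρ ∧
      EuclideanSpace.single 1 (1 : ℝ) ∈
        range (weierstrassDeriv (disk1 a b t ρ ζ) (disk2 a b t ρ ζ) (disk3 a b t ζ)) := by
  obtain ⟨x, hx, rfl⟩ := exists_of_mem_arc 1 hζ
  refine ⟨h.cayley_mem (h.mem_punctured hx), ?_, single_one_mem_range h hρ hx⟩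
  rw [(surf_apply _).2.1]
  have o := h.order
  have e1 : -1 / b = -(1 / b) := neg_div _ _
  have e2 : -1 / t = -(1 / t) := neg_div _ _
  have h1 : -a < x := hx.1
  have h2 : x < -1 / b := hx.2
  exact (left_boundary h hρ hP ⟨by linarith, by linarith⟩).2.1 ⟨h1.le, h2.le⟩

/-- The image of the arc over the lower horizontal edge. -/
lemma image_arc_bottom (hρ : 0 < ρ) (hP : PeriodConditions a b t ρ) {c : ℝ} (hc : 0 < c)
    (hcT : c * topHeight a b t = 1) :
    (fun ζ => c • surf a b t ρ ζ) '' arc (cornerAngle a b t) 3 =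
      openSegmentAt (c * boxX a b t ρ) (-1) := by
  have ht : -1 / t < 1 / t := by
    have o := h.order
    rw [neg_div]
    linarith
  have e3 : surfX a b t ρ (cayley ((-1 / t : ℝ) : ℂ)) = boxX a b t ρ :=
    (vertex_positions h hρ hP).1 3 (by simp)
  have e4 : surfX a b t ρ (cayley ((1 / t : ℝ) : ℂ)) = -boxX a b t ρ := by
    have : cayley ((1 / t : ℝ) : ℂ) = -cayley (vtx a b t 0) := (cayley_vtx_opposite h).1
    rw [this, surfX_neg, boxX]
  ext p
  constructor
  · rintro ⟨ζ, hζ, rfl⟩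
    obtain ⟨x, hx, rfl⟩ := exists_of_mem_arc 3 hζ
    have hx' : x ∈ Ioo (-1 / t) (1 / t) := hx
    obtain ⟨b1, b2, b3⟩ := bottom_bounds h hρ hP (Ioo_subset_Icc_self hx')
    refine ⟨?_, ?_, ?_⟩
    · rw [PiLp.smul_apply, (surf_apply _).1, smul_eq_mul, abs_mul, abs_of_pos hc]
      refine mul_lt_mul_of_pos_left (lt_of_le_of_ne b2 fun e => ?_) hc
      rcases b3 e with e | e
      exacts [hx'.1.ne' e, hx'.2.ne e]
    · simp [(surf_apply _).2.1, b1]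
    · rw [PiLp.smul_apply, (surf_apply _).2.2, surfZ_bottom h (Ioo_subset_Icc_self hx'),
        smul_eq_mul, mul_neg, hcT]
  · rintro ⟨h1, h2, h3⟩
    -- Every x-value strictly between the end values is attained on the open arc, by the
    -- intermediate value theorem.
    have hp : p 0 / c ∈ Ioo (-boxX a b t ρ) (boxX a b t ρ) := by
      rw [abs_lt] at h1
      rw [mem_Ioo, lt_div_iff₀ hc, div_lt_iff₀ hc]
      constructor <;> linarith
    rw [← e4, ← e3] at hp
    obtain ⟨x, hx, ex⟩ := intermediate_value_Ioo' ht.le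
      ((continuous_surfX_real (ρ := ρ) h).continuousOn (s := Icc (-1 / t) (1 / t))) hp
    refine ⟨cayley x, cayley_mem_arc 3 hx, ?_⟩
    obtain ⟨b1, -, -⟩ := bottom_bounds h hρ hP (Ioo_subset_Icc_self hx)
    simp only at ex
    ext i
    fin_cases i
    · simp only [Fin.zero_eta, PiLp.smul_apply, (surf_apply _).1, ex, smul_eq_mul]
      exact mul_div_cancel₀ _ hc.ne'
    · simp [(surf_apply _).2.1, b1, h2]
    · simp only [Fin.reduceFinMk, PiLp.smul_apply, (surf_apply _).2.2,
        surfZ_bottom h (Ioo_subset_Icc_self hx), smul_eq_mul, mul_neg, hcT, h3]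

omit h in
lemma neg_mem_openSegmentAt {A m : ℝ} {p : E3} : p ∈ openSegmentAt A m ↔ -p ∈ openSegmentAt A (-m) := by
  simp [openSegmentAt]

lemma image_arc_top (hρ : 0 < ρ) (hP : PeriodConditions a b t ρ) {c : ℝ} (hc : 0 < c)
    (hcT : c * topHeight a b t = 1) :
    (fun ζ => c • surf a b t ρ ζ) '' arc (cornerAngle a b t) 7 =
      openSegmentAt (c * boxX a b t ρ) 1 := by
  ext p
  rw [neg_mem_openSegmentAt, ← image_arc_bottom h hρ hP hc hcT]
  constructor
  · rintro ⟨ζ, hζ, rfl⟩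
    exact ⟨-ζ, (mem_arc_opposite h).2.2.2.1 hζ, by simp [surf_neg]⟩
  · rintro ⟨ζ, hζ, e⟩
    refine ⟨-ζ, (mem_arc_opposite h).2.2.2.2 (by rwa [neg_neg]), ?_⟩
    simp only [surf_neg, smul_neg]
    rw [← neg_neg p, ← e]

/-- Points strictly between the horizontal edges are handled by `level_bounds` and points of extreme
height by `top_bounds`. At extreme height y = 0, so such a point meets an edge of the box only where
|x| is maximal, that is, at a vertex. -/
lemma isBoxOctagon_surf (hρ : 0 < ρ) (hP : PeriodConditions a b t ρ) {c : ℝ} (hc : 0 < c)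
    (hcT : c * topHeight a b t = 1) :
    IsBoxOctagon (c * boxX a b t ρ) (c * boxY a b t ρ)
      ((fun ζ => c • surf a b t ρ ζ) '' closedBall 0 1)
      (fun k => c • surf a b t ρ (cayley (vtx a b t k))) := by
  have hB := boxY_pos h hρ hP
  obtain ⟨xk, y0, y3, y1, y2, hA⟩ := vertex_positions h hρ hP
  have hT := topHeight_pos h
  have hco : ∀ ζ : ℂ, (c • surf a b t ρ ζ) 0 = c * surfX a b t ρ ζ ∧
      (c • surf a b t ρ ζ) 1 = c * surfY a b t ρ ζ ∧ (c • surf a b t ρ ζ) 2 = c * surfZ a b t ζ := by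
    intro ζ
    simp [surf_apply]
  have habs : ∀ y m : ℝ, (|c * y| ≤ c * m ↔ |y| ≤ m) ∧ (|c * y| = c * m ↔ |y| = m) := by
    intro y m
    rw [abs_mul, abs_of_pos hc]
    exact ⟨mul_le_mul_iff_right₀ hc, mul_right_inj' hc.ne'⟩
  have hbox : ∀ ζ ∈ closedBall (0 : ℂ) 1,
      c • surf a b t ρ ζ ∈ box (c * boxX a b t ρ) (c * boxY a b t ρ) := by
    intro ζ hζ
    obtain ⟨e0, e1, e2⟩ := hco ζ
    rw [box, mem_ofPred_eq, e0, e1, e2, ← hcT, (habs _ _).1, (habs _ _).1, (habs _ _).1]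
    rcases lt_or_ge |surfZ a b t ζ| (topHeight a b t) with hZ | hZ
    · obtain ⟨b1, b2, -⟩ := level_bounds h hρ hP hζ hZ
      exact ⟨b1, b2, hZ.le⟩
    · obtain ⟨b1, b2, b3, -⟩ := top_bounds h hρ hP hζ hZ
      exact ⟨b3, by rw [b2, abs_zero]; exact hB.le, b1.le⟩
  have hfd : IsMinimalDisk (fun ζ => c • surf a b t ρ ζ) (cornerAngle a b t) _ _ :=
    isMinimalDisk_surf h hρ hc
  obtain ⟨o4, o5, o6, o7⟩ := cayley_vtx_opposite h
  refine ⟨mul_pos hc hA, mul_pos hc hB, ?_, ⟨_, _, hfd, ?_, ?_, ?_, ?_, ?_, ?_, ?_, ?_⟩, ?_, ?_, ?_⟩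
  · rintro _ ⟨ζ, hζ, rfl⟩
    exact hbox ζ hζ
  · exact freeBoundary_of h hc fun ζ hζ => freeBoundary_data_x h hρ hP (k := 0) (Or.inl rfl) hζ
  · rw [← mul_neg]
    exact freeBoundary_of h hc fun ζ hζ => freeBoundary_data_y h hρ hP hζ
  · exact freeBoundary_of h hc fun ζ hζ => freeBoundary_data_x h hρ hP (k := 2) (Or.inr rfl) hζ
  · exact image_arc_bottom h hρ hP hc hcT
  · rw [← mul_neg]
    exact freeBoundary_of h hc fun ζ hζ => freeBoundary_data_neg
      (freeBoundary_data_x h hρ hP (k := 0) (Or.inl rfl) ((mem_arc_opposite h).1.1 hζ))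
  · rw [← neg_neg (boxY a b t ρ)]
    exact freeBoundary_of h hc fun ζ hζ => freeBoundary_data_neg
      (freeBoundary_data_y h hρ hP ((mem_arc_opposite h).2.1.1 hζ))
  · rw [← mul_neg]
    exact freeBoundary_of h hc fun ζ hζ => freeBoundary_data_neg
      (freeBoundary_data_x h hρ hP (k := 2) (Or.inr rfl) ((mem_arc_opposite h).2.2.1.1 hζ))
  · exact image_arc_top h hρ hP hc hcT
  · ext p
    constructor
    · rintro ⟨⟨ζ, hζ, rfl⟩, -, hp⟩
      obtain ⟨e0, e1, e2⟩ := hco ζ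
      rw [e0, e1, e2, ← hcT, (habs _ _).2, (habs _ _).2, (habs _ _).2] at hp
      suffices ∃ k, ζ = cayley (vtx a b t k) by
        obtain ⟨k, rfl⟩ := this
        exact ⟨k, rfl⟩
      rcases lt_or_ge |surfZ a b t ζ| (topHeight a b t) with hZ | hZ
      · rcases hp with hp | hp | hp
        · exact (level_bounds h hρ hP hζ hZ).2.2.2.2 hp.1 hp.2
        · exact absurd hp.2 hZ.ne
        · exact absurd hp.2 hZ.ne
      · obtain ⟨b1, b2, b3, b4⟩ := top_bounds h hρ hP hζ hZ
        rw [b2, abs_zero] at hp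
        rcases hp with hp | hp | hp
        · exact b4 hp.1
        · exact b4 hp.1
        · exact absurd hp.1 hB.ne
    · rintro ⟨k, rfl⟩
      have hk : cayley (vtx a b t k) ∈ closedBall (0 : ℂ) 1 := cayley_mem_closedBall (by simp)
      refine ⟨⟨_, hk, rfl⟩, hbox _ hk, ?_⟩
      obtain ⟨e0, e1, e2⟩ := hco (cayley (vtx a b t k))
      rw [e0, e1, e2, ← hcT, (habs _ _).2, (habs _ _).2, (habs _ _).2]
      have z3 : surfZ a b t (cayley (vtx a b t 3)) = -topHeight a b t :=
        surfZ_bottom h (x := -1 / t) ⟨le_rfl, by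
          have o := h.order
          rw [neg_div]
          linarith⟩
      have q0 : |surfX a b t ρ (cayley (vtx a b t 0))| = boxX a b t ρ := abs_of_pos hA
      have q : ∀ k : Fin 8, k = 1 ∨ k = 2 ∨ k = 3 →
          |surfX a b t ρ (cayley (vtx a b t k))| = boxX a b t ρ := fun k hk => by
        rw [xk k hk, abs_of_pos hA]
      have w1 : |surfY a b t ρ (cayley (vtx a b t 1))| = boxY a b t ρ := by
        rw [y1, abs_neg, abs_of_pos hB]
      have w2 : |surfY a b t ρ (cayley (vtx a b t 2))| = boxY a b t ρ := by
        rw [y2, abs_neg, abs_of_pos hB]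
      have z0 : |surfZ a b t (cayley (vtx a b t 0))| = topHeight a b t := abs_of_pos hT
      have z3' : |surfZ a b t (cayley (vtx a b t 3))| = topHeight a b t := by
        rw [z3, abs_neg, abs_of_pos hT]
      fin_cases k
      · exact Or.inr (Or.inl ⟨q0, z0⟩)
      · exact Or.inl ⟨q 1 (by simp), w1⟩
      · exact Or.inl ⟨q 2 (by simp), w2⟩
      · exact Or.inr (Or.inl ⟨q 3 (by simp), z3'⟩)
      · simp only [Fin.reduceFinMk, o4, surfX_neg, surfY_neg, surfZ_neg, abs_neg]
        exact Or.inr (Or.inl ⟨q0, z0⟩)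
      · simp only [Fin.reduceFinMk, o5, surfX_neg, surfY_neg, surfZ_neg, abs_neg]
        exact Or.inl ⟨q 1 (by simp), w1⟩
      · simp only [Fin.reduceFinMk, o6, surfX_neg, surfY_neg, surfZ_neg, abs_neg]
        exact Or.inl ⟨q 2 (by simp), w2⟩
      · simp only [Fin.reduceFinMk, o7, surfX_neg, surfY_neg, surfZ_neg, abs_neg]
        exact Or.inr (Or.inl ⟨q 3 (by simp), z3'⟩)
  · rintro _ ⟨ζ, hζ, rfl⟩
    obtain ⟨e0, e1, e2⟩ := hco ζ
    simp only [e0, e1, ← mul_neg, mul_right_inj' hc.ne']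
    rcases lt_or_ge |surfZ a b t ζ| (topHeight a b t) with hZ | hZ
    · obtain ⟨-, -, b3, b4, -⟩ := level_bounds h hρ hP hζ hZ
      exact ⟨b3, b4⟩
    · obtain ⟨-, b2, -⟩ := top_bounds h hρ hP hζ hZ
      rw [b2]
      exact ⟨fun e => hB.ne e.2, fun e => by linarith [e.2]⟩
  · rintro _ ⟨ζ, hζ, rfl⟩
    exact ⟨-ζ, by simpa using hζ, by simp [surf_neg]⟩

/-- The surface is already in standard position: a dilation that brings the horizontal edges to
heights ±1 suffices, and the isometry is the identity. -/
lemma isFundamentalOctagon_of_periodConditions (hρ : 0 < ρ) (hP : PeriodConditions a b t ρ) :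
    IsFundamentalOctagonUpToSimilarity (weierstrassImage a b t ρ) (weierstrassVertex a b t ρ) := by
  have hT := topHeight_pos h
  have hO := isBoxOctagon_surf h hρ hP (inv_pos.2 hT) (inv_mul_cancel₀ hT.ne')
  have hF : IsFundamentalOctagonOf
      ((fun p => AffineIsometryEquiv.refl ℝ E3 ((topHeight a b t)⁻¹ • p)) '' weierstrassImage a b t ρ)
      (fun k => AffineIsometryEquiv.refl ℝ E3 ((topHeight a b t)⁻¹ • weierstrassVertex a b t ρ k))
      (extendedSurface ((topHeight a b t)⁻¹ * boxX a b t ρ) ((topHeight a b t)⁻¹ * boxY a b t ρ)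
        ((fun p => AffineIsometryEquiv.refl ℝ E3 ((topHeight a b t)⁻¹ • p)) ''
          weierstrassImage a b t ρ)) := by
    refine ⟨_, _, ?_, rfl⟩
    simp only [AffineIsometryEquiv.coe_refl, id, weierstrassVertex_eq h hρ]
    rw [weierstrassImage_eq h hρ, image_image]
    exact hO
  exact ⟨_, _, inv_pos.2 hT, _, ⟨_, _, hF⟩, hF⟩

end

theorem mainTheorem8 (a b t : ℝ) (ha : 0 < a) (hb : 0 < b) (ht : 1 < t)
    (hta : 1 / t < 1 / a) (hab : 1 / a < b) (hbt : b < t) :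
    -- the edge lengths are well-defined positive numbers
    (∀ ρ : ℝ, 0 < ρ → ∀ k : Fin 7,
      IntervalIntegrable (fun x : ℝ => phi1 a b t ρ (x : ℂ)) MeasureTheory.volume
        (vtx a b t k.castSucc) (vtx a b t k.succ) ∧
      IntervalIntegrable (fun x : ℝ => phi2 a b t ρ (x : ℂ)) MeasureTheory.volume
        (vtx a b t k.castSucc) (vtx a b t k.succ) ∧
      0 < edgeI a b t ρ k ∧ 0 < edgeJ a b t ρ k) ∧
    -- the Weierstrass image is the octagon of a surface in the class iff the periods close
    (∀ ρ : ℝ, 0 < ρ →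
      (IsFundamentalOctagonUpToSimilarity (weierstrassImage a b t ρ) (weierstrassVertex a b t ρ) ↔
        PeriodConditions a b t ρ)) ∧
    -- the two quotients depend on `a`, `b`, `t` only
    (∀ ρ σ : ℝ, 0 < ρ → 0 < σ →
      quotI a b t ρ = quotI a b t σ ∧ quotJ a b t ρ = quotJ a b t σ) ∧
    -- elimination of the Lopez-Ros factor
    (∀ σ : ℝ, 0 < σ →
      (quotI a b t σ = quotJ a b t σ ↔ quotQ a b t σ = 0) ∧
      (quotQ a b t σ = 0 ↔ ∃ ρ : ℝ, 0 < ρ ∧ PeriodConditions a b t ρ) ∧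
      (quotQ a b t σ = 0 → ∃! ρ : ℝ, 0 < ρ ∧ PeriodConditions a b t ρ)) := by
  have h : Admissible a b t := ⟨ha, hb, ht, lt_of_one_div_lt_one_div (by linarith) hta, hab, hbt⟩
  have hI1 := (edge1 h one_pos 1).2.2
  have hJ1 := (edge2 h one_pos 1).2.2
  have huniq : quotI a b t 1 = quotJ a b t 1 → ∃! ρ : ℝ, 0 < ρ ∧ PeriodConditions a b t ρ := by
    intro hQ
    have hpos : 0 < edgeJ a b t 1 1 / edgeI a b t 1 1 := div_pos hJ1 hI1
    -- The equation ρI₂ = ρ⁻¹J₂, with I₂ and J₂ taken at ρ = 1, has this single positive root;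
    -- equality of the quotients then gives the other condition.
    refine ⟨Real.sqrt (edgeJ a b t 1 1 / edgeI a b t 1 1), ⟨Real.sqrt_pos.2 hpos, ?_⟩, ?_⟩
    · rw [periodConditions_iff h (Real.sqrt_pos.2 hpos)]
      exact ⟨hQ, Real.sq_sqrt hpos.le⟩
    · rintro ρ ⟨hρ, hP⟩
      rw [periodConditions_iff h hρ] at hP
      rw [← hP.2, Real.sqrt_sq hρ.le]
  refine ⟨fun ρ hρ k => ⟨(edge1 h hρ k).1, (edge2 h hρ k).1, (edge1 h hρ k).2.2, (edge2 h hρ k).2.2⟩,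
    fun ρ hρ => ⟨periodConditions_of_isFundamentalOctagon h hρ,
      isFundamentalOctagon_of_periodConditions h hρ⟩,
    fun ρ σ hρ hσ => ⟨by rw [quotI_eq hρ, quotI_eq hσ], by rw [quotJ_eq hρ, quotJ_eq hσ]⟩,
    fun σ hσ => ?_⟩
  rw [quotQ, sub_eq_zero, quotI_eq hσ, quotJ_eq hσ]
  refine ⟨Iff.rfl, ⟨fun hQ => (huniq hQ).exists, ?_⟩, huniq⟩
  rintro ⟨ρ, hρ, hP⟩
  exact ((periodConditions_iff h hρ).1 hP).1
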